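/- **Theorem 5.1.** Let $A$ be a finite dimensional Hopf algebra over a field $k$ with bijective antipode $\gamma$, with a basis $(e_a)$ and dual basis $(e^a)$ of $A^*$; write $\bar\gamma=\gamma^{-1}$, $\bar\gamma^*$ for the transpose of $\bar\gamma$, and $\Delta(a)=\sum a'\otimes a''$. Let $H(A)=A^*\otimes A$ be the Heisenberg double, with unit $\varepsilon\otimes 1$ and product $(f\otimes a)(g\otimes b)=\sum f\,g(?\,a')\otimes a''b$, where $g(?\,a')$ is the functional $y\mapsto g(ya')$ and the product of $A^*$ is dual to $\Delta$. Identify $x\in A$ with $1\otimes x$ and $f\in A^*$ with $f\otimes 1$. *Colored diagrams.* A colored diagram is an oriented virtual tangle diagram with ordered components, each of which is thin or thick, obtained by pasting, horizontally and vertically, vertical strands, local maxima, local minima, real crossings and virtual crossings ("symmetries"). At a crossing the two lines go from top left to bottom right ($\backslash$) and from top right to bottom left ($/$), each with arbitrary orientation and thickness; a real crossing is of kind $X$ if $/$ passes over, and of kind $\bar X$ if $\backslash$ passes over. For $\mu,\nu\in\{\pm\}^n$ let $\mathcal{CD}(\mu;\nu)$ be the set of diagrams whose $i$th component is thin iff $\mu_i=+$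 and has non-empty boundary iff $\nu_i=+$. *The map $J'$.* Put $H_i=H(A)$ if $\mu_i=+$ and $H_i=H(A)^{\mathrm{op}}$ if $\mu_i=-$; put $H_i^{\nu_i}=H_i$ if $\nu_i=+$, and $H_i^{\nu_i}=H_i/\mathrm{Span}_k\{xy-yx\}$ if $\nu_i=-$. At a real crossing choose a basis index $a$. The under strand gets the label $e_a$, to which $\gamma$ is applied once if this strand is thick, once if the crossing is of kind $\bar X$, and once if this strand is directed upwards. The over strand gets the label $e^a$, to which $\bar\gamma^*$ is applied once if this strand is thick and once if it is directed upwards. (Before the labels of upward strands are changed, a crossing of kind $X$ thus carries $S=\sum e_a\otimes e^a$, $S'=\sum\gamma(e_a)\otimes e^a$, $S''=\sum e_a\otimes\bar\gamma^*(e^a)$ or $\tilde S=\sum\gamma(e_a)\otimes\bar\gamma^*(e^a)$, according to the thicknesses, and a crossing of kind $\bar X$ carries the inverse of that tensor.) Maxima, minima and virtual crossings get no label. For $Z\in\mathcal{CD}(\mu;\nu)$, $$J'(Z)\in\bigotimes_{i=1}^n H_i^{\nu_i}$$ is the sum over all choices of indices of the tensor whose $i$th factor is the product in $H_i$ of the labels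 met along the $i$th component, read against the orientation (from any base point if the component is closed) and written from left to right. *Moves.* The colored moves are the following replacements inside a diagram; orientations and thicknesses of strands are arbitrary unless specified, components keep their numbers, and local diagrams are read from top to bottom. 1. *Colored Pachner $(2,3)$ moves.* Three strands $x,m,y$ appear in this order from left to right at the top and in the order $y,m,x$ at the bottom, and all real crossings are of kind $X$; let $(pq)$ denote a real and $(pq)^v$ a virtual crossing of the strands $p$ and $q$. If $m$ is thin and directed downwards or thick and directed upwards, then $(my),(xy),(xm)\leftrightarrow(xm),(xy)^v,(my)$. If $m$ is thick and directed downwards or thin and directed upwards, then $(xm),(xy),(my)\leftrightarrow(my),(xy)^v,(xm)$. 2. *Colored $(0,2)$ moves.* A crossing of kind $X$ followed directly below by one of kind $\bar X$ of the same two strands, or in the other order, $\leftrightarrow$ two vertical strands. 3. *Symmetry moves.* Removal of a virtual kink; cancellation of two consecutive virtual crossings of the same two strands; passing a strand that meets two others only virtually across a (real or virtual) crossing of these two. 4. *Planar isotopies.* Insertion or deletion of a row of vertical strands; changing the relative heights of horizontally adjacent parts; straightening of a zigzag formed by a maximum and a minimum; moving a strand that crosses one leg of a local maximum or minimum (over,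 under or virtually) to the other leg, which it then crosses in the same way. Let $\sim_c$ be the equivalence relation generated by all colored moves. Let $\sim'_c$ be the equivalence relation generated by all colored moves except the following ones: moving a strand from one leg to the other of a local maximum or minimum that is oriented from left to right, when the crossings are real; and the colored Pachner $(2,3)$ moves whose middle strand $m$ is directed upwards. *Claim.* For all $\mu,\nu$ and all $Z,Z'\in\mathcal{CD}(\mu;\nu)$: if $Z\sim'_c Z'$, then $J'(Z)=J'(Z')$. If $\gamma^2=1$, then $Z\sim_c Z'$ also implies $J'(Z)=J'(Z')$. -/

import Mathlib

open scoped TensorProduct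

noncomputable section

/-! ### The Heisenberg double -/

/-- The underlying vector space `A* ⊗ A` of the Heisenberg double `H(A)`. -/
def HeisenbergDouble (k A : Type*) [Field k] [Ring A] [HopfAlgebra k A] : Type _ :=
  Module.Dual k A ⊗[k] A

namespace HeisenbergDouble

section

variable {k A : Type*} [Field k] [Ring A] [HopfAlgebra k A]

instance : AddCommGroup (HeisenbergDouble k A) :=
  inferInstanceAs (AddCommGroup (Module.Dual k A ⊗[k] A))

instance : Module k (HeisenbergDouble k A) :=
  inferInstanceAs (Module k (Module.Dual k A ⊗[k] A))

/-- The pure tensor `f ⊗ a` in `H(A)`. -/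
def mk (f : Module.Dual k A) (a : A) : HeisenbergDouble k A := f ⊗ₜ[k] a

variable (k A) in
/-- The product of the dual Hopf algebra: `(f g)(x) = ∑ f(x') g(x'')`. -/
def dualMul : Module.Dual k A →ₗ[k] Module.Dual k A →ₗ[k] Module.Dual k A :=
  LinearMap.mk₂ k
    (fun f g => LinearMap.mul' k k ∘ₗ TensorProduct.map f g ∘ₗ Coalgebra.comul)
    (fun f f' g => by simp [TensorProduct.map_add_left, LinearMap.comp_add, LinearMap.add_comp])
    (fun c f g => by simp [TensorProduct.map_smul_left, LinearMap.comp_smul, LinearMap.smul_comp])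
    (fun f g g' => by simp [TensorProduct.map_add_right, LinearMap.comp_add, LinearMap.add_comp])
    (fun c f g => by simp [TensorProduct.map_smul_right, LinearMap.comp_smul, LinearMap.smul_comp])

variable (k A) in
/-- The functional `g(? a)`, that is `y ↦ g (y * a)`, as a bilinear map in `a` and `g`. -/
def translate : A →ₗ[k] Module.Dual k A →ₗ[k] Module.Dual k A :=
  LinearMap.mk₂ k (fun a g => g ∘ₗ LinearMap.mulRight k a)
    (fun a a' g => by ext; simp [mul_add])
    (fun c a g => by ext; simp)
    (fun a g g' => by ext; simp)
    (fun c a g => by ext; simp)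

@[simp] theorem translate_apply (a : A) (g : Module.Dual k A) (y : A) :
    translate k A a g y = g (y * a) := rfl

theorem dualMul_repr (f g : Module.Dual k A) {x : A} {J : Type*} (r : Coalgebra.Repr k x J) :
    dualMul k A f g x = ∑ i ∈ r.index, f (r.left i) * g (r.right i) := by
  simp [dualMul, ← r.eq]

variable (k A) in
/-- `x ⊗ y` acts on `A* ⊗ A` by `g ⊗ b ↦ g(? x) ⊗ y b`. -/
def pairAct : A ⊗[k] A →ₗ[k] Module.End k (Module.Dual k A ⊗[k] A) :=
  TensorProduct.homTensorHomMap (RingHom.id k) (Module.Dual k A) A (Module.Dual k A) A ∘ₗ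
    TensorProduct.map (translate k A) (LinearMap.mul k A)

@[simp] theorem pairAct_tmul (x y : A) (g : Module.Dual k A) (b : A) :
    pairAct k A (x ⊗ₜ y) (g ⊗ₜ b) = translate k A x g ⊗ₜ (y * b) := by
  simp [pairAct]

variable (k A) in
/-- Left multiplication as a linear map: `f ⊗ a` sends `g ⊗ b` to
`∑ f g(? a') ⊗ a'' b`. -/
def mulMap : Module.Dual k A ⊗[k] A →ₗ[k] Module.End k (Module.Dual k A ⊗[k] A) :=
  TensorProduct.lift ((LinearMap.mul k (Module.End k (Module.Dual k A ⊗[k] A))).compl₁₂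
    (LinearMap.rTensorHom A ∘ₗ dualMul k A) (pairAct k A ∘ₗ Coalgebra.comul))

theorem mulMap_tmul (f : Module.Dual k A) (a : A) (w : Module.Dual k A ⊗[k] A) :
    mulMap k A (f ⊗ₜ a) w =
      (dualMul k A f).rTensor A (pairAct k A (Coalgebra.comul a) w) := by
  simp [mulMap]

instance : Mul (HeisenbergDouble k A) := ⟨fun x y => mulMap k A x y⟩

instance : One (HeisenbergDouble k A) := ⟨mk Coalgebra.counit 1⟩

theorem one_def : (1 : HeisenbergDouble k A) = mk Coalgebra.counit 1 := rfl

/-- The defining formula `(f ⊗ a)(g ⊗ b) = ∑ f g(? a') ⊗ a'' b`. -/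
theorem mk_mul_mk (f g : Module.Dual k A) (a b : A) {J : Type*} (r : Coalgebra.Repr k a J) :
    mk f a * mk g b =
      ∑ i ∈ r.index, mk (dualMul k A f (translate k A (r.left i) g)) (r.right i * b) := by
  change mulMap k A (f ⊗ₜ a) (g ⊗ₜ b) = ∑ i ∈ r.index, _ ⊗ₜ[k] _
  rw [mulMap_tmul, ← r.eq]
  simp [map_sum, LinearMap.sum_apply]

theorem dualMul_assoc (f g h : Module.Dual k A) :
    dualMul k A (dualMul k A f g) h = dualMul k A f (dualMul k A g h) :=
  congrArg WithConv.ofConv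
    (mul_assoc (WithConv.toConv f) (WithConv.toConv g) (WithConv.toConv h))

theorem counit_dualMul (f : Module.Dual k A) : dualMul k A Coalgebra.counit f = f :=
  congrArg WithConv.ofConv (one_mul (WithConv.toConv f))

theorem dualMul_counit (f : Module.Dual k A) : dualMul k A f Coalgebra.counit = f :=
  congrArg WithConv.ofConv (mul_one (WithConv.toConv f))

theorem pairAct_mul (s t : A ⊗[k] A) : pairAct k A (s * t) = pairAct k A s * pairAct k A t := by
  induction s with
  | zero => simp
  | add s s' hs hs' => simp [add_mul, hs, hs']
  | tmul x y =>
    induction t with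
    | zero => simp
    | add t t' ht ht' => simp [mul_add, ht, ht']
    | tmul x' y' =>
      refine TensorProduct.ext' fun g b => ?_
      have : translate k A (x * x') g = translate k A x (translate k A x' g) := by
        ext; simp [mul_assoc]
      simp [mul_assoc, this]

theorem translate_dualMul (a : A) (g p : Module.Dual k A) {J : Type*}
    (r : Coalgebra.Repr k a J) :
    translate k A a (dualMul k A g p) =
      ∑ i ∈ r.index, dualMul k A (translate k A (r.left i) g) (translate k A (r.right i) p) := by
  ext y
  have hy := Coalgebra.Repr.arbitrary k y
  simp only [LinearMap.sum_apply, dualMul_repr _ _ hy, translate_apply]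
  simp only [dualMul, LinearMap.mk₂_apply, LinearMap.comp_apply, Bialgebra.comul_mul, ← hy.eq,
    ← r.eq, Finset.sum_mul_sum, map_sum, Algebra.TensorProduct.tmul_mul_tmul,
    TensorProduct.map_tmul, LinearMap.mul'_apply]
  exact Finset.sum_comm

theorem pairAct_comul_rTensor (a : A) (g : Module.Dual k A) (w : Module.Dual k A ⊗[k] A)
    {J : Type*} (r : Coalgebra.Repr k a J) :
    pairAct k A (Coalgebra.comul a) ((dualMul k A g).rTensor A w) =
      ∑ i ∈ r.index, (dualMul k A (translate k A (r.left i) g)).rTensor A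
        (pairAct k A (Coalgebra.comul (r.right i)) w) := by
  induction w with
  | zero => simp
  | add w w' hw hw' => simp [hw, hw', Finset.sum_add_distrib]
  | tmul p q =>
    -- both sides are the value of one trilinear map on the iterated coproduct
    let Φ : A →ₗ[k] A →ₗ[k] A →ₗ[k] Module.Dual k A ⊗[k] A :=
      LinearMap.mk₂ k (fun x y => (TensorProduct.mk k _ _
          (dualMul k A (translate k A x g) (translate k A y p))) ∘ₗ LinearMap.mulRight k q)
        (by intros; ext; simp) (by intros; ext; simp)
        (by intros; ext; simp) (by intros; ext; simp)
    let Ψ : A ⊗[k] (A ⊗[k] A) →ₗ[k] Module.Dual k A ⊗[k] A :=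
      TensorProduct.lift ((TensorProduct.lift.equiv (RingHom.id k) A A
        (Module.Dual k A ⊗[k] A)).toLinearMap ∘ₗ Φ)
    have hΨ : ∀ x y z, Ψ (x ⊗ₜ (y ⊗ₜ z)) =
        dualMul k A (translate k A x g) (translate k A y p) ⊗ₜ (z * q) := by
      intros; simp [Ψ, Φ]
    have h := congrArg Ψ (Coalgebra.sum_tmul_tmul_eq r
      (fun i => Coalgebra.Repr.arbitrary k (r.left i))
      (fun i => Coalgebra.Repr.arbitrary k (r.right i)))
    simp only [map_sum, hΨ] at h
    calc _ = ∑ i ∈ r.index, (translate k A (r.left i) (dualMul k A g p)) ⊗ₜ[k] (r.right i * q) := by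
            conv_lhs => rw [← r.eq]
            simp [map_sum, LinearMap.sum_apply]
      _ = _ := by
            simp only [translate_dualMul _ g p (Coalgebra.Repr.arbitrary k (r.left _)),
              TensorProduct.sum_tmul]
            rw [h]
            refine Finset.sum_congr rfl fun i _ => ?_
            conv_rhs => rw [← (Coalgebra.Repr.arbitrary k (r.right i)).eq]
            simp [map_sum, LinearMap.sum_apply]

theorem mulMap_mulMap (x y z : Module.Dual k A ⊗[k] A) :
    mulMap k A (mulMap k A x y) z = mulMap k A x (mulMap k A y z) := by
  induction x with
  | zero => simp
  | add x x' h h' => simp [h, h']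
  | tmul f a =>
    induction y with
    | zero => simp
    | add y y' h h' => simp [h, h']
    | tmul g b =>
      have r := Coalgebra.Repr.arbitrary k a
      rw [mulMap_tmul g b z, mulMap_tmul f a _, mulMap_tmul f a _, pairAct_comul_rTensor a g _ r]
      conv_lhs => rw [← r.eq]
      simp only [map_sum, LinearMap.sum_apply, pairAct_tmul, LinearMap.rTensor_tmul, mulMap_tmul,
        Bialgebra.comul_mul, pairAct_mul, Module.End.mul_apply]
      refine Finset.sum_congr rfl fun i _ => ?_
      have hc : dualMul k A (dualMul k A f (translate k A (r.left i) g)) =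
          dualMul k A f ∘ₗ dualMul k A (translate k A (r.left i) g) := by
        ext1 h; exact dualMul_assoc _ _ _
      rw [hc, LinearMap.rTensor_comp, LinearMap.comp_apply]

theorem mulMap_one (x : Module.Dual k A ⊗[k] A) : mulMap k A (Coalgebra.counit ⊗ₜ 1) x = x := by
  have : dualMul k A Coalgebra.counit = LinearMap.id := by ext1 f; exact counit_dualMul f
  rw [mulMap_tmul, this, LinearMap.rTensor_id, LinearMap.id_apply, Bialgebra.comul_one,
    Algebra.TensorProduct.one_def]
  induction x with
  | zero => simp
  | add x y hx hy => rw [map_add, hx, hy]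
  | tmul g b =>
    have : translate k A 1 g = g := by ext; simp
    rw [pairAct_tmul, one_mul, this]

theorem mulMap_apply_one (x : Module.Dual k A ⊗[k] A) :
    mulMap k A x (Coalgebra.counit ⊗ₜ 1) = x := by
  induction x with
  | zero => simp
  | add x y hx hy => rw [map_add, LinearMap.add_apply, hx, hy]
  | tmul f a =>
    have r := Coalgebra.Repr.arbitrary k a
    have ht : ∀ x : A, translate k A x Coalgebra.counit =
        (Coalgebra.counit (R := k) x) • (Coalgebra.counit : Module.Dual k A) := by
      intro x; ext y; simp [mul_comm]
    rw [mulMap_tmul, ← r.eq]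
    simp only [map_sum, LinearMap.sum_apply, pairAct_tmul, LinearMap.rTensor_tmul, ht,
      dualMul_counit, mul_one, TensorProduct.smul_tmul, ← TensorProduct.tmul_sum,
      Coalgebra.sum_counit_smul]

/-- The algebra structure of the Heisenberg double. -/
instance : Ring (HeisenbergDouble k A) where
  left_distrib x y z := (mulMap k A x).map_add y z
  right_distrib x y z := (mulMap k A).map_add₂ x y z
  zero_mul x := (mulMap k A).map_zero₂ x
  mul_zero x := (mulMap k A x).map_zero
  mul_assoc := mulMap_mulMap
  one_mul := mulMap_one
  mul_one := mulMap_apply_one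
  zsmul := zsmulRec
  neg_add_cancel := neg_add_cancel

instance : Algebra k (HeisenbergDouble k A) :=
  Algebra.ofModule (fun c x y => (mulMap k A).map_smul₂ c x y)
    (fun c x y => (mulMap k A x).map_smul c y)

/-- The embedding `x ↦ 1 ⊗ x` of `A` (the unit of `A*` is the counit of `A`). -/
def ofAlg (x : A) : HeisenbergDouble k A := mk Coalgebra.counit x

/-- The embedding `f ↦ f ⊗ 1` of `A*`. -/
def ofDual (f : Module.Dual k A) : HeisenbergDouble k A := mk f 1

end

end HeisenbergDouble

/-! ### Colored diagrams -/

namespace ColoredDiagrams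

/-- The thickness of a component. -/
inductive Thickness
  | thin
  | thick
deriving DecidableEq

/-- Whether a component is an arc, with two boundary points, or a closed curve. -/
inductive ComponentType
  | bounded
  | closed
deriving DecidableEq

/-- The vertical direction of a strand at a height at which it is not horizontal. -/
inductive Direction
  | down
  | up
deriving DecidableEq

/-- The opposite direction. -/
def Direction.rev : Direction → Direction
  | .down => .up
  | .up => .down

/-- A strand of a diagram with `n` ordered components, as seen at a given height: the component to
which it belongs and its direction. The thickness is a function of the component. -/
structure Strand (n : ℕ) where
  comp : Fin n
  dir : Direction
deriving DecidableEq

/-- The same component, with the opposite direction. -/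
def Strand.rev {n : ℕ} (a : Strand n) : Strand n := ⟨a.comp, a.dir.rev⟩

/-- The two kinds of real crossings, distinguished by the line that passes over, and the virtual
crossing (symmetry). In each of them one line runs from top left to bottom right, like a
backslash, and the other one from top right to bottom left, like a slash. If both strands
have the same vertical direction, `slashOver` is the positive crossing. -/
inductive CrossingKind
  | slashOver
  | backslashOver
  | virtual
deriving DecidableEq

/-- Exchange of over and under. -/
def CrossingKind.swap : CrossingKind → CrossingKind
  | .slashOver => .backslashOver
  | .backslashOver => .slashOver
  | .virtual => .virtual

/-- The elementary pieces: a vertical strand; a crossing, in which `a` runs between top left and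
bottom right and `b` between top right and bottom left; a local maximum and a local minimum
whose left leg is `a` and whose right leg is therefore `a.rev`. -/
inductive Piece (n : ℕ)
  | strand (a : Strand n)
  | crossing (κ : CrossingKind) (a b : Strand n)
  | max (a : Strand n)
  | min (a : Strand n)

/-- The strands at the top of a piece, from left to right. -/
def Piece.top {n : ℕ} : Piece n → List (Strand n)
  | .strand a => [a]
  | .crossing _ a b => [a, b]
  | .max _ => []
  | .min a => [a, a.rev]

/-- The strands at the bottom of a piece, from left to right. -/
def Piece.bot {n : ℕ} : Piece n → List (Strand n)
  | .strand a => [a]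
  | .crossing _ a b => [b, a]
  | .max a => [a, a.rev]
  | .min _ => []

/-- Pieces pasted horizontally, from left to right. -/
abbrev Row (n : ℕ) := List (Piece n)

/-- The strands at the top of a row. -/
def Row.top {n : ℕ} (r : Row n) : List (Strand n) := r.flatMap Piece.top

/-- The strands at the bottom of a row. -/
def Row.bot {n : ℕ} (r : Row n) : List (Strand n) := r.flatMap Piece.bot

/-- A row of vertical strands. -/
def idRow {n : ℕ} (w : List (Strand n)) : Row n := w.map Piece.strand

/-- A passage of a strand through a real crossing. A crossing is named by the coordinates of its
top left corner. -/
structure Passage where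
  crossing : ℕ × ℕ
  isOver : Bool
  kind : CrossingKind
  dir : Direction

/-- A piece of a strand, between two of the points at which the diagram meets the horizontal lines
that separate the rows. The point `(h, p)` is the `p`th point from the left on the `h`th line from
the top (both counted from `0`). An arc is directed from `src` to `tgt`. -/
structure Arc (n : ℕ) where
  src : ℕ × ℕ
  tgt : ℕ × ℕ
  comp : Fin n
  passage : Option Passage

/-- The arc of the strand `a` with ends `P` and `Q`, directed from `P` to `Q` if `a` is directed
downwards, and from `Q` to `P` otherwise. -/
def mkArc {n : ℕ} (a : Strand n) (P Q : ℕ × ℕ) (s : Option Passage) : Arc n :=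
  match a.dir with
  | .down => ⟨P, Q, a.comp, s⟩
  | .up => ⟨Q, P, a.comp, s⟩

/-- The arcs of a piece in row `h` whose first top point has position `t` and whose first bottom
point has position `u`. -/
def Piece.arcs {n : ℕ} (h t u : ℕ) : Piece n → List (Arc n)
  | .strand a => [mkArc a (h, t) (h + 1, u) none]
  | .crossing .slashOver a b =>
      [mkArc a (h, t) (h + 1, u + 1) (some ⟨(h, t), false, .slashOver, a.dir⟩),
        mkArc b (h, t + 1) (h + 1, u) (some ⟨(h, t), true, .slashOver, b.dir⟩)]
  | .crossing .backslashOver a b =>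
      [mkArc a (h, t) (h + 1, u + 1) (some ⟨(h, t), true, .backslashOver, a.dir⟩),
        mkArc b (h, t + 1) (h + 1, u) (some ⟨(h, t), false, .backslashOver, b.dir⟩)]
  | .crossing .virtual a b =>
      [mkArc a (h, t) (h + 1, u + 1) none, mkArc b (h, t + 1) (h + 1, u) none]
  | .max a => [mkArc a (h + 1, u + 1) (h + 1, u) none]
  | .min a => [mkArc a (h, t) (h, t + 1) none]

/-- The arcs of the part of row `h` that starts at the positions `t` (top) and `u` (bottom). -/
def rowArcs {n : ℕ} (h : ℕ) : ℕ → ℕ → Row n → List (Arc n)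
  | _, _, [] => []
  | t, u, p :: r => p.arcs h t u ++ rowArcs h (t + p.top.length) (u + p.bot.length) r

/-- The arcs of a stack of rows whose top row has number `h`. -/
def arcsFrom {n : ℕ} : ℕ → List (Row n) → List (Arc n)
  | _, [] => []
  | h, r :: rs => rowArcs h 0 0 r ++ arcsFrom (h + 1) rs

/-- The arcs of a stack of rows. -/
def arcs {n : ℕ} (rows : List (Row n)) : List (Arc n) := arcsFrom 0 rows

/-- The boundary points: the strands on the top line and on the bottom line. -/
def boundary {n : ℕ} (rows : List (Row n)) : List (Strand n) :=
  (rows.head?.map Row.top).getD [] ++ (rows.getLast?.map Row.bot).getD []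

/-- `l` lists the arcs carrying the label `i`, each of them once, in an order in which they are met
when one travels along the diagram following the orientation. -/
def IsTraversal {n : ℕ} (rows : List (Row n)) (i : Fin n) (l : List (Arc n)) : Prop :=
  l ≠ [] ∧ l.Perm ((arcs rows).filter fun x => x.comp = i) ∧
    l.IsChain fun x y => x.tgt = y.src

/-- Colored diagrams with `n` ordered components, the `i`th of which has thickness `μ i` and is of
type `ν i`: rows of elementary pieces, pasted vertically from top to bottom. -/
structure ColoredDiagram {n : ℕ} (μ : Fin n → Thickness) (ν : Fin n → ComponentType) where
  rows : List (Row n)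
  /-- Adjacent rows fit together, with components and orientations. -/
  fits : rows.IsChain fun r s => Row.bot r = Row.top s
  /-- The strands labelled `i` form exactly one component. -/
  connected : ∀ i, ∃ l, IsTraversal rows i l
  /-- The `i`th component has boundary if and only if `ν i` says so. -/
  type_eq : ∀ i, ν i = .bounded ↔ ∃ a ∈ boundary rows, a.comp = i

/-! ### The map `J'` -/

section Labels

variable (k A : Type*) [Field k] [Ring A] [HopfAlgebra k A]

/-- The algebra of a component: `H(A)` if it is thin and `H(A)ᵒᵖ` if it is thick. -/
def ColorAlgebra : Thickness → Type _
  | .thin => HeisenbergDouble k A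
  | .thick => (HeisenbergDouble k A)ᵐᵒᵖ

instance : (τ : Thickness) → Ring (ColorAlgebra k A τ)
  | .thin => inferInstanceAs (Ring (HeisenbergDouble k A))
  | .thick => inferInstanceAs (Ring (HeisenbergDouble k A)ᵐᵒᵖ)

instance : (τ : Thickness) → Algebra k (ColorAlgebra k A τ)
  | .thin => inferInstanceAs (Algebra k (HeisenbergDouble k A))
  | .thick => inferInstanceAs (Algebra k (HeisenbergDouble k A)ᵐᵒᵖ)

variable {k A} in
/-- An element of `H(A)`, regarded as an element of `H(A)` or of `H(A)ᵒᵖ`. -/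
def toColor : (τ : Thickness) → HeisenbergDouble k A → ColorAlgebra k A τ
  | .thin, x => x
  | .thick, x => MulOpposite.op x

/-- The span of the commutators of an algebra. -/
def commutatorSpan (R : Type*) [Ring R] [Algebra k R] : Submodule k R :=
  Submodule.span k {x | ∃ a b : R, x = a * b - b * a}

/-- The tensor factor of a component: its algebra, modulo commutators if it is closed. -/
def Target (τ : Thickness) : ComponentType → Type _
  | .bounded => ColorAlgebra k A τ
  | .closed => ColorAlgebra k A τ ⧸ commutatorSpan k (ColorAlgebra k A τ)

instance (τ : Thickness) : (β : ComponentType) → AddCommGroup (Target k A τ β)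
  | .bounded => inferInstanceAs (AddCommGroup (ColorAlgebra k A τ))
  | .closed =>
      inferInstanceAs (AddCommGroup (ColorAlgebra k A τ ⧸ commutatorSpan k (ColorAlgebra k A τ)))

instance (τ : Thickness) : (β : ComponentType) → Module k (Target k A τ β)
  | .bounded => inferInstanceAs (Module k (ColorAlgebra k A τ))
  | .closed =>
      inferInstanceAs (Module k (ColorAlgebra k A τ ⧸ commutatorSpan k (ColorAlgebra k A τ)))

variable {k A}

/-- The class of an element in the tensor factor of a component. -/
def toTarget (τ : Thickness) : (β : ComponentType) → ColorAlgebra k A τ → Target k A τ β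
  | .bounded, x => x
  | .closed, x => (commutatorSpan k (ColorAlgebra k A τ)).mkQ x

/-- The antipode `γ` of `A`. -/
def antipodeMap : A →ₗ[k] A := HopfAlgebra.antipode k

/-- The inverse `γ⁻¹` of the antipode. -/
def antipodeInv (hγ : Function.Bijective (HopfAlgebra.antipode k : A →ₗ[k] A)) : A →ₗ[k] A :=
  (LinearEquiv.ofBijective (HopfAlgebra.antipode k : A →ₗ[k] A) hγ).symm

/-- The transpose `(γ⁻¹)*` of the inverse of the antipode. -/
def dualAntipodeInv (hγ : Function.Bijective (HopfAlgebra.antipode k : A →ₗ[k] A)) :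
    Module.Dual k A →ₗ[k] Module.Dual k A :=
  (antipodeInv hγ).dualMap

/-- The label in `A` of the strand that passes under a crossing, for the basis vector `x`. The
tensor at a `slashOver` crossing is `∑ x ⊗ x*`, with `γ x` instead of `x` if the under strand is
thick; at a `backslashOver` crossing it is the inverse of that tensor, which is obtained by
applying `γ` to the first factor. For an upward strand `γ` is applied once more. -/
def underLabel (τ : Thickness) (κ : CrossingKind) (d : Direction) (x : A) : A :=
  let x₁ := match τ with
    | .thin => x
    | .thick => antipodeMap (k := k) x
  let x₂ := match κ with
    | .backslashOver => antipodeMap (k := k) x₁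
    | _ => x₁
  match d with
  | .down => x₂
  | .up => antipodeMap (k := k) x₂

/-- The label in `A*` of the strand that passes over a crossing, for the dual basis vector `f`:
`f`, with `(γ⁻¹)*` applied if the strand is thick, and once more if it is directed upwards. -/
def overLabel (hγ : Function.Bijective (HopfAlgebra.antipode k : A →ₗ[k] A))
    (τ : Thickness) (d : Direction) (f : Module.Dual k A) : Module.Dual k A :=
  let f₁ := match τ with
    | .thin => f
    | .thick => dualAntipodeInv hγ f
  match d with
  | .down => f₁
  | .up => dualAntipodeInv hγ f₁

/-- The label of a passage along a component of thickness `τ`, where `j` is the summation index of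
the crossing. -/
def passageLabel (hγ : Function.Bijective (HopfAlgebra.antipode k : A →ₗ[k] A))
    {ι : Type*} (e : Module.Basis ι k A) (τ : Thickness) (s : Passage) (j : ι) :
    ColorAlgebra k A τ :=
  toColor τ (if s.isOver then HeisenbergDouble.ofDual (overLabel hγ τ s.dir (e.coord j))
    else HeisenbergDouble.ofAlg (underLabel (k := k) τ s.kind s.dir (e j)))

end Labels

section Invariant

variable {n : ℕ} {μ : Fin n → Thickness} {ν : Fin n → ComponentType}

/-- The real crossings of a diagram. -/
def ColoredDiagram.crossings (Z : ColoredDiagram μ ν) : Finset (ℕ × ℕ) :=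
  ((arcs Z.rows).filterMap fun x => x.passage.map Passage.crossing).toFinset

/-- The passages along the `i`th component through real crossings, in the order of the orientation.
If the component is closed, this involves the choice of a base point. -/
def ColoredDiagram.passages (Z : ColoredDiagram μ ν) (i : Fin n) : List Passage :=
  (Classical.choose (Z.connected i)).filterMap Arc.passage

variable {k A : Type*} [Field k] [Ring A] [HopfAlgebra k A]

/-- The invariant `J'`: the sum over all choices `c` of a basis index at each real crossing of the
tensor whose `i`th factor is the product of the labels along the `i`th component, read against the
orientation and written from left to right. -/
def JPrime (hγ : Function.Bijective (HopfAlgebra.antipode k : A →ₗ[k] A))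
    {ι : Type*} [Fintype ι] (e : Module.Basis ι k A) (Z : ColoredDiagram μ ν) :
    PiTensorProduct k fun i => Target k A (μ i) (ν i) :=
  ∑ c : (Z.crossings → ι), PiTensorProduct.tprod k fun i =>
    toTarget (μ i) (ν i) ((Z.passages i).map fun s =>
      if h : s.crossing ∈ Z.crossings then passageLabel hγ e (μ i) s (c ⟨s.crossing, h⟩)
      else 1).reverse.prod

end Invariant

/-! ### Colored moves

Each kind of move is a relation between local diagrams (lists of rows with the same top and the
same bottom). -/

section Moves

variable {n : ℕ}

open Piece CrossingKind

/-- The colored Pachner (2,3) moves with middle strand `m`. The strand `x` passes under `m` and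
`y`, the strand `y` passes over `x` and `m`, and `m` lies between them. On one side there are three
real crossings, on the other one two real crossings and a virtual crossing of `x` and `y`. The two
forms differ in the order of the crossings along `m`. -/
inductive PachnerMove (μ : Fin n → Thickness) (m : Strand n) :
    List (Row n) → List (Row n) → Prop
  | outerFirst (x y : Strand n)
      (h : (μ m.comp = .thin ∧ m.dir = .down) ∨ (μ m.comp = .thick ∧ m.dir = .up)) :
      PachnerMove μ m
        [[strand x, crossing slashOver m y], [crossing slashOver x y, strand m],
          [strand y, crossing slashOver x m]]
        [[crossing slashOver x m, strand y], [strand m, crossing virtual x y],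
          [crossing slashOver m y, strand x]]
  | innerFirst (x y : Strand n)
      (h : (μ m.comp = .thick ∧ m.dir = .down) ∨ (μ m.comp = .thin ∧ m.dir = .up)) :
      PachnerMove μ m
        [[crossing slashOver x m, strand y], [strand m, crossing slashOver x y],
          [crossing slashOver m y, strand x]]
        [[strand x, crossing slashOver m y], [crossing virtual x y, strand m],
          [strand y, crossing slashOver x m]]

/-- The colored (0,2) moves: two consecutive real crossings of the strands `a` and `b`, both with
`a` over `b` or both with `b` over `a`, are removed. -/
inductive ZeroTwoMove : List (Row n) → List (Row n) → Prop
  | cancel (κ : CrossingKind) (hκ : κ ≠ virtual) (a b : Strand n) :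
      ZeroTwoMove [[crossing κ a b], [crossing κ.swap b a]] [[strand a, strand b]]

/-- The symmetry moves: the moves of virtual Reidemeister type. -/
inductive SymmetryMove : List (Row n) → List (Row n) → Prop
  | kinkRight (a : Strand n) :
      SymmetryMove
        [[strand a, max a], [crossing virtual a a, strand a.rev], [strand a, min a]]
        [[strand a]]
  | kinkLeft (a : Strand n) :
      SymmetryMove
        [[max a.rev, strand a], [strand a.rev, crossing virtual a a], [min a.rev, strand a]]
        [[strand a]]
  | involution (a b : Strand n) :
      SymmetryMove [[crossing virtual a b], [crossing virtual b a]] [[strand a, strand b]]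
  | naturality (κ : CrossingKind) (a b c : Strand n) :
      SymmetryMove
        [[crossing κ a b, strand c], [strand b, crossing virtual a c],
          [crossing virtual b c, strand a]]
        [[strand a, crossing virtual b c], [crossing virtual a c, strand b],
          [strand c, crossing κ a b]]

/-- The planar isotopies: insertion of a row of vertical strands; horizontally adjacent parts may
be placed at different heights; straightening of a zigzag; a strand that crosses one leg of a
local maximum or minimum may be moved to the other leg. -/
inductive PlanarIsotopy : List (Row n) → List (Row n) → Prop
  | identity (w : List (Strand n)) : PlanarIsotopy [idRow w] []
  | leftFirst (p q : Row n) :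
      PlanarIsotopy [p ++ q] [p ++ idRow (Row.top q), idRow (Row.bot p) ++ q]
  | rightFirst (p q : Row n) :
      PlanarIsotopy [p ++ q] [idRow (Row.top p) ++ q, p ++ idRow (Row.bot q)]
  | zigzagRight (a : Strand n) :
      PlanarIsotopy [[strand a, max a.rev], [min a, strand a]] [[strand a]]
  | zigzagLeft (a : Strand n) :
      PlanarIsotopy [[max a, strand a], [strand a, min a.rev]] [[strand a]]
  | slideMax (κ : CrossingKind) (s a : Strand n) :
      PlanarIsotopy
        [[strand s, max a], [crossing κ s a, strand a.rev]]
        [[max a, strand s], [strand a, crossing κ.swap a.rev s]]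
  | slideMin (κ : CrossingKind) (s a : Strand n) :
      PlanarIsotopy
        [[crossing κ a s, strand a.rev], [strand s, min a]]
        [[strand a, crossing κ.swap s a.rev], [min a, strand s]]

/-- The colored moves. -/
inductive ColoredMove (μ : Fin n → Thickness) (T T' : List (Row n)) : Prop
  | pachner (m : Strand n) (h : PachnerMove μ m T T')
  | zeroTwo (h : ZeroTwoMove T T')
  | symmetry (h : SymmetryMove T T')
  | planar (h : PlanarIsotopy T T')

/-- The exceptional colored moves: a strand slides through a local maximum or minimum that is
oriented from left to right, with real crossings; or a colored Pachner (2,3) move whose middle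
strand is oriented upwards. -/
inductive ExceptionalMove (μ : Fin n → Thickness) : List (Row n) → List (Row n) → Prop
  | slideMax (κ : CrossingKind) (hκ : κ ≠ virtual) (s a : Strand n) (ha : a.dir = .up) :
      ExceptionalMove μ
        [[strand s, max a], [crossing κ s a, strand a.rev]]
        [[max a, strand s], [strand a, crossing κ.swap a.rev s]]
  | slideMin (κ : CrossingKind) (hκ : κ ≠ virtual) (s a : Strand n) (ha : a.dir = .down) :
      ExceptionalMove μ
        [[crossing κ a s, strand a.rev], [strand s, min a]]
        [[strand a, crossing κ.swap s a.rev], [min a, strand s]]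
  | pachner (m : Strand n) (hm : m.dir = .up) {T T' : List (Row n)} (h : PachnerMove μ m T T') :
      ExceptionalMove μ T T'

variable {μ : Fin n → Thickness} {ν : Fin n → ComponentType}

/-- `Z'` arises from `Z` by replacing a local diagram `T` by `T'`, where `M T T'`. To the left and
to the right of the local diagram there are vertical strands. -/
def LocalMove (M : List (Row n) → List (Row n) → Prop) (Z Z' : ColoredDiagram μ ν) : Prop :=
  ∃ (above below : List (Row n)) (left right : List (Strand n)) (T T' : List (Row n)),
    M T T' ∧
    Z.rows = above ++ T.map (fun r => idRow left ++ r ++ idRow right) ++ below ∧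
    Z'.rows = above ++ T'.map (fun r => idRow left ++ r ++ idRow right) ++ below

/-- The equivalence relation `∼_c`, generated by all colored moves. -/
def ColoredEquiv (Z Z' : ColoredDiagram μ ν) : Prop :=
  Relation.EqvGen (LocalMove (ColoredMove μ)) Z Z'

/-- The equivalence relation `∼'_c`, generated by the colored moves that are not exceptional. -/
def RestrictedColoredEquiv (Z Z' : ColoredDiagram μ ν) : Prop :=
  Relation.EqvGen (LocalMove fun T T' => ColoredMove μ T T' ∧ ¬ ExceptionalMove μ T T') Z Z'

end Moves

end ColoredDiagrams

end

noncomputable section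

namespace ColoredDiagrams

/-! ### Systems of weighted arcs -/

/-! The plane enters $J'$ only through the arcs into which the horizontal lines cut a diagram. In a
fixed state of the crossings the diagram becomes a multiset of directed arcs with weights, whose
value is the tensor of the products along its components. This value is well defined: a component
determines its list of arcs up to rotation (`Tame.tour_unique`), and a rotation can occur only for
closed components, which are read modulo commutators. The value is linear in each weight, and it
does not change when two consecutive arcs are merged (`Reading.val_contract`) or when arcs of weight
1 shrink to points (`Reading.val_collapse`). By `JPrime_eq`, $J'$ is the sum of these values over
all states.

A move leaves the crossings outside the local diagram alone, so it suffices to compare the two local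
sums in a fixed surrounding (`stateSum_local`). In the moves on individual strands, every strand of
the local diagram merges into one arc that carries the product of its labels. Both sides then have
the same arcs up to a vertical shift, and what remains is an identity between sums of labels. It is
trivial for zigzags and symmetry moves. For the insertion of rows and the changes of height, the
additional vertical strands shrink to points instead.

The label maps turn products along a strand into products in $A$ or $A^*$, in an order that depends
neither on thickness nor on direction (`comb_underMap`, `comb_overMap`). The identities needed are
the following.

For the (0,2) moves: $\sum\gamma(e_i)e_j\otimes e^ie^j=1\otimes\varepsilon$ and its mirror image,
which are the antipode axioms (`sum_antipode_mul`, `sum_mul_antipode`).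

For slides through a maximum or minimum (`crossSum_slide`): the other leg has the other direction,
which changes its label by $\gamma$ or $\bar\gamma^*$, and the crossing changes its kind, which
changes the under label by $\gamma$. If the extremum is oriented from right to left, these changes
compensate each other because $\sum\gamma(e_a)\otimes\bar\gamma^*(e^a)=\sum e_a\otimes e^a$.
Otherwise they leave a factor $\gamma^2$, and only here is $\gamma^2=1$ used.

For the Pachner moves (`sum_pentagon_outer`, `sum_pentagon_inner`): a product of two dual labels is
traded for a coproduct in $A$, a multiplication is moved from $e_c$ to a translation of $e^c$, and
the result is the commutation relation of $H(A)$ on the middle strand. The labels of that strand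
satisfy $af=\sum f(?\,a')a''$ or its mirror image, and this distinguishes the two forms of the move.
-/

/-- A directed arc of the component `comp` between two points, with a weight. -/
structure WArc (P : Type*) (n : ℕ) (B : Type*) where
  src : P
  tgt : P
  comp : Fin n
  w : B

namespace WArc

variable {P Q B C : Type*} {n : ℕ}

/-- Change the weight of an arc. -/
def mapWeight (g : B → C) (x : WArc P n B) : WArc P n C := ⟨x.src, x.tgt, x.comp, g x.w⟩

/-- Move the ends of an arc. -/
def mapPts (f : P → Q) (x : WArc P n B) : WArc Q n B := ⟨f x.src, f x.tgt, x.comp, x.w⟩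

/-- Forget the weight of an arc. -/
def skel (x : WArc P n B) : WArc P n Unit := x.mapWeight fun _ => ()

@[simp] theorem skel_src (x : WArc P n B) : x.skel.src = x.src := rfl

@[simp] theorem skel_tgt (x : WArc P n B) : x.skel.tgt = x.tgt := rfl

@[simp] theorem skel_comp (x : WArc P n B) : x.skel.comp = x.comp := rfl

end WArc

/-! ### Tours of the components -/

section Tours

variable {P Q B C : Type*} {n : ℕ}

/-- The arcs of `l` follow each other. -/
abbrev IsPath (l : List (WArc P n B)) : Prop := l.IsChain fun x y => x.tgt = y.src

/-- `l` lists the arcs of the component `i` in an order in which they follow each other. -/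
def IsTour (m : Multiset (WArc P n B)) (i : Fin n) (l : List (WArc P n B)) : Prop :=
  l ≠ [] ∧ (l : Multiset _) = m.filter (fun x => x.comp = i) ∧ IsPath l

/-- The arcs form `n` curves, and those which are not closed according to `cl` have an end. -/
structure Tame (cl : Fin n → Prop) (m : Multiset (WArc P n B)) : Prop where
  src_nodup : (m.map WArc.src).Nodup
  tgt_nodup : (m.map WArc.tgt).Nodup
  tour : ∀ i, ∃ l, IsTour m i l
  ends : ∀ i, ¬ cl i → ∃ x ∈ m, x.comp = i ∧
    ((∀ y ∈ m, y.tgt ≠ x.src) ∨ (∀ y ∈ m, y.src ≠ x.tgt))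

variable {cl : Fin n → Prop} {m : Multiset (WArc P n B)} {i : Fin n} {l l' : List (WArc P n B)}

theorem IsTour.mem_iff (h : IsTour m i l) {x : WArc P n B} : x ∈ l ↔ x ∈ m ∧ x.comp = i := by
  rw [← Multiset.mem_coe, h.2.1, Multiset.mem_filter]

theorem Tame.src_inj (h : Tame cl m) {x y : WArc P n B} (hx : x ∈ m) (hy : y ∈ m)
    (e : x.src = y.src) : x = y := Multiset.inj_on_of_nodup_map h.src_nodup _ hx _ hy e

theorem Tame.tgt_inj (h : Tame cl m) {x y : WArc P n B} (hx : x ∈ m) (hy : y ∈ m)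
    (e : x.tgt = y.tgt) : x = y := Multiset.inj_on_of_nodup_map h.tgt_nodup _ hx _ hy e

theorem Tame.nodup (h : Tame cl m) : m.Nodup := Multiset.Nodup.of_map _ h.src_nodup

theorem Tame.tour_nodup (h : Tame cl m) (hl : IsTour m i l) : l.Nodup := by
  rw [← Multiset.coe_nodup, hl.2.1]
  exact h.nodup.filter _

/-- Each arc after the first starts where the previous one ends, and starting points determine arcs,
so the first arc and the length determine the whole path. -/
theorem path_eq_of_head : ∀ {l l' : List (WArc P n B)}, IsPath l → IsPath l' →
    l.length = l'.length → l.head? = l'.head? →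
    (∀ x ∈ l, ∀ y ∈ l', x.src = y.src → x = y) → l = l'
  | [], [], _, _, _, _, _ => rfl
  | [], _ :: _, _, _, h, _, _ => by simp at h
  | _ :: _, [], _, _, h, _, _ => by simp at h
  | x :: l, y :: l', h, h', hlen, hh, hinj => by
    obtain rfl : x = y := by simpa using hh
    rw [IsPath, List.isChain_cons] at h h'
    congr 1
    refine path_eq_of_head h.2 h'.2 (by simpa using hlen) ?_
      fun a ha b hb => hinj a (List.mem_cons_of_mem _ ha) b (List.mem_cons_of_mem _ hb)
    cases l with
    | nil => cases l' with
      | nil => rfl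
      | cons b l' => simp at hlen
    | cons a l => cases l' with
      | nil => simp at hlen
      | cons b l' =>
        have ha := h.1 a (by simp)
        have hb := h'.1 b (by simp)
        simp [hinj a (by simp) b (by simp) (ha.symm.trans hb)]

theorem IsPath.exists_pred {x : WArc P n B} : ∀ {b : WArc P n B} {s : List (WArc P n B)},
    IsPath (b :: s) → x ∈ s → ∃ z ∈ b :: s, z.tgt = x.src
  | b, [], _, hx => by simp at hx
  | b, c :: s, h, hx => by
    rw [IsPath, List.isChain_cons_cons] at h
    rcases List.mem_cons.1 hx with rfl | hx
    · exact ⟨b, by simp, h.1⟩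
    · obtain ⟨z, hz, e⟩ := IsPath.exists_pred h.2 hx
      exact ⟨z, List.mem_cons_of_mem _ hz, e⟩

theorem IsPath.exists_succ {z : WArc P n B} : ∀ {b : WArc P n B} {s : List (WArc P n B)},
    IsPath (b :: s) → z ∈ b :: s → (b :: s).getLast? = some z ∨ ∃ y ∈ s, y.src = z.tgt
  | b, [], _, hz => by simp_all
  | b, c :: s, h, hz => by
    rw [IsPath, List.isChain_cons_cons] at h
    rcases List.mem_cons.1 hz with rfl | hz
    · exact Or.inr ⟨c, by simp, h.1.symm⟩
    · rcases IsPath.exists_succ h.2 hz with e | ⟨y, hy, e⟩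
      · exact Or.inl (by simpa using e)
      · exact Or.inr ⟨y, List.mem_cons_of_mem _ hy, e⟩

/-- Two tours of a component agree up to rotation. -/
theorem Tame.tour_unique (h : Tame cl m) (hl : IsTour m i l) (hl' : IsTour m i l') :
    l = l' ∨ cl i ∧ ∃ p q, l = p ++ q ∧ l' = q ++ p := by
  obtain ⟨a, s, rfl⟩ := List.exists_cons_of_ne_nil hl.1
  obtain ⟨b, s', rfl⟩ := List.exists_cons_of_ne_nil hl'.1
  have hperm : (a :: s).Perm (b :: s') := Multiset.coe_eq_coe.1 (hl.2.1.trans hl'.2.1.symm)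
  have hinj : ∀ x ∈ a :: s, ∀ y ∈ b :: s', x.src = y.src → x = y := fun x hx y hy =>
    h.src_inj (hl.mem_iff.1 hx).1 (hl'.mem_iff.1 hy).1
  by_cases hab : a = b
  · subst hab
    exact Or.inl (path_eq_of_head hl.2.2 hl'.2.2 hperm.length_eq rfl hinj)
  right
  have ha' : a ∈ s' := by
    have := hperm.subset (List.mem_cons_self (a := a))
    simpa [hab] using this
  obtain ⟨z, hz', hza⟩ := IsPath.exists_pred hl'.2.2 ha'
  have hz : z ∈ a :: s := hperm.symm.subset hz'
  -- If `z` had a successor in the first tour, that arc would start where `a` starts and hence be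
  -- `a`, which occurs only at the head.
  have hlast : (a :: s).getLast? = some z := by
    rcases IsPath.exists_succ hl.2.2 hz with e | ⟨y, hy, e⟩
    · exact e
    · have : y = a := hinj y (List.mem_cons_of_mem _ hy) a (List.mem_cons_of_mem _ ha')
        (e.trans hza)
      subst this
      exact absurd hy (List.nodup_cons.1 (h.tour_nodup hl)).1
  -- Since `z` runs into `a`, the component is cyclic: every arc has a predecessor and a successor.
  -- This contradicts the existence of an end.
  constructor
  · by_contra hcl
    obtain ⟨x, hx, hxi, hends⟩ := h.ends i hcl
    have hxl : x ∈ a :: s := hl.mem_iff.2 ⟨hx, hxi⟩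
    rcases hends with hends | hends
    · rcases List.mem_cons.1 hxl with rfl | hxs
      · exact hends z (hl.mem_iff.1 hz).1 hza
      · obtain ⟨y, hy, e⟩ := IsPath.exists_pred hl.2.2 hxs
        exact hends y (hl.mem_iff.1 hy).1 e
    · rcases IsPath.exists_succ hl.2.2 hxl with e | ⟨y, hy, e⟩
      · obtain rfl : z = x := by simpa [hlast] using e
        exact hends a (hl.mem_iff.1 (by simp)).1 hza.symm
      · exact hends y (hl.mem_iff.1 (List.mem_cons_of_mem _ hy)).1 e
  · obtain ⟨p, q, hpq⟩ := List.append_of_mem (hperm.symm.subset (List.mem_cons_self (a := b)))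
    refine ⟨p, b :: q, hpq, ?_⟩
    have hc := hl.2.2
    rw [hpq] at hc
    rw [hpq] at hlast
    obtain ⟨hp, hq, -⟩ := List.isChain_append.1 hc
    have hrot : IsPath (b :: q ++ p) := by
      refine List.isChain_append.2 ⟨hq, hp, fun x hx y hy => ?_⟩
      have hx' : x = z := by
        rw [List.getLast?_append] at hlast
        simp only [Option.mem_def] at hx
        rw [hx] at hlast
        simpa using hlast
      have hy' : y = a := by
        cases p with
        | nil => simp at hy
        | cons c p => simp_all
      rw [hx', hy', hza]
    have hperm' : (b :: q ++ p).Perm (b :: s') :=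
      List.perm_append_comm.trans (hpq ▸ hperm)
    refine (path_eq_of_head hrot hl'.2.2 hperm'.length_eq rfl fun x hx y hy e => ?_).symm
    exact hinj x (hperm.symm.subset (hperm'.subset hx)) y hy e

/-- The lifting needs no injectivity of `f`. It carries a tour of the arcs without weights back to a
tour of the weighted arcs. -/
theorem exists_list_of_map_eq_coe {α β : Type*} (f : α → β) :
    ∀ (l : List β) {s : Multiset α}, s.map f = l → ∃ l' : List α, (l' : Multiset α) = s ∧
      l'.map f = l
  | [], s, h => ⟨[], by simpa [eq_comm] using h⟩
  | b :: l, s, h => by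
    classical
    rw [← Multiset.cons_coe] at h
    obtain ⟨a, ha, hab, hs⟩ := (Multiset.map_eq_cons f s _ b).2 h
    obtain ⟨l', hl', e⟩ := exists_list_of_map_eq_coe f l hs
    exact ⟨a :: l', by rw [← Multiset.cons_coe, hl', Multiset.cons_erase ha], by simp [hab, e]⟩

theorem IsTour.skel (h : IsTour m i l) : IsTour (m.map WArc.skel) i (l.map WArc.skel) := by
  refine ⟨by simpa using h.1, ?_, ?_⟩
  · rw [← Multiset.map_coe, h.2.1, Multiset.filter_map]
    rfl
  · rw [IsPath, List.isChain_map]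
    exact h.2.2

theorem exists_isTour_of_skel {l : List (WArc P n Unit)} (h : IsTour (m.map WArc.skel) i l) :
    ∃ l', IsTour m i l' ∧ l'.map WArc.skel = l := by
  have h1 := h.2.1
  rw [Multiset.filter_map] at h1
  obtain ⟨l', hl', e⟩ := exists_list_of_map_eq_coe _ l h1.symm
  refine ⟨l', ⟨?_, hl', ?_⟩, e⟩
  · rintro rfl
    exact h.1 (by simpa using e.symm)
  · have := h.2.2
    rw [← e, IsPath, List.isChain_map] at this
    exact this

/-- Tameness does not involve the weights. It is therefore checked once for a diagram and then holds
in all its states. -/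
theorem tame_skel_iff : Tame cl (m.map WArc.skel) ↔ Tame cl m := by
  constructor
  · intro h
    refine ⟨?_, ?_, fun i => ?_, fun i hi => ?_⟩
    · simpa [Multiset.map_map, Function.comp_def] using h.src_nodup
    · simpa [Multiset.map_map, Function.comp_def] using h.tgt_nodup
    · obtain ⟨l, hl⟩ := h.tour i
      obtain ⟨l', hl', -⟩ := exists_isTour_of_skel hl
      exact ⟨l', hl'⟩
    · simpa using h.ends i hi
  · intro h
    refine ⟨?_, ?_, fun i => ?_, fun i hi => ?_⟩
    · simpa [Multiset.map_map, Function.comp_def] using h.src_nodup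
    · simpa [Multiset.map_map, Function.comp_def] using h.tgt_nodup
    · obtain ⟨l, hl⟩ := h.tour i
      exact ⟨_, hl.skel⟩
    · simpa using h.ends i hi

theorem Tame.of_skel_eq {m' : Multiset (WArc P n C)} (h : Tame cl m)
    (e : m.map WArc.skel = m'.map WArc.skel) : Tame cl m' := by
  rw [← tame_skel_iff, ← e, tame_skel_iff]
  exact h

/-- In a tour of a curve one may assume that two adjacent arcs are met one after the other. -/
theorem Tame.exists_tour_adjacent (h : Tame cl m) {x y : WArc P n B} (hx : x ∈ m) (hy : y ∈ m)
    (hxy : x ≠ y) (hc : x.comp = y.comp) (e : x.tgt = y.src) :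
    ∃ p q, IsTour m x.comp (p ++ x :: y :: q) := by
  obtain ⟨l, hl⟩ := h.tour x.comp
  obtain ⟨p, q, rfl⟩ := List.append_of_mem (hl.mem_iff.2 ⟨hx, rfl⟩)
  have hmem : ∀ z ∈ p ++ x :: q, z ∈ m := fun z hz => (hl.mem_iff.1 hz).1
  cases q with
  | cons y' q =>
    have h2 : x.tgt = y'.src := by
      have := hl.2.2
      rw [IsPath, List.isChain_append_cons_cons] at this
      exact this.2.1
    obtain rfl : y' = y := h.src_inj (hmem _ (by simp)) hy (h2.symm.trans e)
    exact ⟨p, q, hl⟩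
  -- Here `x` comes last. Then `y` must come first, since a predecessor of `y` would end where `x`
  -- ends and so be a second occurrence of `x`. Rotating `x` to the front makes the two arcs
  -- adjacent.
  | nil =>
    have hyl : y ∈ p := by
      have := hl.mem_iff.2 ⟨hy, hc.symm⟩
      simpa [hxy.symm] using this
    obtain ⟨p₁, p₂, rfl⟩ := List.append_of_mem hyl
    rcases p₁.eq_nil_or_concat' with rfl | ⟨p₁, z, rfl⟩
    · refine ⟨[], p₂, by simp, ?_, ?_⟩
      · rw [← hl.2.1, Multiset.coe_eq_coe]
        simpa using (List.perm_append_comm (l₁ := [x]) (l₂ := y :: p₂))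
      · have hch := hl.2.2
        simp only [List.nil_append] at hch ⊢
        exact List.isChain_cons_cons.2 ⟨e, (List.isChain_append.1 hch).1⟩
    · exfalso
      have hch := hl.2.2
      have hzy : z.tgt = y.src := by
        simp only [List.append_assoc, List.cons_append, List.nil_append] at hch
        rw [IsPath, List.isChain_append_cons_cons] at hch
        exact hch.2.1
      obtain rfl : z = x := h.tgt_inj (hmem _ (by simp)) hx (hzy.trans e.symm)
      have := h.tour_nodup hl
      simp [List.nodup_append] at this

end Tours

/-! ### The value of a system of weighted arcs -/

section Word

theorem filter_comp_cons_of_eq {P B : Type*} {n : ℕ} {i : Fin n} {x : WArc P n B}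
    {s : Multiset (WArc P n B)} (h : x.comp = i) :
    (x ::ₘ s).filter (fun x => x.comp = i) = x ::ₘ s.filter (fun x => x.comp = i) :=
  Multiset.filter_cons_of_pos (p := fun x : WArc P n B => x.comp = i) s h

theorem filter_comp_cons_of_ne {P B : Type*} {n : ℕ} {i : Fin n} {x : WArc P n B}
    {s : Multiset (WArc P n B)} (h : x.comp ≠ i) :
    (x ::ₘ s).filter (fun x => x.comp = i) = s.filter (fun x => x.comp = i) :=
  Multiset.filter_cons_of_neg (p := fun x : WArc P n B => x.comp = i) s h

variable {P Q B : Type*} {n : ℕ} [Monoid B]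

/-- The product of the weights, read from the last arc to the first one. -/
def word (l : List (WArc P n B)) : B := (l.map WArc.w).reverse.prod

theorem word_append (l l' : List (WArc P n B)) : word (l ++ l') = word l' * word l := by
  simp [word]

theorem word_cons (x : WArc P n B) (l : List (WArc P n B)) : word (x :: l) = word l * x.w := by
  simp [word]

/-- In a tour in which the two arcs are adjacent they can be replaced by one arc. Its weight is `y.w
* x.w` in this order because words are read against the orientation. -/
theorem Tame.contract {cl : Fin n → Prop} {x y : WArc P n B} {L : Multiset (WArc P n B)}
    (h : Tame cl (x ::ₘ y ::ₘ L)) (hc : x.comp = y.comp) (e : x.tgt = y.src) :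
    Tame cl (⟨x.src, y.tgt, x.comp, y.w * x.w⟩ ::ₘ L) ∧
      ∀ i, ∃ l l', IsTour (x ::ₘ y ::ₘ L) i l ∧
        IsTour (⟨x.src, y.tgt, x.comp, y.w * x.w⟩ ::ₘ L) i l' ∧ word l = word l' := by
  have hsrc := h.src_nodup
  have htgt := h.tgt_nodup
  simp only [Multiset.map_cons, Multiset.nodup_cons, Multiset.mem_cons, Multiset.mem_map,
    not_or, not_exists, not_and] at hsrc htgt
  have hxy : x ≠ y := fun hxy => hsrc.1.1 (by rw [hxy])
  have key : ∀ i, ∃ l l', IsTour (x ::ₘ y ::ₘ L) i l ∧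
        IsTour (⟨x.src, y.tgt, x.comp, y.w * x.w⟩ ::ₘ L) i l' ∧ word l = word l' := by
    intro i
    by_cases hi : x.comp = i
    · subst hi
      obtain ⟨p, q, hl⟩ := h.exists_tour_adjacent (by simp) (by simp) hxy hc e
      refine ⟨_, p ++ ⟨x.src, y.tgt, x.comp, y.w * x.w⟩ :: q, hl, ⟨by simp, ?_, ?_⟩, ?_⟩
      · have h1 := hl.2.1
        rw [filter_comp_cons_of_eq rfl, filter_comp_cons_of_eq hc.symm] at h1
        rw [filter_comp_cons_of_eq (by rfl)]
        have h2 : ((p ++ x :: y :: q : List _) : Multiset (WArc P n B)) =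
            x ::ₘ y ::ₘ ((p ++ q : List _) : Multiset _) := by
          simp only [Multiset.cons_coe, Multiset.coe_eq_coe]
          exact List.perm_middle.trans (List.Perm.cons _ List.perm_middle)
        rw [h2, Multiset.cons_inj_right, Multiset.cons_inj_right] at h1
        rw [← h1]
        simp only [Multiset.cons_coe, Multiset.coe_eq_coe]
        exact List.perm_middle
      · obtain ⟨hp, hq, hj⟩ := List.isChain_append.1 hl.2.2
        rw [List.isChain_cons_cons] at hq
        refine List.isChain_append.2 ⟨hp, ?_, ?_⟩
        · rw [List.isChain_cons] at hq ⊢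
          exact ⟨hq.2.1, hq.2.2⟩
        · simpa using hj
      · simp [word_append, word_cons, mul_assoc]
    · obtain ⟨l, hl⟩ := h.tour i
      refine ⟨l, l, hl, ⟨hl.1, ?_, hl.2.2⟩, rfl⟩
      rw [hl.2.1, filter_comp_cons_of_ne hi,
        filter_comp_cons_of_ne (by rwa [hc] at hi), filter_comp_cons_of_ne (by exact hi)]
  refine ⟨⟨?_, ?_, fun i => ?_, fun i hi => ?_⟩, key⟩
  · simp only [Multiset.map_cons, Multiset.nodup_cons, Multiset.mem_map, not_exists, not_and]
    exact ⟨hsrc.1.2, hsrc.2.2⟩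
  · simp only [Multiset.map_cons, Multiset.nodup_cons, Multiset.mem_map, not_exists, not_and]
    exact ⟨htgt.2.1, htgt.2.2⟩
  · obtain ⟨l, l', -, h', -⟩ := key i
    exact ⟨l', h'⟩
  · obtain ⟨z, hz, hzi, hends⟩ := h.ends i hi
    -- The point at which `x` meets `y` is no end of the component. An end at `x` is thus the source
    -- of `x`, an end at `y` is the target of `y`, and both survive.
    simp only [Multiset.mem_cons, forall_eq_or_imp] at hz hends ⊢
    rcases hz with rfl | rfl | hz
    · refine ⟨_, Or.inl rfl, hzi, Or.inl ?_⟩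
      rcases hends with hends | hends
      · exact ⟨hends.2.1, hends.2.2⟩
      · exact absurd e.symm hends.2.1
    · refine ⟨_, Or.inl rfl, hc.trans hzi, Or.inr ?_⟩
      rcases hends with hends | hends
      · exact absurd e hends.1
      · exact ⟨hends.1, hends.2.2⟩
    · refine ⟨z, Or.inr hz, hzi, ?_⟩
      rcases hends with hends | hends
      · exact Or.inl ⟨hends.2.1, hends.2.2⟩
      · exact Or.inr ⟨hends.1, hends.2.2⟩

-- A dropped arc starts and ends at the same image point, so the arcs before and after it still fit
-- together. The second conclusion, on the starting point, is what makes the induction work.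
open Classical in
theorem path_collapse {P Q B : Type*} {n : ℕ} (f : P → Q) (keep : WArc P n B → Prop) :
    ∀ l : List (WArc P n B), IsPath l → (∀ x ∈ l, ¬ keep x → f x.src = f x.tgt) →
      IsPath ((l.filter fun x => keep x).map (WArc.mapPts f)) ∧
        ∀ a ∈ l.head?, ∀ y ∈ (l.filter fun x => keep x).head?, f a.src = f y.src
  | [], _, _ => by simp
  | x :: l, h, hn => by
    rw [IsPath, List.isChain_cons] at h
    obtain ⟨ih, ih'⟩ := path_collapse f keep l h.2 fun x hx => hn x (List.mem_cons_of_mem _ hx)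
    have hj : ∀ y ∈ (l.filter fun x => keep x).head?, f x.tgt = f y.src := by
      intro y hy
      cases l with
      | nil => simp at hy
      | cons a l => rw [h.1 a (by simp)]; exact ih' a (by simp) y hy
    by_cases hx : keep x
    · rw [List.filter_cons_of_pos (by simpa using hx)]
      refine ⟨?_, by simp⟩
      rw [List.map_cons, IsPath, List.isChain_cons]
      refine ⟨fun y hy => ?_, ih⟩
      rw [List.head?_map, Option.mem_def] at hy
      obtain ⟨z, hz, rfl⟩ := Option.map_eq_some_iff.1 hy
      exact hj z (Option.mem_def.2 hz)
    · rw [List.filter_cons_of_neg (by simpa using hx)]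
      refine ⟨ih, fun a ha y hy => ?_⟩
      obtain rfl : x = a := by simpa using ha
      rw [hn x (by simp) hx]
      exact hj y hy

open Classical in
/-- Arcs without weight whose ends are identified can be left out of a tour. -/
theorem Tame.collapse {cl : Fin n → Prop} (f : P → Q) {L N : Multiset (WArc P n B)}
    (h : Tame cl (L + N)) (h' : Tame cl (L.map (WArc.mapPts f)))
    (hN : ∀ x ∈ N, f x.src = f x.tgt ∧ x.w = 1) (i : Fin n) :
    ∃ l l', IsTour (L + N) i l ∧ IsTour (L.map (WArc.mapPts f)) i l' ∧ word l = word l' := by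
  obtain ⟨l, hl⟩ := h.tour i
  have hdis := (Multiset.nodup_add.1 h.nodup).2.2
  have hkeep : ∀ x ∈ l, x ∉ L → x ∈ N := fun x hx hxL =>
    (Multiset.mem_add.1 (hl.mem_iff.1 hx).1).resolve_left hxL
  have hms : (((l.filter fun x => x ∈ L).map (WArc.mapPts f) : List _) : Multiset _) =
      (L.map (WArc.mapPts f)).filter (fun x => x.comp = i) := by
    rw [← Multiset.map_coe, Multiset.filter_map]
    have : ((l.filter fun x => x ∈ L : List _) : Multiset _) =
        Multiset.filter (fun x => x ∈ L) (l : Multiset _) := by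
      rw [Multiset.filter_coe]
    rw [this, hl.2.1, Multiset.filter_filter]
    have h1 : Multiset.filter (fun a => a ∈ L ∧ a.comp = i) N = 0 := by
      rw [Multiset.filter_eq_nil]
      exact fun a ha haL => Multiset.disjoint_left.1 hdis haL.1 ha
    rw [Multiset.filter_add, h1, add_zero]
    congr 1
    refine Multiset.filter_congr fun x hx => ?_
    simp [hx, WArc.mapPts]
  refine ⟨l, (l.filter fun x => x ∈ L).map (WArc.mapPts f), hl, ⟨?_, hms, ?_⟩, ?_⟩
  -- A component could lose all its arcs; the tameness of the image excludes this, because tours are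
  -- nonempty.
  · obtain ⟨l', hl'⟩ := h'.tour i
    intro h0
    apply hl'.1
    have := hl'.2.1.trans hms.symm
    simpa [h0] using this
  · convert (path_collapse f _ l hl.2.2 fun x hx hxL => (hN x (hkeep x hx hxL)).1).1
  · have : ∀ l : List (WArc P n B), (∀ x ∈ l, x ∉ L → x ∈ N) →
        word l = word ((l.filter fun x => x ∈ L).map (WArc.mapPts f)) := by
      intro l hl
      induction l with
      | nil => rfl
      | cons x l ih =>
        have ih := ih fun x hx => hl x (List.mem_cons_of_mem _ hx)
        by_cases hx : x ∈ L
        · rw [List.filter_cons_of_pos (by simpa using hx), List.map_cons, word_cons, word_cons, ih]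
          rfl
        · rw [List.filter_cons_of_neg (by simpa using hx), word_cons, ih,
            (hN x (hl x (by simp) hx)).2, mul_one]
    exact this l hkeep

end Word

/-- How to read off the value of a system of arcs with weights in the product of the algebras `R i`:
the product along the component `i` is mapped by `π i`, which is a trace if the component
is closed. -/
structure Reading (k : Type*) [Field k] {n : ℕ} (R N : Fin n → Type*) [∀ i, Ring (R i)]
    [∀ i, Algebra k (R i)] [∀ i, AddCommGroup (N i)] [∀ i, Module k (N i)] where
  cl : Fin n → Prop
  π : ∀ i, R i →ₗ[k] N i
  trace : ∀ i, cl i → ∀ x y, π i (x * y) = π i (y * x)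

namespace Reading

variable {k : Type*} [Field k] {n : ℕ} {R N : Fin n → Type*} [∀ i, Ring (R i)]
  [∀ i, Algebra k (R i)] [∀ i, AddCommGroup (N i)] [∀ i, Module k (N i)]
  {P Q : Type*}

open Classical in
/-- The value of a system of weighted arcs. -/
def val (T : Reading k R N) (m : Multiset (WArc P n (∀ i, R i))) : PiTensorProduct k N :=
  if h : Tame T.cl m then
    PiTensorProduct.tprod k fun i => T.π i (word (Classical.choose (h.tour i)) i)
  -- As tameness does not depend on weights, the default value 0 keeps the value linear in every
  -- weight without further assumptions.
  else 0

variable (T : Reading k R N) {m : Multiset (WArc P n (∀ i, R i))}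
  {m' : Multiset (WArc Q n (∀ i, R i))}

/-- The chosen tours differ from the given ones at most by rotations of closed components, where `π
i` is a trace. -/
theorem val_eq (h : Tame T.cl m) {l : Fin n → List (WArc P n (∀ i, R i))}
    (hl : ∀ i, IsTour m i (l i)) :
    T.val m = PiTensorProduct.tprod k fun i => T.π i (word (l i) i) := by
  rw [val, dif_pos h]
  congr 1
  funext i
  rcases h.tour_unique (Classical.choose_spec (h.tour i)) (hl i) with e | ⟨hc, p, q, e, e'⟩
  · rw [e]
  · rw [e, e', word_append, word_append, Pi.mul_apply, Pi.mul_apply, T.trace i hc]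

theorem val_eq_val (h : Tame T.cl m) (h' : Tame T.cl m')
    (H : ∀ i, ∃ l l', IsTour m i l ∧ IsTour m' i l' ∧ word l = word l') :
    T.val m = T.val m' := by
  choose l l' hl hl' e using H
  rw [T.val_eq h hl, T.val_eq h' hl']
  simp only [e]

theorem val_contract {x y : WArc P n (∀ i, R i)} {L : Multiset (WArc P n (∀ i, R i))}
    (h : Tame T.cl (x ::ₘ y ::ₘ L)) (hc : x.comp = y.comp) (e : x.tgt = y.src) :
    Tame T.cl (⟨x.src, y.tgt, x.comp, y.w * x.w⟩ ::ₘ L) ∧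
      T.val (x ::ₘ y ::ₘ L) = T.val (⟨x.src, y.tgt, x.comp, y.w * x.w⟩ ::ₘ L) :=
  ⟨(h.contract hc e).1, T.val_eq_val h (h.contract hc e).1 (h.contract hc e).2⟩

theorem val_collapse (f : P → Q) {L N : Multiset (WArc P n (∀ i, R i))}
    (h : Tame T.cl (L + N)) (h' : Tame T.cl (L.map (WArc.mapPts f)))
    (hN : ∀ x ∈ N, f x.src = f x.tgt ∧ x.w = 1) :
    T.val (L + N) = T.val (L.map (WArc.mapPts f)) :=
  T.val_eq_val h h' (h.collapse f h' hN)

/-- The value is linear in the weight of an arc. -/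
theorem exists_val_cons (s t : P) (i : Fin n) (L : Multiset (WArc P n (∀ i, R i))) :
    ∃ g : R i →ₗ[k] PiTensorProduct k N, ∀ w : ∀ i, R i, T.val (⟨s, t, i, w⟩ ::ₘ L) = g (w i) := by
  by_cases h : Tame T.cl (⟨s, t, i, 1⟩ ::ₘ L)
  swap
  · refine ⟨0, fun w => ?_⟩
    rw [val, dif_neg, LinearMap.zero_apply]
    exact fun h' => h (h'.of_skel_eq (by simp [WArc.skel, WArc.mapWeight]))
  have hw : ∀ w, Tame T.cl (⟨s, t, i, w⟩ ::ₘ L) := fun w =>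
    h.of_skel_eq (by simp [WArc.skel, WArc.mapWeight])
  choose l hl using h.tour
  obtain ⟨p, q, hpq⟩ := List.append_of_mem
    (((hl i).mem_iff (x := ⟨s, t, i, 1⟩)).2 ⟨by simp, rfl⟩)
  have htour : ∀ w j, IsTour (⟨s, t, i, w⟩ ::ₘ L) j
      (if j = i then p ++ ⟨s, t, i, w⟩ :: q else l j) := by
    intro w j
    by_cases hj : j = i
    · subst hj
      have hlj := hl j
      rw [hpq] at hlj
      rw [if_pos rfl]
      refine ⟨by simp, ?_, ?_⟩
      · have h1 := hlj.2.1
        rw [filter_comp_cons_of_eq (by rfl)] at h1 ⊢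
        have h2 : ∀ x : WArc P n (∀ i, R i), ((p ++ x :: q : List _) : Multiset _) =
            x ::ₘ ((p ++ q : List _) : Multiset _) := by
          intro x
          simp only [Multiset.cons_coe, Multiset.coe_eq_coe]
          exact List.perm_middle
        rw [h2, Multiset.cons_inj_right] at h1 ⊢
        exact h1
      · obtain ⟨hp, hq, hj⟩ := List.isChain_append.1 hlj.2.2
        rw [List.isChain_cons] at hq
        exact List.isChain_append.2 ⟨hp, List.isChain_cons.2 hq, by simpa using hj⟩
    · rw [if_neg hj]
      refine ⟨(hl j).1, ?_, (hl j).2.2⟩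
      rw [(hl j).2.1, filter_comp_cons_of_ne (fun h => hj h.symm),
        filter_comp_cons_of_ne (fun h => hj h.symm)]
  -- Along the component `i` the word is `word q * w * word p`; the words of the other components
  -- are constant.
  refine ⟨(PiTensorProduct.tprod k).toLinearMap (fun j => T.π j (word (l j) j)) i ∘ₗ T.π i ∘ₗ
    LinearMap.mulLeft k (word q i) ∘ₗ LinearMap.mulRight k (word p i), fun w => ?_⟩
  rw [T.val_eq (hw w) (htour w)]
  simp only [LinearMap.comp_apply, MultilinearMap.toLinearMap_apply, LinearMap.mulLeft_apply,
    LinearMap.mulRight_apply]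
  congr 1
  funext j
  by_cases hj : j = i
  · subst hj
    simp [word_append, word_cons, mul_assoc]
  · simp [hj]

/-- Bilinearity follows from linearity in each weight separately. Only the factor of a weight that
belongs to its own component matters, so `Pi.single` provides a weight for each element of that
factor. -/
theorem exists_val_cons₂ (s₁ t₁ s₂ t₂ : P) (i₁ i₂ : Fin n) (L : Multiset (WArc P n (∀ i, R i))) :
    ∃ g : R i₁ →ₗ[k] R i₂ →ₗ[k] PiTensorProduct k N, ∀ w₁ w₂ : ∀ i, R i,
      T.val (⟨s₁, t₁, i₁, w₁⟩ ::ₘ ⟨s₂, t₂, i₂, w₂⟩ ::ₘ L) = g (w₁ i₁) (w₂ i₂) := by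
  choose g hg using fun w₂ => T.exists_val_cons s₁ t₁ i₁ (⟨s₂, t₂, i₂, w₂⟩ ::ₘ L)
  choose g' hg' using fun w₁ => T.exists_val_cons s₂ t₂ i₂ (⟨s₁, t₁, i₁, w₁⟩ ::ₘ L)
  have hgg : ∀ w₁ w₂, g w₂ (w₁ i₁) = g' w₁ (w₂ i₂) := fun w₁ w₂ => by
    rw [← hg, ← hg', Multiset.cons_swap]
  refine ⟨LinearMap.mk₂ k (fun x y => g (Pi.single i₂ y) x) (fun x x' y => by simp)
    (fun c x y => by simp) (fun x y y' => ?_) (fun c x y => ?_), fun w₁ w₂ => ?_⟩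
  · have := fun y => hgg (Pi.single i₁ x) (Pi.single i₂ y)
    simp only [Pi.single_eq_same] at this
    simp [this]
  · have := fun y => hgg (Pi.single i₁ x) (Pi.single i₂ y)
    simp only [Pi.single_eq_same] at this
    simp [this]
  · rw [hg, hgg, LinearMap.mk₂_apply, hgg, Pi.single_eq_same]

theorem exists_val_cons₃ (s₁ t₁ s₂ t₂ s₃ t₃ : P) (i₁ i₂ i₃ : Fin n)
    (L : Multiset (WArc P n (∀ i, R i))) :
    ∃ g : R i₁ →ₗ[k] R i₂ →ₗ[k] R i₃ →ₗ[k] PiTensorProduct k N, ∀ w₁ w₂ w₃ : ∀ i, R i,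
      T.val (⟨s₁, t₁, i₁, w₁⟩ ::ₘ ⟨s₂, t₂, i₂, w₂⟩ ::ₘ ⟨s₃, t₃, i₃, w₃⟩ ::ₘ L) =
        g (w₁ i₁) (w₂ i₂) (w₃ i₃) := by
  choose g hg using fun w₁ => T.exists_val_cons₂ s₂ t₂ s₃ t₃ i₂ i₃ (⟨s₁, t₁, i₁, w₁⟩ ::ₘ L)
  choose g' hg' using fun w₂ w₃ => T.exists_val_cons s₁ t₁ i₁
    (⟨s₂, t₂, i₂, w₂⟩ ::ₘ ⟨s₃, t₃, i₃, w₃⟩ ::ₘ L)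
  have hgg : ∀ w₁ w₂ w₃, g w₁ (w₂ i₂) (w₃ i₃) = g' w₂ w₃ (w₁ i₁) := fun w₁ w₂ w₃ => by
    rw [← hg, ← hg']
    congr 1
    simp only [← Multiset.singleton_add]
    abel
  have hs := fun x y z => hgg (Pi.single i₁ x) (Pi.single i₂ y) (Pi.single i₃ z)
  simp only [Pi.single_eq_same] at hs
  refine ⟨
    { toFun := fun x => g (Pi.single i₁ x)
      map_add' := fun x x' => ?_
      map_smul' := fun c x => ?_ }, fun w₁ w₂ w₃ => ?_⟩
  · ext y z
    simp [hs]
  · ext y z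
    simp [hs]
  · have h1 := hgg w₁ w₂ w₃
    have h2 := hgg (Pi.single i₁ (w₁ i₁)) w₂ w₃
    rw [Pi.single_eq_same] at h2
    calc _ = g w₁ (w₂ i₂) (w₃ i₃) := by
            rw [← hg]
            congr 1
            simp only [← Multiset.singleton_add]
            abel
      _ = _ := h1.trans h2.symm

/-! ### Reductions of local systems of arcs -/

/-- The local system `m` may be replaced by `m'` without a change of the value. -/
def Red (m m' : Multiset (WArc P n (∀ i, R i))) : Prop :=
  ∀ L, Tame T.cl (m + L) → Tame T.cl (m' + L) ∧ T.val (m + L) = T.val (m' + L)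

variable {T} {m₁ m₂ m₃ m₁' m₂' : Multiset (WArc P n (∀ i, R i))}

theorem Red.refl (m : Multiset (WArc P n (∀ i, R i))) : T.Red m m := fun _ h => ⟨h, rfl⟩

theorem Red.trans (h : T.Red m₁ m₂) (h' : T.Red m₂ m₃) : T.Red m₁ m₃ := fun L hL =>
  ⟨(h' L (h L hL).1).1, (h L hL).2.trans (h' L (h L hL).1).2⟩

theorem Red.of_eq (h : m₁ = m₂) : T.Red m₁ m₂ := h ▸ Red.refl _

theorem Red.add_right (h : T.Red m₁ m₂) (m : Multiset (WArc P n (∀ i, R i))) :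
    T.Red (m₁ + m) (m₂ + m) := fun L hL => by
  rw [add_assoc] at hL
  simp only [add_assoc]
  exact h _ hL

theorem Red.add_left (h : T.Red m₁ m₂) (m : Multiset (WArc P n (∀ i, R i))) :
    T.Red (m + m₁) (m + m₂) := by
  rw [add_comm m, add_comm m]
  exact h.add_right m

theorem Red.add (h : T.Red m₁ m₁') (h' : T.Red m₂ m₂') : T.Red (m₁ + m₂) (m₁' + m₂') :=
  (h.add_right _).trans (h'.add_left _)

end Reading

/-! ### State sums -/

/-- A piece, together with its row and the positions of its first top and bottom points. -/
structure PlacedPiece (n : ℕ) where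
  row : ℕ
  top : ℕ
  bot : ℕ
  piece : Piece n

namespace PlacedPiece

variable {n : ℕ}

/-- The arcs of a placed piece. -/
def arcs (p : PlacedPiece n) : List (Arc n) := p.piece.arcs p.row p.top p.bot

/-- The name of the real crossing in a placed piece. -/
def name (p : PlacedPiece n) : Option (ℕ × ℕ) :=
  match p.piece with
  | .crossing .slashOver _ _ => some (p.row, p.top)
  | .crossing .backslashOver _ _ => some (p.row, p.top)
  | _ => none

end PlacedPiece

/-! ### Positions of the pieces and names of the crossings -/

section Placing

variable {n : ℕ}

/-- The pieces of a row. -/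
def rowPlaced (h : ℕ) : ℕ → ℕ → Row n → List (PlacedPiece n)
  | _, _, [] => []
  | t, u, p :: r => ⟨h, t, u, p⟩ :: rowPlaced h (t + p.top.length) (u + p.bot.length) r

/-- The pieces of a stack of rows. -/
def stackPlaced : ℕ → List (Row n) → List (PlacedPiece n)
  | _, [] => []
  | h, r :: rs => rowPlaced h 0 0 r ++ stackPlaced (h + 1) rs

theorem rowArcs_eq (h t u : ℕ) (r : Row n) :
    rowArcs h t u r = (rowPlaced h t u r).flatMap PlacedPiece.arcs := by
  induction r generalizing t u with
  | nil => rfl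
  | cons p r ih => simp [rowArcs, rowPlaced, ih, PlacedPiece.arcs]

theorem arcsFrom_eq (h : ℕ) (rows : List (Row n)) :
    arcsFrom h rows = (stackPlaced h rows).flatMap PlacedPiece.arcs := by
  induction rows generalizing h with
  | nil => rfl
  | cons r rs ih => simp [arcsFrom, stackPlaced, ih, rowArcs_eq]

@[simp] theorem rowTop_nil : Row.top ([] : Row n) = [] := rfl

@[simp] theorem rowBot_nil : Row.bot ([] : Row n) = [] := rfl

@[simp] theorem rowTop_cons (p : Piece n) (r : Row n) : Row.top (p :: r) = p.top ++ Row.top r := rfl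

@[simp] theorem rowBot_cons (p : Piece n) (r : Row n) : Row.bot (p :: r) = p.bot ++ Row.bot r := rfl

@[simp] theorem rowTop_append (r s : Row n) : Row.top (r ++ s) = Row.top r ++ Row.top s := by
  simp [Row.top]

@[simp] theorem rowBot_append (r s : Row n) : Row.bot (r ++ s) = Row.bot r ++ Row.bot s := by
  simp [Row.bot]

@[simp] theorem rowTop_idRow (v : List (Strand n)) : Row.top (idRow v) = v := by
  induction v with
  | nil => rfl
  | cons a v ih => simpa [idRow, Piece.top] using ih

@[simp] theorem rowBot_idRow (v : List (Strand n)) : Row.bot (idRow v) = v := by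
  induction v with
  | nil => rfl
  | cons a v ih => simpa [idRow, Piece.bot] using ih

theorem rowPlaced_append (h t u : ℕ) (r s : Row n) : rowPlaced h t u (r ++ s) =
    rowPlaced h t u r ++ rowPlaced h (t + (Row.top r).length) (u + (Row.bot r).length) s := by
  induction r generalizing t u with
  | nil => rfl
  | cons p r ih => simp [rowPlaced, ih, add_assoc]

theorem stackPlaced_append (h : ℕ) (rs ss : List (Row n)) : stackPlaced h (rs ++ ss) =
    stackPlaced h rs ++ stackPlaced (h + rs.length) ss := by
  induction rs generalizing h with
  | nil => rfl
  | cons r rs ih => simp [stackPlaced, ih, add_assoc, add_comm 1]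

theorem rowPlaced_bounds {h t u : ℕ} {r : Row n} {p : PlacedPiece n} (hp : p ∈ rowPlaced h t u r) :
    p.row = h ∧ t ≤ p.top := by
  induction r generalizing t u with
  | nil => simp [rowPlaced] at hp
  | cons q r ih =>
    rcases List.mem_cons.1 hp with rfl | hp
    · simp
    · exact ⟨(ih hp).1, by have := (ih hp).2; omega⟩

theorem stackPlaced_bounds {h : ℕ} {rows : List (Row n)} {p : PlacedPiece n}
    (hp : p ∈ stackPlaced h rows) : h ≤ p.row := by
  induction rows generalizing h with
  | nil => simp [stackPlaced] at hp
  | cons q r ih =>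
    rcases List.mem_append.1 hp with hp | hp
    · exact (rowPlaced_bounds hp).1.ge
    · have := ih hp; omega

theorem PlacedPiece.name_eq {p : PlacedPiece n} {x : ℕ × ℕ} (h : p.name = some x) :
    x = (p.row, p.top) ∧ p.piece.top.length = 2 := by
  obtain ⟨h, t, u, p⟩ := p
  cases p with
  | crossing κ a b => cases κ <;> simp_all [PlacedPiece.name, Piece.top]
  | _ => simp [PlacedPiece.name] at h

/-- A name is the position of the top left corner. A crossing has two points at its top, so every
later piece of the row starts strictly further to the right. -/
theorem rowPlaced_names_nodup (h t u : ℕ) (r : Row n) :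
    ((rowPlaced h t u r).filterMap PlacedPiece.name).Nodup := by
  induction r generalizing t u with
  | nil => simp [rowPlaced]
  | cons p r ih =>
    rw [rowPlaced]
    cases hp : PlacedPiece.name ⟨h, t, u, p⟩ with
    | none => rw [List.filterMap_cons_none hp]; exact ih _ _
    | some x =>
      rw [List.filterMap_cons_some hp, List.nodup_cons]
      refine ⟨fun hx => ?_, ih _ _⟩
      obtain ⟨q, hq, hqx⟩ := List.mem_filterMap.1 hx
      have h1 := PlacedPiece.name_eq hp
      have h2 := PlacedPiece.name_eq hqx
      have h3 := (rowPlaced_bounds hq).2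
      have h4 := h1.1.symm.trans h2.1
      simp only [Prod.mk.injEq] at h4 h1
      omega

theorem stackPlaced_names_nodup (h : ℕ) (rows : List (Row n)) :
    ((stackPlaced h rows).filterMap PlacedPiece.name).Nodup := by
  induction rows generalizing h with
  | nil => simp [stackPlaced]
  | cons r rs ih =>
    rw [stackPlaced, List.filterMap_append, List.nodup_append]
    refine ⟨rowPlaced_names_nodup _ _ _ _, ih _, fun x hx y hy hxy => ?_⟩
    obtain ⟨p, hp, hpx⟩ := List.mem_filterMap.1 hx
    obtain ⟨q, hq, hqy⟩ := List.mem_filterMap.1 hy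
    have h1 := (PlacedPiece.name_eq hpx).1
    have h2 := (PlacedPiece.name_eq hqy).1
    have h3 := (rowPlaced_bounds hp).1
    have h4 := stackPlaced_bounds hq
    have h5 := (h1.symm.trans hxy).trans h2
    simp only [Prod.mk.injEq] at h5
    omega

theorem PlacedPiece.name_of_passage {p : PlacedPiece n} {x : Arc n} {s : Passage}
    (hx : x ∈ p.arcs) (hs : x.passage = some s) : p.name = some s.crossing := by
  obtain ⟨h, t, u, p⟩ := p
  have hmk : ∀ (a : Strand n) P Q (o : Option Passage), (mkArc a P Q o).passage = o := by
    intro a P Q o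
    unfold mkArc
    split <;> rfl
  cases p with
  | crossing κ a b =>
    cases κ <;> simp only [PlacedPiece.arcs, Piece.arcs, List.mem_cons, List.not_mem_nil,
      or_false] at hx <;> rcases hx with rfl | rfl <;> simp_all [PlacedPiece.name] <;> rw [← hs]
  | _ => simp_all [PlacedPiece.arcs, Piece.arcs]

theorem PlacedPiece.exists_passage {p : PlacedPiece n} {x : ℕ × ℕ} (h : p.name = some x) :
    ∃ a ∈ p.arcs, ∃ s, a.passage = some s ∧ s.crossing = x := by
  obtain ⟨h, t, u, p⟩ := p
  have hmk : ∀ (a : Strand n) P Q (o : Option Passage), (mkArc a P Q o).passage = o := by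
    intro a P Q o
    unfold mkArc
    split <;> rfl
  cases p with
  | crossing κ a b => cases κ <;> simp_all [PlacedPiece.name, PlacedPiece.arcs, Piece.arcs]
  | _ => simp [PlacedPiece.name] at h

end Placing

section Weights

variable {n : ℕ} {B : Type*}

/-- The arc of the strand `a` with ends `P` and `Q` and weight `w`, directed from `P` to `Q` if `a`
is directed downwards, and from `Q` to `P` otherwise. -/
def mkW {X : Type*} (a : Strand n) (P Q : X) (w : B) : WArc X n B :=
  match a.dir with
  | .down => ⟨P, Q, a.comp, w⟩
  | .up => ⟨Q, P, a.comp, w⟩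

/-- An arc of a diagram, with the weight `g s` if it passes through the crossing `s`. -/
def weigh [One B] (g : Passage → B) (x : Arc n) : WArc (ℕ × ℕ) n B :=
  ⟨x.src, x.tgt, x.comp, x.passage.elim 1 g⟩

/-- The arc without its passage. -/
def Arc.skel (x : Arc n) : WArc (ℕ × ℕ) n Unit := ⟨x.src, x.tgt, x.comp, ()⟩

theorem weigh_mkArc [One B] (g : Passage → B) (a : Strand n) (P Q : ℕ × ℕ) (o : Option Passage) :
    weigh g (mkArc a P Q o) = mkW a P Q (o.elim 1 g) := by
  obtain ⟨i, d⟩ := a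
  cases d <;> rfl

theorem mkW_rev {X : Type*} (a : Strand n) (P Q : X) (w : B) : mkW a.rev P Q w = mkW a Q P w := by
  obtain ⟨i, d⟩ := a
  cases d <;> rfl

theorem mapPts_mkW {X Y : Type*} (f : X → Y) (a : Strand n) (P Q : X) (w : B) :
    (mkW a P Q w).mapPts f = mkW a (f P) (f Q) w := by
  unfold mkW
  split <;> rfl

theorem skel_weigh [One B] (g : Passage → B) (x : Arc n) : (weigh g x).skel = x.skel := rfl

end Weights

/-! ### Iterated sums over the states of the crossings -/

section StateSum

variable {n : ℕ} {B M ι : Type*} [One B] [AddCommMonoid M] [Fintype ι]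
  (lab : Bool → CrossingKind → Direction → ι → B)

/-- The sum over the states of the real crossing in a piece. -/
def pieceSum (p : PlacedPiece n) (F : Multiset (WArc (ℕ × ℕ) n B) → M) : M :=
  if p.name.isSome then
    ∑ j, F (Multiset.ofList (p.arcs.map (weigh fun s => lab s.isOver s.kind s.dir j)))
  else F (Multiset.ofList (p.arcs.map (weigh fun _ => 1)))

/-- The sum over the states of all real crossings in a list of pieces. -/
def stateSum : List (PlacedPiece n) → (Multiset (WArc (ℕ × ℕ) n B) → M) → M
  | [], F => F 0
  | p :: ps, F => pieceSum lab p fun x => stateSum ps fun y => F (x + y)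

/-- The arcs of a list of pieces, without weights. -/
def skelOf (ps : List (PlacedPiece n)) : Multiset (WArc (ℕ × ℕ) n Unit) :=
  Multiset.ofList ((ps.flatMap PlacedPiece.arcs).map Arc.skel)

theorem skelOf_append (ps qs : List (PlacedPiece n)) :
    skelOf (ps ++ qs) = skelOf ps + skelOf qs := by
  simp [skelOf]

theorem skelOf_cons (p : PlacedPiece n) (ps : List (PlacedPiece n)) :
    skelOf (p :: ps) = Multiset.ofList (p.arcs.map Arc.skel) + skelOf ps := by
  simp [skelOf]

variable {lab}

theorem pieceSum_congr {p : PlacedPiece n} {F G : Multiset (WArc (ℕ × ℕ) n B) → M}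
    (h : ∀ x, x.map WArc.skel = Multiset.ofList (p.arcs.map Arc.skel) → F x = G x) :
    pieceSum lab p F = pieceSum lab p G := by
  have hs : ∀ g : Passage → B, Multiset.map WArc.skel (Multiset.ofList (p.arcs.map (weigh g))) =
      Multiset.ofList (p.arcs.map Arc.skel) := by
    intro g
    simp [Function.comp_def, skel_weigh]
  unfold pieceSum
  split
  · exact Finset.sum_congr rfl fun j _ => h _ (hs _)
  · exact h _ (hs _)

/-- The summands need to agree only on systems with the arcs of the given pieces. This makes
tameness, a property of the arcs without weights, available under the sum. -/
theorem stateSum_congr {ps : List (PlacedPiece n)} {F G : Multiset (WArc (ℕ × ℕ) n B) → M}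
    (h : ∀ x, x.map WArc.skel = skelOf ps → F x = G x) :
    stateSum lab ps F = stateSum lab ps G := by
  induction ps generalizing F G with
  | nil => exact h 0 rfl
  | cons p ps ih =>
    refine pieceSum_congr fun x hx => ih fun y hy => h _ ?_
    rw [Multiset.map_add, hx, hy, skelOf_cons]

theorem pieceSum_sum {κ : Type*} (s : Finset κ) (p : PlacedPiece n)
    (F : κ → Multiset (WArc (ℕ × ℕ) n B) → M) :
    pieceSum lab p (fun x => ∑ j ∈ s, F j x) = ∑ j ∈ s, pieceSum lab p (F j) := by
  unfold pieceSum
  split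
  · exact Finset.sum_comm
  · rfl

theorem stateSum_sum {κ : Type*} (s : Finset κ) (ps : List (PlacedPiece n))
    (F : κ → Multiset (WArc (ℕ × ℕ) n B) → M) :
    stateSum lab ps (fun x => ∑ j ∈ s, F j x) = ∑ j ∈ s, stateSum lab ps (F j) := by
  induction ps generalizing F with
  | nil => rfl
  | cons p ps ih => simp only [stateSum, ih, pieceSum_sum]

theorem stateSum_append (ps qs : List (PlacedPiece n))
    (F : Multiset (WArc (ℕ × ℕ) n B) → M) : stateSum lab (ps ++ qs) F =
      stateSum lab ps fun x => stateSum lab qs fun y => F (x + y) := by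
  induction ps generalizing F with
  | nil => simp [stateSum]
  | cons p ps ih => simp [stateSum, ih, add_assoc]

theorem pieceSum_comm (ps : List (PlacedPiece n)) (q : PlacedPiece n)
    (F : Multiset (WArc (ℕ × ℕ) n B) → Multiset (WArc (ℕ × ℕ) n B) → M) :
    (stateSum lab ps fun x => pieceSum lab q fun y => F x y) =
      pieceSum lab q fun y => stateSum lab ps fun x => F x y := by
  unfold pieceSum
  split
  · exact stateSum_sum _ _ _
  · rfl

/-- Serves to sum over the states of a local diagram last, with the states of all other crossings
fixed. -/
theorem stateSum_comm (ps qs : List (PlacedPiece n))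
    (F : Multiset (WArc (ℕ × ℕ) n B) → Multiset (WArc (ℕ × ℕ) n B) → M) :
    (stateSum lab ps fun x => stateSum lab qs fun y => F x y) =
      stateSum lab qs fun y => stateSum lab ps fun x => F x y := by
  induction qs generalizing F with
  | nil => rfl
  | cons q qs ih => simp only [stateSum, pieceSum_comm, ih]

/-- The sum does not see the name of a crossing, only the ends of the arcs. A piece has at most two
points at the top and two at the bottom, so the values of `f` at offsets 0 and 1 suffice. -/
theorem pieceSum_relocate {f : ℕ × ℕ → ℕ × ℕ} {h t u h' t' u' : ℕ} {p : Piece n}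
    (ht : ∀ j < p.top.length, f (h, t + j) = (h', t' + j))
    (hu : ∀ j < p.bot.length, f (h + 1, u + j) = (h' + 1, u' + j))
    (F : Multiset (WArc (ℕ × ℕ) n B) → M) :
    pieceSum lab ⟨h', t', u', p⟩ F =
      pieceSum lab ⟨h, t, u, p⟩ fun m => F (m.map (WArc.mapPts f)) := by
  have ht0 := ht 0
  have ht1 := ht 1
  have hu0 := hu 0
  have hu1 := hu 1
  cases p with
  | crossing κ a b =>
    cases κ <;> simp [Piece.top, Piece.bot] at ht0 ht1 hu0 hu1 <;>
      simp [pieceSum, PlacedPiece.name, PlacedPiece.arcs, Piece.arcs, weigh_mkArc, mapPts_mkW,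
        ht0, ht1, hu0, hu1]
  | _ =>
    simp [Piece.top, Piece.bot] at ht0 ht1 hu0 hu1
    simp [pieceSum, PlacedPiece.name, PlacedPiece.arcs, Piece.arcs, weigh_mkArc, mapPts_mkW,
        ht0, ht1, hu0, hu1]

theorem stateSum_relocate_row {f : ℕ × ℕ → ℕ × ℕ} {h h' : ℕ} (r : Row n) {t u t' u' : ℕ}
    (ht : ∀ j < (Row.top r).length, f (h, t + j) = (h', t' + j))
    (hu : ∀ j < (Row.bot r).length, f (h + 1, u + j) = (h' + 1, u' + j))
    (F : Multiset (WArc (ℕ × ℕ) n B) → M) :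
    stateSum lab (rowPlaced h' t' u' r) F =
      stateSum lab (rowPlaced h t u r) fun m => F (m.map (WArc.mapPts f)) := by
  induction r generalizing t u t' u' F with
  | nil => rfl
  | cons p r ih =>
    simp only [rowTop_cons, rowBot_cons, List.length_append] at ht hu
    simp only [rowPlaced, stateSum, Multiset.map_add]
    rw [pieceSum_relocate (f := f) (h := h) (t := t) (u := u) (fun j hj => ht j (by omega))
      (fun j hj => hu j (by omega))]
    congr 1
    funext x
    refine ih (fun j hj => ?_) (fun j hj => ?_) _
    · rw [add_assoc, add_assoc]; exact ht _ (by omega)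
    · rw [add_assoc, add_assoc]; exact hu _ (by omega)

theorem stateSum_relocate_stack {f : ℕ × ℕ → ℕ × ℕ} (rows : List (Row n)) {h h' : ℕ}
    (hf : ∀ i ≤ rows.length, ∀ j, f (h + i, j) = (h' + i, j))
    (F : Multiset (WArc (ℕ × ℕ) n B) → M) :
    stateSum lab (stackPlaced h' rows) F =
      stateSum lab (stackPlaced h rows) fun m => F (m.map (WArc.mapPts f)) := by
  induction rows generalizing h h' F with
  | nil => rfl
  | cons r rs ih =>
    simp only [stackPlaced, stateSum_append, Multiset.map_add]
    rw [stateSum_relocate_row (f := f) (h := h) (t := 0) (u := 0) r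
      (fun j _ => by simpa using hf 0 (by simp) j)
      (fun j _ => by simpa using hf 1 (by simp) j)]
    congr 1
    funext x
    refine ih (fun i hi j => ?_) _
    have := hf (i + 1) (by simpa using hi) j
    simpa [add_assoc, add_comm 1] using this

end StateSum

/-! ### Iterated sums as sums over functions -/

section States

variable {M ι X : Type*} [AddCommMonoid M] [Fintype ι] [DecidableEq X]

/-- A function on a finite set, extended by `none`. -/
def extend (S : Finset X) (c : S → ι) (x : X) : Option ι :=
  if h : x ∈ S then some (c ⟨x, h⟩) else none

theorem sum_extend_insert {S : Finset X} {x : X} (hx : x ∉ S) (G : (X → Option ι) → M) :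
    ∑ c : (↥(insert x S) → ι), G (extend _ c) =
      ∑ j, ∑ c : (S → ι), G (Function.update (extend S c) x (some j)) := by
  rw [← Fintype.sum_prod_type' (f := fun j c => G (Function.update (extend S c) x (some j)))]
  refine Fintype.sum_equiv (ι := ↥(insert x S) → ι) (κ := ι × (S → ι))
    { toFun := fun c => (c ⟨x, Finset.mem_insert_self _ _⟩,
        fun y => c ⟨y, Finset.mem_insert_of_mem y.2⟩)
      invFun := fun d y => if h : (y : X) = x then d.1
        else d.2 ⟨y, (Finset.mem_insert.1 y.2).resolve_left h⟩
      left_inv := fun c => ?_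
      right_inv := fun d => ?_ } _ _ fun c => ?_
  · funext y
    obtain ⟨y, hy⟩ := y
    by_cases h : y = x
    · subst h; simp
    · simp [h]
  · refine Prod.ext (by simp) ?_
    funext y
    have : (y : X) ≠ x := fun h => hx (h ▸ y.2)
    simp [this]
  · congr 1
    funext y
    by_cases h : y = x
    · subst h
      simp [extend]
    · simp [extend, h]

variable {n : ℕ} {B : Type*} [One B] {lab : Bool → CrossingKind → Direction → ι → B}

/-- Because the names are distinct, each crossing contributes one independent coordinate of the
state `c`, and passages through different crossings never share an index. -/
theorem stateSum_eq_sum (ps : List (PlacedPiece n)) (S : Finset (ℕ × ℕ))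
    (hps : (ps.filterMap PlacedPiece.name).Nodup)
    (hS : S = (ps.filterMap PlacedPiece.name).toFinset) (F : Multiset (WArc (ℕ × ℕ) n B) → M) :
    stateSum lab ps F = ∑ c : (S → ι), F (Multiset.ofList ((ps.flatMap PlacedPiece.arcs).map
      (weigh fun s => (extend S c s.crossing).elim 1 (lab s.isOver s.kind s.dir)))) := by
  induction ps generalizing S F with
  | nil =>
    subst hS
    have : IsEmpty (([] : List (PlacedPiece n)).filterMap PlacedPiece.name).toFinset :=
      ⟨fun x => absurd x.2 (by simp)⟩
    rw [Fintype.sum_unique]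
    rfl
  | cons p ps ih =>
    rw [stateSum, pieceSum]
    cases hp : p.name with
    | none =>
      rw [List.filterMap_cons_none hp] at hps hS
      rw [if_neg (by simp), ih S hps hS]
      refine Finset.sum_congr rfl fun c _ => ?_
      rw [List.flatMap_cons, List.map_append, ← Multiset.coe_add]
      congr 3
      refine List.map_congr_left fun x hx => ?_
      cases hs : x.passage with
      | none => simp [weigh, hs]
      | some s => simp [PlacedPiece.name_of_passage hx hs] at hp
    | some x =>
      rw [List.filterMap_cons_some hp] at hps hS
      rw [List.nodup_cons] at hps
      rw [List.toFinset_cons] at hS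
      subst hS
      rw [if_pos (by simp), sum_extend_insert (by simpa using hps.1) (fun c => F
        (Multiset.ofList (((p :: ps).flatMap PlacedPiece.arcs).map (weigh fun s => (c s.crossing).elim 1
          (lab s.isOver s.kind s.dir)))))]
      refine Finset.sum_congr rfl fun j _ => ?_
      rw [ih _ hps.2 rfl]
      refine Finset.sum_congr rfl fun c _ => ?_
      rw [List.flatMap_cons, List.map_append, ← Multiset.coe_add]
      congr 3
      · refine List.map_congr_left fun a ha => ?_
        cases hs : a.passage with
        | none => simp [weigh, hs]
        | some s =>
          have := PlacedPiece.name_of_passage ha hs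
          obtain rfl : x = s.crossing := by simpa [hp] using this
          simp [weigh, hs]
      · refine List.map_congr_left fun a ha => ?_
        cases hs : a.passage with
        | none => simp [weigh, hs]
        | some s =>
          obtain ⟨q, hq, ha⟩ := List.mem_flatMap.1 ha
          have hqn := PlacedPiece.name_of_passage ha hs
          have : s.crossing ≠ x := by
            rintro rfl
            exact hps.1 (List.mem_filterMap.2 ⟨q, hq, hqn⟩)
          simp [weigh, hs, this]


end States

/-! ### The arcs of a diagram form curves -/

section Ends

variable {n : ℕ}

/-- The points on the line `h`, from the position `t` on, at which the strands of `v` have the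
direction `d`, with the components of these strands. -/
def linePoints (d : Direction) (h : ℕ) : ℕ → List (Strand n) → Multiset ((ℕ × ℕ) × Fin n)
  | _, [] => 0
  | t, a :: v => (if a.dir = d then {((h, t), a.comp)} else 0) + linePoints d h (t + 1) v

/-- The source or the target of an arc, with its component. -/
def endPoint : Direction → WArc (ℕ × ℕ) n Unit → (ℕ × ℕ) × Fin n
  | .down, x => (x.src, x.comp)
  | .up, x => (x.tgt, x.comp)

theorem linePoints_append (d : Direction) (h t : ℕ) (v w : List (Strand n)) :
    linePoints d h t (v ++ w) = linePoints d h t v + linePoints d h (t + v.length) w := by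
  induction v generalizing t with
  | nil => simp [linePoints]
  | cons a v ih => simp [linePoints, ih, add_assoc, add_comm 1]

theorem mem_linePoints {d : Direction} {h t : ℕ} {v : List (Strand n)} {x : (ℕ × ℕ) × Fin n} :
    x ∈ linePoints d h t v ↔
      x.1.1 = h ∧ ∃ j, x.1.2 = t + j ∧ v[j]? = some ⟨x.2, d⟩ := by
  obtain ⟨⟨y, z⟩, i⟩ := x
  induction v generalizing t with
  | nil => simp [linePoints]
  | cons a v ih =>
    obtain ⟨c, e⟩ := a
    simp only [linePoints, Multiset.mem_add, ih]
    constructor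
    · rintro (h1 | ⟨h1, j, h2, h3⟩)
      · split at h1
        · next he =>
          simp only [Multiset.mem_singleton, Prod.mk.injEq] at h1
          obtain ⟨⟨rfl, rfl⟩, rfl⟩ := h1
          exact ⟨rfl, 0, by simp, by simpa using he⟩
        · simp at h1
      · exact ⟨h1, j + 1, by omega, by simpa using h3⟩
    · rintro ⟨h1, j, h2, h3⟩
      cases j with
      | zero =>
        left
        simp only [List.getElem?_cons_zero, Option.some.injEq, Strand.mk.injEq] at h3
        simp_all
      | succ j => exact Or.inr ⟨h1, j, by omega, by simpa using h3⟩

theorem linePoints_nodup (d : Direction) (h t : ℕ) (v : List (Strand n)) :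
    ((linePoints d h t v).map Prod.fst).Nodup := by
  induction v generalizing t with
  | nil => simp [linePoints]
  | cons a v ih =>
    rw [linePoints]
    split
    · rw [Multiset.singleton_add, Multiset.map_cons, Multiset.nodup_cons]
      refine ⟨fun hx => ?_, ih _⟩
      obtain ⟨x, hx, e⟩ := Multiset.mem_map.1 hx
      obtain ⟨h1, j, h2, -⟩ := mem_linePoints.1 hx
      rw [e] at h2
      simp only at h2
      omega
    · simpa using ih _

theorem endPoint_skel_mkArc (d : Direction) (a : Strand n) (P Q : ℕ × ℕ) (o : Option Passage) :
    endPoint d (mkArc a P Q o).skel = (if a.dir = d then P else Q, a.comp) := by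
  obtain ⟨i, e⟩ := a
  cases d <;> cases e <;> rfl

/-- An arc leaves a point at the top of a piece if its strand goes down there, and a point at the
bottom if it goes up. For targets the directions are exchanged. -/
theorem map_endPoint_piece (d : Direction) (h t u : ℕ) (p : Piece n) :
    Multiset.map (endPoint d) (Multiset.ofList ((p.arcs h t u).map Arc.skel)) =
      linePoints d h t p.top + linePoints d.rev (h + 1) u p.bot := by
  have hs : ∀ (κ : CrossingKind) (a b : Strand n),
      Multiset.map (endPoint d)
        (Multiset.ofList (((Piece.crossing κ a b).arcs h t u).map Arc.skel)) =
        {(if a.dir = d then (h, t) else (h + 1, u + 1), a.comp)} +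
          {(if b.dir = d then (h, t + 1) else (h + 1, u), b.comp)} := by
    intro κ a b
    cases κ <;> simp [Piece.arcs, endPoint_skel_mkArc] <;> rfl
  cases p with
  | crossing κ a b =>
    rw [hs]
    obtain ⟨i, e⟩ := a
    obtain ⟨j, e'⟩ := b
    cases d <;> cases e <;> cases e' <;>
      simp [Piece.top, Piece.bot, linePoints, Direction.rev, add_comm]
  | strand a =>
    obtain ⟨i, e⟩ := a
    cases d <;> cases e <;>
      simp [Piece.top, Piece.bot, Piece.arcs, linePoints, Direction.rev, endPoint_skel_mkArc]
  | max a =>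
    obtain ⟨i, e⟩ := a
    cases d <;> cases e <;>
      simp [Piece.top, Piece.bot, Piece.arcs, linePoints, Direction.rev, endPoint_skel_mkArc,
        Strand.rev]
  | min a =>
    obtain ⟨i, e⟩ := a
    cases d <;> cases e <;>
      simp [Piece.top, Piece.bot, Piece.arcs, linePoints, Direction.rev, endPoint_skel_mkArc,
        Strand.rev]

theorem map_endPoint_row (d : Direction) (h t u : ℕ) (r : Row n) :
    (skelOf (rowPlaced h t u r)).map (endPoint d) =
      linePoints d h t (Row.top r) + linePoints d.rev (h + 1) u (Row.bot r) := by
  induction r generalizing t u with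
  | nil => simp [rowPlaced, skelOf, linePoints]
  | cons p r ih =>
    rw [rowPlaced, skelOf_cons, Multiset.map_add, ih, PlacedPiece.arcs, map_endPoint_piece,
      rowTop_cons, rowBot_cons, linePoints_append, linePoints_append]
    abel

theorem map_endPoint_stack_cons (d : Direction) (h : ℕ) (r : Row n) (rs : List (Row n)) :
    (skelOf (stackPlaced h (r :: rs))).map (endPoint d) =
      linePoints d h 0 (Row.top r) + linePoints d.rev (h + 1) 0 (Row.bot r) +
        (skelOf (stackPlaced (h + 1) rs)).map (endPoint d) := by
  rw [stackPlaced, skelOf_append, Multiset.map_add, map_endPoint_row]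

/-- Control of the two outer lines of a stack. The top line is needed for gluing on one more row,
and both lines for finding the ends of components with boundary. -/
theorem mem_endPoint_stack {d : Direction} {h : ℕ} {rows : List (Row n)} {x : (ℕ × ℕ) × Fin n}
    (hx : x ∈ (skelOf (stackPlaced h rows)).map (endPoint d)) :
    h ≤ x.1.1 ∧ (x.1.1 = h → ∃ r ∈ rows.head?, x ∈ linePoints d h 0 (Row.top r)) ∧
      x.1.1 ≤ h + rows.length ∧
      (x.1.1 = h + rows.length →
        ∃ r ∈ rows.getLast?, x ∈ linePoints d.rev (h + rows.length) 0 (Row.bot r)) := by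
  induction rows generalizing h with
  | nil => simp [stackPlaced, skelOf] at hx
  | cons r rs ih =>
    rw [map_endPoint_stack_cons, Multiset.mem_add, Multiset.mem_add] at hx
    rcases hx with (hx | hx) | hx
    · have := (mem_linePoints.1 hx).1
      refine ⟨by omega, fun _ => ⟨r, by simp, hx⟩, by omega, fun h' => ?_⟩
      simp only [List.length_cons] at h'
      omega
    · have h1 := (mem_linePoints.1 hx).1
      refine ⟨by omega, fun h' => by omega, by simp; omega, fun h' => ?_⟩
      simp only [List.length_cons] at h'
      have : rs = [] := List.length_eq_zero_iff.1 (by omega)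
      subst this
      exact ⟨r, by simp, by simpa using hx⟩
    · obtain ⟨h1, -, h3, h4⟩ := ih hx
      refine ⟨by omega, fun h' => by omega, by simp; omega, fun h' => ?_⟩
      simp only [List.length_cons] at h' ⊢
      obtain ⟨s, hs, h5⟩ := h4 (by omega)
      refine ⟨s, ?_, ?_⟩
      · rw [List.getLast?_cons]
        simp only [Option.mem_def] at hs
        simp [hs]
      · rw [show h + (rs.length + 1) = h + 1 + rs.length by omega]
        exact h5

/-- At a point of an inner line the rows above and below see the same strand. If it goes down, the
point is a source for the lower row only and a target for the upper row only; if it goes up, the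
other way round. -/
theorem endPoint_stack_nodup (d : Direction) (h : ℕ) (rows : List (Row n))
    (fits : rows.IsChain fun r s => Row.bot r = Row.top s) :
    (((skelOf (stackPlaced h rows)).map (endPoint d)).map Prod.fst).Nodup := by
  induction rows generalizing h with
  | nil => simp [stackPlaced, skelOf]
  | cons r rs ih =>
    rw [List.isChain_cons] at fits
    rw [map_endPoint_stack_cons, Multiset.map_add, Multiset.map_add]
    refine Multiset.nodup_add.2 ⟨Multiset.nodup_add.2 ⟨linePoints_nodup _ _ _ _,
      linePoints_nodup _ _ _ _, ?_⟩, ih _ fits.2, ?_⟩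
    · refine Multiset.disjoint_left.2 fun {y} hy hy' => ?_
      obtain ⟨x, hx, rfl⟩ := Multiset.mem_map.1 hy
      obtain ⟨x', hx', e⟩ := Multiset.mem_map.1 hy'
      have h1 := (mem_linePoints.1 hx).1
      have h2 := (mem_linePoints.1 hx').1
      rw [e] at h2
      omega
    · refine Multiset.disjoint_left.2 fun {y} hy hy' => ?_
      obtain ⟨x', hx', rfl⟩ := Multiset.mem_map.1 hy'
      obtain ⟨h1, h2, -⟩ := mem_endPoint_stack hx'
      rw [← Multiset.map_add] at hy
      obtain ⟨x, hx, e⟩ := Multiset.mem_map.1 hy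
      rcases Multiset.mem_add.1 hx with hx | hx
      · have h3 := (mem_linePoints.1 hx).1
        rw [e] at h3
        omega
      · obtain ⟨h3, j, h4, h5⟩ := mem_linePoints.1 hx
        rw [e] at h3 h4
        obtain ⟨s, hs, h6⟩ := h2 h3
        obtain ⟨-, j', h7, h8⟩ := mem_linePoints.1 h6
        rw [fits.1 s hs] at h5
        obtain rfl : j = j' := by omega
        rw [h5] at h8
        simp only [Option.some.injEq, Strand.mk.injEq] at h8
        exact absurd h8.2 (by cases d <;> simp [Direction.rev])

theorem rev_ne (d : Direction) : d.rev ≠ d := by cases d <;> simp [Direction.rev]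

theorem rev_rev (d : Direction) : d.rev.rev = d := by cases d <;> rfl

variable {μ : Fin n → Thickness} {ν : Fin n → ComponentType}

theorem ColoredDiagram.skelOf_eq (Z : ColoredDiagram μ ν) :
    skelOf (stackPlaced 0 Z.rows) = Multiset.ofList ((arcs Z.rows).map Arc.skel) := by
  rw [skelOf, arcs, arcsFrom_eq]

theorem isTour_of_isTraversal {Z : ColoredDiagram μ ν} {i : Fin n} {l : List (Arc n)}
    {B : Type*} (φ : Arc n → WArc (ℕ × ℕ) n B)
    (h1 : ∀ x, (φ x).src = x.src) (h2 : ∀ x, (φ x).tgt = x.tgt) (h3 : ∀ x, (φ x).comp = x.comp)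
    (h : IsTraversal Z.rows i l) :
    IsTour (Multiset.ofList ((arcs Z.rows).map φ)) i (l.map φ) := by
  refine ⟨by simpa using h.1, ?_, ?_⟩
  · rw [Multiset.filter_coe, Multiset.coe_eq_coe, List.filter_map]
    simp only [Function.comp_def, h3]
    exact h.2.1.map φ
  · rw [IsPath, List.isChain_map]
    simpa only [h1, h2] using h.2.2

theorem ColoredDiagram.tame (Z : ColoredDiagram μ ν) :
    Tame (fun i => ν i = .closed) (skelOf (stackPlaced 0 Z.rows)) := by
  have hnd := fun d => endPoint_stack_nodup d 0 Z.rows Z.fits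
  refine ⟨?_, ?_, fun i => ?_, fun i hi => ?_⟩
  · have := hnd .down
    rwa [Multiset.map_map] at this
  · have := hnd .up
    rwa [Multiset.map_map] at this
  · obtain ⟨l, hl⟩ := Z.connected i
    rw [Z.skelOf_eq]
    exact ⟨_, isTour_of_isTraversal Arc.skel (fun _ => rfl) (fun _ => rfl) (fun _ => rfl) hl⟩
  · have hi' : ν i = .bounded := by
      cases h : ν i with
      | bounded => rfl
      | closed => exact absurd h hi
    have key : ∀ (x : (ℕ × ℕ) × Fin n) (d : Direction), x.2 = i →
        x ∈ (skelOf (stackPlaced 0 Z.rows)).map (endPoint d) →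
        (∀ y ∈ (skelOf (stackPlaced 0 Z.rows)).map (endPoint d.rev), y.1 ≠ x.1) →
        ∃ z ∈ skelOf (stackPlaced 0 Z.rows), z.comp = i ∧
          ((∀ y ∈ skelOf (stackPlaced 0 Z.rows), y.tgt ≠ z.src) ∨
            (∀ y ∈ skelOf (stackPlaced 0 Z.rows), y.src ≠ z.tgt)) := by
      intro x d hxi hx hne
      obtain ⟨z, hz, rfl⟩ := Multiset.mem_map.1 hx
      refine ⟨z, hz, ?_, ?_⟩
      · cases d <;> exact hxi
      · cases d
        · exact Or.inl fun y hy => hne _ (Multiset.mem_map_of_mem _ hy)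
        · exact Or.inr fun y hy => hne _ (Multiset.mem_map_of_mem _ hy)
    obtain ⟨a, ha, hai⟩ := (Z.type_eq i).1 hi'
    rcases List.mem_append.1 ha with ha | ha
    · cases hrows : Z.rows with
      | nil => simp [hrows] at ha
      | cons r rs =>
        rw [hrows] at ha key
        simp only [List.head?_cons, Option.map_some, Option.getD_some] at ha
        obtain ⟨j, hj⟩ := List.mem_iff_getElem?.1 ha
        -- A point of the top line is a source but no target if its strand goes down, and a target
        -- but no source if it goes up, so `a.dir` selects the right kind of end.
        refine key ((0, j), i) a.dir rfl ?_ fun y hy e => ?_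
        · rw [map_endPoint_stack_cons, add_assoc, Multiset.mem_add]
          left
          rw [mem_linePoints]
          exact ⟨rfl, j, by simp, by rw [hj, ← hai]⟩
        · obtain ⟨-, h2, -⟩ := mem_endPoint_stack hy
          obtain ⟨s, hs, h3⟩ := h2 (by rw [e])
          obtain ⟨-, j', h4, h5⟩ := mem_linePoints.1 h3
          obtain rfl : r = s := by simpa using hs
          rw [e] at h4
          obtain rfl : j = j' := by simpa using h4
          rw [hj] at h5
          exact rev_ne a.dir (congrArg Strand.dir (Option.some.inj h5)).symm
    · rcases Z.rows.eq_nil_or_concat' with hrows | ⟨rs, r, hrows⟩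
      · simp [hrows] at ha
      · rw [hrows] at ha key ⊢
        simp only [List.getLast?_append, List.getLast?_singleton, Option.some_or, Option.map_some,
          Option.getD_some] at ha
        obtain ⟨j, hj⟩ := List.mem_iff_getElem?.1 ha
        -- On the bottom line the roles of sources and targets are exchanged, hence the reversed
        -- direction.
        refine key ((rs.length + 1, j), i) a.dir.rev rfl ?_ fun y hy e => ?_
        · rw [stackPlaced_append, skelOf_append, Multiset.map_add, map_endPoint_stack_cons,
            Multiset.mem_add, Multiset.mem_add, Multiset.mem_add]
          right; left; right
          rw [rev_rev, mem_linePoints]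
          exact ⟨by simp, j, by simp, by rw [hj, ← hai]⟩
        · obtain ⟨-, -, -, h2⟩ := mem_endPoint_stack hy
          obtain ⟨s, hs, h3⟩ := h2 (by rw [e]; simp)
          obtain ⟨-, j', h4, h5⟩ := mem_linePoints.1 h3
          obtain rfl : r = s := by simpa using hs
          rw [e] at h4
          obtain rfl : j = j' := by simpa using h4
          rw [hj, rev_rev] at h5
          exact rev_ne a.dir (congrArg Strand.dir (Option.some.inj h5)).symm

end Ends

/-! ### The antipode and the Heisenberg double -/

section Antipode

open Coalgebra HopfAlgebra WithConv HeisenbergDouble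

variable {k A : Type*} [Field k] [Ring A] [HopfAlgebra k A]

/-- The antipode is an anti-homomorphism of coalgebras. -/
theorem comul_antipode (a : A) {J : Type*} (r : Coalgebra.Repr k a J) :
    comul (antipode k a) =
      ∑ i ∈ r.index, antipode k (r.right i) ⊗ₜ[k] antipode k (r.left i) := by
  let i₁ : A →ₐ[k] A ⊗[k] A := Algebra.TensorProduct.includeLeft
  let i₂ : A →ₐ[k] A ⊗[k] A := Algebra.TensorProduct.includeRight
  -- In the convolution algebra of maps from `A` to `A ⊗ A` the comultiplication is the product of
  -- the two inclusions. Both sides of the claim are inverse to it, one from the left and one from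
  -- the right.
  have hδ : toConv (comul : A →ₗ[k] A ⊗[k] A) =
      toConv i₁.toLinearMap * toConv i₂.toLinearMap := by
    ext a
    rw [(ℛ k a).convMul_apply]
    simp [i₁, i₂, (ℛ k a).eq]
  have h1 : ∀ j : A →ₐ[k] A ⊗[k] A,
      toConv (j.toLinearMap ∘ₗ antipode k) * toConv j.toLinearMap = 1 := by
    intro j
    ext a
    rw [(ℛ k a).convMul_apply]
    simp only [LinearMap.comp_apply, AlgHom.toLinearMap_apply, ← map_mul, ← map_sum,
      sum_antipode_mul_eq_algebraMap_counit]
    simp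
  have hG : (toConv (i₂.toLinearMap ∘ₗ antipode k) * toConv (i₁.toLinearMap ∘ₗ antipode k)) *
      toConv (comul : A →ₗ[k] A ⊗[k] A) = 1 := by
    rw [hδ, mul_assoc, ← mul_assoc (toConv (i₁.toLinearMap ∘ₗ antipode k)), h1, one_mul, h1]
  have := left_inv_eq_right_inv hG LinearMap.comul_right_inv
  have := congrArg (fun f : WithConv (A →ₗ[k] A ⊗[k] A) => f a) this
  simp only [r.convMul_apply] at this
  simpa [i₁, i₂] using this.symm

theorem ofDual_mul_ofAlg (f : Module.Dual k A) (a : A) : ofDual f * ofAlg a = mk f a := by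
  rw [ofDual, ofAlg, mk_mul_mk _ _ _ _ ⟨{()}, fun _ => 1, fun _ => 1, by
    simp [Algebra.TensorProduct.one_def]⟩]
  have : translate k A 1 Coalgebra.counit = (Coalgebra.counit : Module.Dual k A) := by
    ext; simp
  simp [this, dualMul_counit]

/-- The coproduct may be presented by an arbitrary sum, so that the presentation given by
`comul_antipode` can be inserted. -/
theorem ofAlg_mul_ofDual (f : Module.Dual k A) {a : A} {J : Type*} (s : Finset J) (x y : J → A)
    (h : comul a = ∑ i ∈ s, x i ⊗ₜ[k] y i) :
    ofAlg a * ofDual f = ∑ i ∈ s, ofDual (translate k A (x i) f) * ofAlg (y i) := by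
  rw [ofDual, ofAlg, mk_mul_mk _ _ _ _ ⟨s, x, y, h.symm⟩]
  refine Finset.sum_congr rfl fun i _ => ?_
  rw [ofDual_mul_ofAlg, counit_dualMul, mul_one]

variable (k A) in
/-- The embedding of `A`, as a linear map. -/
def ofAlgL : A →ₗ[k] HeisenbergDouble k A := TensorProduct.mk k _ _ (counit : Module.Dual k A)

variable (k A) in
/-- The embedding of the dual of `A`, as a linear map. -/
def ofDualL : Module.Dual k A →ₗ[k] HeisenbergDouble k A := (TensorProduct.mk k _ _).flip (1 : A)

theorem ofAlgL_apply (a : A) : ofAlgL k A a = ofAlg a := rfl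

theorem ofAlg_mul_ofAlg (a b : A) : (ofAlg a * ofAlg b : HeisenbergDouble k A) = ofAlg (a * b) := by
  have ht : ∀ x : A, translate k A x counit =
      (counit (R := k) x) • (counit : Module.Dual k A) := by
    intro x; ext y; simp [mul_comm]
  rw [ofAlg, ofAlg, mk_mul_mk _ _ _ _ (ℛ k a)]
  have hm : ∀ (c : k) (y : A), HeisenbergDouble.mk (c • (counit : Module.Dual k A)) y =
      ofAlgL k A (c • y) := fun c y => TensorProduct.smul_tmul c _ y
  simp only [ht, map_smul, counit_dualMul, hm]
  conv_rhs => rw [← sum_counit_smul (R := k) (ℛ k a), Finset.sum_mul]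
  simp only [← ofAlgL_apply, map_sum, smul_mul_assoc, map_smul]

theorem ofDual_mul_ofDual (f g : Module.Dual k A) :
    (ofDual f * ofDual g : HeisenbergDouble k A) = ofDual (dualMul k A f g) := by
  rw [ofDual, ofDual, mk_mul_mk _ _ _ _ ⟨{()}, fun _ => 1, fun _ => 1, by
    simp [Algebra.TensorProduct.one_def]⟩]
  have : translate k A 1 g = g := by
    ext; simp
  simp [this, ofDual]

variable (hγ : Function.Bijective (antipode k : A →ₗ[k] A))

theorem antipode_antipodeInv (x : A) : antipode k (antipodeInv hγ x) = x :=
  (LinearEquiv.ofBijective (antipode k : A →ₗ[k] A) hγ).apply_symm_apply x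

theorem antipodeInv_antipode (x : A) : antipodeInv hγ (antipode k x) = x :=
  (LinearEquiv.ofBijective (antipode k : A →ₗ[k] A) hγ).symm_apply_apply x

theorem antipodeInv_mul (x y : A) :
    antipodeInv hγ (x * y) = antipodeInv hγ y * antipodeInv hγ x := by
  apply hγ.1
  rw [antipode_antipodeInv, antipode_mul_antidistrib, antipode_antipodeInv, antipode_antipodeInv]

theorem dualAntipodeInv_apply (f : Module.Dual k A) (x : A) :
    dualAntipodeInv hγ f x = f (antipodeInv hγ x) := rfl

theorem dualAntipodeInv_counit : dualAntipodeInv hγ (counit : Module.Dual k A) = counit := by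
  ext x
  rw [dualAntipodeInv_apply, ← counit_antipode, antipode_antipodeInv]

theorem dualAntipodeInv_dualMul (f g : Module.Dual k A) : dualAntipodeInv hγ (dualMul k A f g) =
    dualMul k A (dualAntipodeInv hγ g) (dualAntipodeInv hγ f) := by
  ext x
  obtain ⟨a, rfl⟩ := hγ.2 x
  rw [dualAntipodeInv_apply, antipodeInv_antipode, dualMul_repr f g (ℛ k a),
    dualMul_repr _ _ ⟨(ℛ k a).index, fun i => antipode k ((ℛ k a).right i),
      fun i => antipode k ((ℛ k a).left i), (comul_antipode a (ℛ k a)).symm⟩]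
  simp [dualAntipodeInv_apply, antipodeInv_antipode, mul_comm]

/-- The functional `g(a ?)`. -/
def leftTranslate (a : A) (g : Module.Dual k A) : Module.Dual k A := g ∘ₗ LinearMap.mulLeft k a

/-- The antipode reverses products and thereby exchanges right and left translations. Two
applications restore the side, one does not; this produces the two forms of the commutation relation
below. -/
theorem translate_dualAntipodeInv (a : A) (g : Module.Dual k A) :
    translate k A (antipode k a) (dualAntipodeInv hγ g) =
      dualAntipodeInv hγ (leftTranslate a g) := by
  ext x
  simp [dualAntipodeInv_apply, antipodeInv_mul, antipodeInv_antipode, leftTranslate]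

theorem leftTranslate_dualAntipodeInv (a : A) (g : Module.Dual k A) :
    leftTranslate (antipode k a) (dualAntipodeInv hγ g) =
      dualAntipodeInv hγ (translate k A a g) := by
  ext x
  simp [dualAntipodeInv_apply, antipodeInv_mul, antipodeInv_antipode, leftTranslate]

end Antipode

/-! ### Labels as maps to the algebras of the components -/

section LabelMaps

open Coalgebra HopfAlgebra HeisenbergDouble

variable {k A : Type*} [Field k] [Ring A] [HopfAlgebra k A]

/-- The product of two weights met from top to bottom along a strand of the given direction. -/
def comb {R : Type*} [Mul R] : Direction → R → R → R
  | .down, x, y => y * x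
  | .up, x, y => x * y

theorem comb_one_left {R : Type*} [Monoid R] (d : Direction) (x : R) : comb d 1 x = x := by
  cases d <;> simp [comb]

theorem comb_one_right {R : Type*} [Monoid R] (d : Direction) (x : R) : comb d x 1 = x := by
  cases d <;> simp [comb]

variable (k A) in
/-- The map `toColor`, as a linear map. -/
def toColorL : (τ : Thickness) → HeisenbergDouble k A →ₗ[k] ColorAlgebra k A τ
  | .thin => LinearMap.id
  | .thick => (MulOpposite.opLinearEquiv k).toLinearMap

variable (k A) in
/-- The label of an under strand at a crossing of kind `slashOver`. -/
def underMap (τ : Thickness) (d : Direction) : A →ₗ[k] ColorAlgebra k A τ :=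
  toColorL k A τ ∘ₗ ofAlgL k A ∘ₗ
    (match d with
      | .down => LinearMap.id
      | .up => antipode k) ∘ₗ
    (match τ with
      | .thin => LinearMap.id
      | .thick => antipode k)

variable (hγ : Function.Bijective (antipode k : A →ₗ[k] A))

/-- The label of an over strand. -/
def overMap (τ : Thickness) (d : Direction) : Module.Dual k A →ₗ[k] ColorAlgebra k A τ :=
  toColorL k A τ ∘ₗ ofDualL k A ∘ₗ
    (match d with
      | .down => LinearMap.id
      | .up => dualAntipodeInv hγ) ∘ₗ
    (match τ with
      | .thin => LinearMap.id
      | .thick => dualAntipodeInv hγ)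

theorem toColor_underLabel_slashOver (τ : Thickness) (d : Direction) (x : A) :
    toColor τ (ofAlg (underLabel (k := k) τ .slashOver d x)) = underMap k A τ d x := by
  cases τ <;> cases d <;> rfl

theorem toColor_underLabel_backslashOver (τ : Thickness) (d : Direction) (x : A) :
    toColor τ (ofAlg (underLabel (k := k) τ .backslashOver d x)) =
      underMap k A τ d (antipode k x) := by
  cases τ <;> cases d <;> rfl

theorem toColor_overLabel (τ : Thickness) (d : Direction) (f : Module.Dual k A) :
    toColor τ (ofDual (overLabel hγ τ d f)) = overMap hγ τ d f := by
  cases τ <;> cases d <;> rfl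

theorem underMap_up (τ : Thickness) (x : A) :
    underMap k A τ .up x = underMap k A τ .down (antipode k x) := by
  cases τ <;> rfl

theorem overMap_up (τ : Thickness) (f : Module.Dual k A) :
    overMap hγ τ .up f = overMap hγ τ .down (dualAntipodeInv hγ f) := by
  cases τ <;> rfl

theorem underMap_down_one (τ : Thickness) : underMap k A τ .down 1 = 1 := by
  cases τ
  · rfl
  · change MulOpposite.op (ofAlg (antipode k (1 : A))) = 1
    rw [antipode_one]
    rfl

theorem overMap_down_counit (τ : Thickness) : overMap hγ τ .down counit = 1 := by
  cases τ
  · rfl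
  · change MulOpposite.op (ofDual (dualAntipodeInv hγ counit)) = 1
    rw [dualAntipodeInv_counit]
    rfl

theorem underMap_one (τ : Thickness) (d : Direction) : underMap k A τ d 1 = 1 := by
  cases d
  · exact underMap_down_one τ
  · rw [underMap_up, antipode_one, underMap_down_one]

theorem overMap_counit (τ : Thickness) (d : Direction) : overMap hγ τ d counit = 1 := by
  cases d
  · exact overMap_down_counit hγ τ
  · rw [overMap_up, dualAntipodeInv_counit, overMap_down_counit]

/-- On a thick strand the reversal of products by the antipode cancels against the opposite
multiplication. -/
theorem underMap_down_mul (τ : Thickness) (x y : A) :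
    underMap k A τ .down (x * y) = underMap k A τ .down x * underMap k A τ .down y := by
  cases τ
  · exact (ofAlg_mul_ofAlg x y).symm
  · change MulOpposite.op (ofAlg (antipode k (x * y))) =
      MulOpposite.op (ofAlg (antipode k x)) * MulOpposite.op (ofAlg (antipode k y))
    rw [antipode_mul_antidistrib, ← ofAlg_mul_ofAlg, MulOpposite.op_mul]
    rfl

theorem overMap_down_mul (τ : Thickness) (f g : Module.Dual k A) :
    overMap hγ τ .down (dualMul k A f g) = overMap hγ τ .down f * overMap hγ τ .down g := by
  cases τ
  · exact (ofDual_mul_ofDual f g).symm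
  · change MulOpposite.op (ofDual (dualAntipodeInv hγ (dualMul k A f g))) =
      MulOpposite.op (ofDual (dualAntipodeInv hγ f)) *
        MulOpposite.op (ofDual (dualAntipodeInv hγ g))
    rw [dualAntipodeInv_dualMul, ← ofDual_mul_ofDual, MulOpposite.op_mul]

/-- On an upward strand the additional antipode reverses products once more, and this cancels
against the reversed order of reading. Hence thickness and direction disappear from the rule. -/
theorem comb_underMap (τ : Thickness) (d : Direction) (x y : A) :
    comb d (underMap k A τ d x) (underMap k A τ d y) = underMap k A τ d (y * x) := by
  cases d
  · exact (underMap_down_mul τ y x).symm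
  · simp only [comb, underMap_up]
    rw [antipode_mul_antidistrib, underMap_down_mul]

theorem comb_overMap (τ : Thickness) (d : Direction) (f g : Module.Dual k A) :
    comb d (overMap hγ τ d f) (overMap hγ τ d g) = overMap hγ τ d (dualMul k A g f) := by
  cases d
  · exact (overMap_down_mul hγ τ g f).symm
  · simp only [comb, overMap_up]
    rw [dualAntipodeInv_dualMul, overMap_down_mul]

/-- The commutation relation of the Heisenberg double, for strands on which the labels define a
homomorphism of `H(A)`. -/
theorem comb_overMap_underMap {τ : Thickness} {d : Direction}
    (h : (τ = .thin ∧ d = .down) ∨ (τ = .thick ∧ d = .up)) (f : Module.Dual k A) {a : A}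
    {J : Type*} (r : Coalgebra.Repr k a J) :
    comb d (overMap hγ τ d f) (underMap k A τ d a) = ∑ i ∈ r.index,
      comb d (underMap k A τ d (r.right i)) (overMap hγ τ d (translate k A (r.left i) f)) := by
  rcases h with ⟨rfl, rfl⟩ | ⟨rfl, rfl⟩
  · exact ofAlg_mul_ofDual f r.index r.left r.right r.eq.symm
  -- The antipode acts twice on both labels: the coproduct is reversed twice, and the translation
  -- returns to the right side. The relation therefore has the form valid for thin downward strands.
  · have h1 := comul_antipode a r
    have h2 := comul_antipode (antipode k a) ⟨r.index, _, _, h1.symm⟩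
    have h3 := ofAlg_mul_ofDual (dualAntipodeInv hγ (dualAntipodeInv hγ f)) _ _ _ h2
    simp only [translate_dualAntipodeInv, leftTranslate_dualAntipodeInv] at h3
    exact (congrArg (toColorL k A .thick) h3).trans (map_sum _ _ _)

/-- The commutation relation of the Heisenberg double, for strands on which the labels define an
anti-homomorphism of `H(A)`. -/
theorem comb_underMap_overMap {τ : Thickness} {d : Direction}
    (h : (τ = .thick ∧ d = .down) ∨ (τ = .thin ∧ d = .up)) (f : Module.Dual k A) {a : A}
    {J : Type*} (r : Coalgebra.Repr k a J) :
    comb d (underMap k A τ d a) (overMap hγ τ d f) = ∑ i ∈ r.index,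
      comb d (overMap hγ τ d (leftTranslate (r.right i) f)) (underMap k A τ d (r.left i)) := by
  -- The antipode acts once on both labels: the coproduct is reversed and the right translation
  -- becomes a left one. In both cases of `h` the product read off is the same product in the
  -- Heisenberg double, since opposite multiplication and upward direction each reverse the order.
  have h1 := ofAlg_mul_ofDual (dualAntipodeInv hγ f) _ _ _ (comul_antipode a r)
  simp only [translate_dualAntipodeInv] at h1
  rcases h with ⟨rfl, rfl⟩ | ⟨rfl, rfl⟩
  · exact (congrArg (toColorL k A .thick) h1).trans (map_sum _ _ _)
  · exact h1

end LabelMaps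

/-! ### Identities for the canonical element -/

section Canonical

open Coalgebra HopfAlgebra HeisenbergDouble

variable {k A : Type*} [Field k] [Ring A] [HopfAlgebra k A] {ι M : Type*} [Fintype ι]
  [AddCommGroup M] [Module k M] (e : Module.Basis ι k A)

theorem sum_coord_smul (f : Module.Dual k A) : ∑ j, f (e j) • e.coord j = f :=
  e.ext fun i => by
    classical
    simp

/-- A map may be moved from one factor of the canonical element to the other one. -/
theorem sum_transfer (U : A →ₗ[k] Module.Dual k A →ₗ[k] M) (α : A →ₗ[k] A) :
    ∑ j, U (α (e j)) (e.coord j) = ∑ j, U (e j) (e.coord j ∘ₗ α) := by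
  have h1 : ∀ x : A, x = ∑ i, e.coord i x • e i := fun x => (e.sum_repr x).symm
  calc _ = ∑ j, ∑ i, e.coord i (α (e j)) • U (e i) (e.coord j) := by
          refine Finset.sum_congr rfl fun j _ => ?_
          conv_lhs => rw [h1 (α (e j))]
          simp only [map_sum, map_smul, LinearMap.sum_apply, LinearMap.smul_apply]
    _ = ∑ i, ∑ j, (e.coord i ∘ₗ α) (e j) • U (e i) (e.coord j) := Finset.sum_comm
    _ = _ := by
          refine Finset.sum_congr rfl fun i _ => ?_
          simp only [← map_smul, ← map_sum, sum_coord_smul]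

/-- The comultiplication of the first factor of the canonical element corresponds to the product of
the second factors. -/
theorem sum_comul (S : A ⊗[k] A →ₗ[k] Module.Dual k A →ₗ[k] M) :
    ∑ a, ∑ b, S (e a ⊗ₜ e b) (dualMul k A (e.coord a) (e.coord b)) =
      ∑ d, S (comul (e d)) (e.coord d) := by
  have h1 : ∀ x : A, comul x = ∑ a, ∑ b,
      dualMul k A (e.coord a) (e.coord b) x • (e a ⊗ₜ[k] e b) := by
    intro x
    have h2 : ∀ t : A ⊗[k] A, t = ∑ a, ∑ b,
        LinearMap.mul' k k (TensorProduct.map (e.coord a) (e.coord b) t) • (e a ⊗ₜ[k] e b) := by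
      intro t
      induction t with
      | zero => simp
      | add s t hs ht =>
        conv_lhs => rw [hs, ht]
        simp [add_smul, Finset.sum_add_distrib]
      | tmul y z =>
        conv_lhs => rw [← e.sum_repr y, ← e.sum_repr z]
        simp only [TensorProduct.sum_tmul, TensorProduct.tmul_sum, TensorProduct.smul_tmul_smul,
          TensorProduct.map_tmul, LinearMap.mul'_apply, Module.Basis.coord_apply]
        exact Finset.sum_comm
    -- For `t = comul x` the coefficients are, by definition, the values of the dual products at
    -- `x`.
    exact h2 _
  calc _ = ∑ a, ∑ b, ∑ d,
        dualMul k A (e.coord a) (e.coord b) (e d) • S (e a ⊗ₜ e b) (e.coord d) := by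
          refine Finset.sum_congr rfl fun a _ => Finset.sum_congr rfl fun b _ => ?_
          simp only [← map_smul, ← map_sum, sum_coord_smul]
    _ = ∑ d, ∑ a, ∑ b,
        dualMul k A (e.coord a) (e.coord b) (e d) • S (e a ⊗ₜ e b) (e.coord d) := by
          exact (Finset.sum_congr rfl fun a _ => Finset.sum_comm).trans Finset.sum_comm
    _ = _ := by
          refine Finset.sum_congr rfl fun d _ => ?_
          rw [h1 (e d)]
          simp [LinearMap.sum_apply]

end Canonical

/-! ### The invariant as a state sum -/

section StateSumOfDiagram

open HeisenbergDouble

variable {k A : Type*} [Field k] [Ring A] [HopfAlgebra k A]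

variable (k A) in
/-- The map `toTarget`, as a linear map. -/
def toTargetL (τ : Thickness) : (β : ComponentType) → ColorAlgebra k A τ →ₗ[k] Target k A τ β
  | .bounded => LinearMap.id
  | .closed => (commutatorSpan k (ColorAlgebra k A τ)).mkQ

theorem toTargetL_apply (τ : Thickness) (β : ComponentType) (x : ColorAlgebra k A τ) :
    toTargetL k A τ β x = toTarget τ β x := by cases β <;> rfl

theorem toTargetL_mul_comm (τ : Thickness) {β : ComponentType} (h : β = .closed)
    (x y : ColorAlgebra k A τ) : toTargetL k A τ β (x * y) = toTargetL k A τ β (y * x) := by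
  subst h
  rw [← sub_eq_zero, ← map_sub]
  exact (Submodule.Quotient.mk_eq_zero _).2 (Submodule.subset_span ⟨x, y, rfl⟩)

variable {n : ℕ} (μ : Fin n → Thickness) (ν : Fin n → ComponentType)

variable (k A) in
/-- The way in which the values of the components are read off. -/
def reading : Reading k (fun i => ColorAlgebra k A (μ i)) (fun i => Target k A (μ i) (ν i)) where
  cl i := ν i = .closed
  π i := toTargetL k A (μ i) (ν i)
  trace i h := toTargetL_mul_comm (μ i) h

variable (hγ : Function.Bijective (HopfAlgebra.antipode k : A →ₗ[k] A))
  {ι : Type*} (e : Module.Basis ι k A)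

/-- The label of a passage, in the product of the algebras of all components. -/
def label (o : Bool) (κ : CrossingKind) (d : Direction) (j : ι) : ∀ i, ColorAlgebra k A (μ i) :=
  fun i => passageLabel hγ e (μ i) ⟨(0, 0), o, κ, d⟩ j

variable {μ ν}

/-- Arcs without a passage have weight 1, so products over all arcs agree with products over the
passages only. -/
theorem list_prod_filterMap {X Y B : Type*} [Monoid B] (p : X → Option Y) (g : Y → B)
    (l : List X) : (l.map fun x => (p x).elim 1 g).reverse.prod =
      ((l.filterMap p).map g).reverse.prod := by
  induction l with
  | nil => rfl
  | cons x l ih => cases h : p x <;> simp_all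

theorem ColoredDiagram.crossings_eq (Z : ColoredDiagram μ ν) :
    Z.crossings = ((stackPlaced 0 Z.rows).filterMap PlacedPiece.name).toFinset := by
  ext x
  simp only [ColoredDiagram.crossings, arcs, arcsFrom_eq, List.mem_toFinset, List.mem_filterMap,
    List.mem_flatMap, Option.map_eq_some_iff]
  constructor
  · rintro ⟨a, ⟨p, hp, ha⟩, s, hs, rfl⟩
    exact ⟨p, hp, PlacedPiece.name_of_passage ha hs⟩
  · rintro ⟨p, hp, hx⟩
    obtain ⟨a, ha, s, hs, rfl⟩ := PlacedPiece.exists_passage hx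
    exact ⟨a, ⟨p, hp, ha⟩, s, hs, rfl⟩

/-- The traversals chosen for `JPrime` and the tours chosen for the value may have different base
points; `Reading.val_eq` shows that this does not matter. Names of crossings have disappeared from
the right-hand side. -/
theorem JPrime_eq [Fintype ι] (Z : ColoredDiagram μ ν) : JPrime hγ e Z =
    stateSum (label μ hγ e) (stackPlaced 0 Z.rows) (reading k A μ ν).val := by
  rw [stateSum_eq_sum _ Z.crossings (stackPlaced_names_nodup _ _) Z.crossings_eq, JPrime]
  refine Finset.sum_congr rfl fun c _ => ?_
  set g : Passage → ∀ i, ColorAlgebra k A (μ i) := fun s =>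
    (extend Z.crossings c s.crossing).elim 1 (label μ hγ e s.isOver s.kind s.dir) with hg
  have htour : ∀ i, IsTour (Multiset.ofList ((arcs Z.rows).map (weigh g))) i
      ((Classical.choose (Z.connected i)).map (weigh g)) := fun i =>
    isTour_of_isTraversal _ (fun _ => rfl) (fun _ => rfl) (fun _ => rfl)
      (Classical.choose_spec (Z.connected i))
  have htame : Tame (reading k A μ ν).cl (Multiset.ofList ((arcs Z.rows).map (weigh g))) := by
    refine Z.tame.of_skel_eq ?_
    rw [Z.skelOf_eq]
    simp [Function.comp_def, WArc.skel, WArc.mapWeight, Arc.skel, weigh]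
  rw [← arcsFrom_eq, ← arcs, (reading k A μ ν).val_eq htame htour]
  congr 1
  funext i
  change _ = toTargetL k A (μ i) (ν i) _
  rw [toTargetL_apply]
  congr 1
  rw [word, Pi.list_prod_apply, List.map_reverse, List.map_map, List.map_map]
  have h1 : ((fun f : ∀ i, ColorAlgebra k A (μ i) => f i) ∘ WArc.w) ∘ weigh g =
      fun x : Arc n => x.passage.elim 1 fun s => g s i := by
    funext x
    cases h : x.passage <;> simp [weigh, h]
  rw [h1, list_prod_filterMap]
  congr 3
  funext s
  simp only [hg, extend]
  split <;> rfl

/-- The label of an under strand, in the product of the algebras of all components. -/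
def underW (μ : Fin n → Thickness) (d : Direction) : A →ₗ[k] ∀ i, ColorAlgebra k A (μ i) :=
  LinearMap.pi fun i => underMap k A (μ i) d

/-- The label of an over strand, in the product of the algebras of all components. -/
def overW (μ : Fin n → Thickness) (d : Direction) :
    Module.Dual k A →ₗ[k] ∀ i, ColorAlgebra k A (μ i) :=
  LinearMap.pi fun i => overMap hγ (μ i) d

theorem label_over (κ : CrossingKind) (d : Direction) (j : ι) :
    label μ hγ e true κ d j = overW hγ μ d (e.coord j) := by
  funext i
  exact toColor_overLabel hγ (μ i) d (e.coord j)

theorem label_under_slashOver (d : Direction) (j : ι) :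
    label μ hγ e false .slashOver d j = underW (k := k) μ d (e j) := by
  funext i
  exact toColor_underLabel_slashOver (μ i) d (e j)

theorem label_under_backslashOver (d : Direction) (j : ι) :
    label μ hγ e false .backslashOver d j =
      underW (k := k) μ d (HopfAlgebra.antipode k (e j)) := by
  funext i
  exact toColor_underLabel_backslashOver (μ i) d (e j)

theorem comb_apply {R : Fin n → Type*} [∀ i, Mul (R i)] (d : Direction) (x y : ∀ i, R i)
    (i : Fin n) : comb d x y i = comb d (x i) (y i) := by
  cases d <;> rfl

theorem comb_underW (d : Direction) (x y : A) :
    comb d (underW (k := k) μ d x) (underW (k := k) μ d y) = underW (k := k) μ d (y * x) := by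
  funext i
  rw [comb_apply]
  exact comb_underMap (μ i) d x y

theorem comb_overW (d : Direction) (f g : Module.Dual k A) :
    comb d (overW hγ μ d f) (overW hγ μ d g) = overW hγ μ d (dualMul k A g f) := by
  funext i
  rw [comb_apply]
  exact comb_overMap hγ (μ i) d f g

end StateSumOfDiagram

/-! ### Strands -/

section Strands

variable {X Y B : Type*} {n : ℕ}

/-- The arcs of the strand `a`, starting at the end `P`, with the given further points and
weights. -/
def strandArcs (a : Strand n) : X → List (X × B) → Multiset (WArc X n B)
  | _, [] => 0
  | P, (Q, w) :: l => {mkW a P Q w} + strandArcs a Q l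

/-- The last point of a strand. -/
def lastPoint : X → List (X × B) → X
  | P, [] => P
  | _, (Q, _) :: l => lastPoint Q l

/-- The product of the weights along a strand. -/
def combAll [Monoid B] (d : Direction) : List (X × B) → B
  | [] => 1
  | (_, w) :: l => comb d w (combAll d l)

/-- Vertical strands, from the positions from `t` on the line `h` to the positions from `u` on the
line `h'`. -/
def lines [One B] (h : ℕ) : ℕ → ℕ → ℕ → List (Strand n) → Multiset (WArc (ℕ × ℕ) n B)
  | _, _, _, [] => 0
  | t, h', u, a :: v => {mkW a (h, t) (h', u) 1} + lines h (t + 1) h' (u + 1) v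

theorem skel_mkW (a : Strand n) (P Q : X) (w : B) : (mkW a P Q w).skel = mkW a P Q () := by
  unfold mkW
  split <;> rfl

theorem skel_mkArc (a : Strand n) (P Q : ℕ × ℕ) (o : Option Passage) :
    (mkArc a P Q o).skel = mkW a P Q () := by
  obtain ⟨i, d⟩ := a
  cases d <;> rfl

theorem map_lines [One B] (f : ℕ × ℕ → ℕ × ℕ) {h t h' u g s g' r : ℕ} (v : List (Strand n))
    (h1 : ∀ j, f (h, t + j) = (g, s + j)) (h2 : ∀ j, f (h', u + j) = (g', r + j)) :
    (lines (B := B) h t h' u v).map (WArc.mapPts f) = lines g s g' r v := by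
  induction v generalizing t u s r with
  | nil => rfl
  | cons a v ih =>
    have h3 := h1 0
    have h4 := h2 0
    simp only [add_zero] at h3 h4
    rw [lines, Multiset.map_add, Multiset.map_singleton, mapPts_mkW, h3, h4, ih, lines]
    · intro j; rw [add_assoc, add_assoc]; exact h1 _
    · intro j; rw [add_assoc, add_assoc]; exact h2 _

namespace Reading

variable {k : Type*} [Field k] {R N : Fin n → Type*} [∀ i, Ring (R i)]
  [∀ i, Algebra k (R i)] [∀ i, AddCommGroup (N i)] [∀ i, Module k (N i)]
  (T : Reading k R N)

theorem exists_val_mkW₂ (a b : Strand n) (P Q P' Q' : X) (L : Multiset (WArc X n (∀ i, R i))) :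
    ∃ g : R a.comp →ₗ[k] R b.comp →ₗ[k] PiTensorProduct k N, ∀ w w',
      T.val ({mkW a P Q w} + {mkW b P' Q' w'} + L) = g (w a.comp) (w' b.comp) := by
  obtain ⟨i, d⟩ := a
  obtain ⟨i', d'⟩ := b
  simp only [Multiset.singleton_add, Multiset.cons_add]
  cases d <;> cases d' <;> exact T.exists_val_cons₂ _ _ _ _ i i' L

theorem exists_val_mkW₃ (a b c : Strand n) (P Q P' Q' P'' Q'' : X)
    (L : Multiset (WArc X n (∀ i, R i))) :
    ∃ g : R a.comp →ₗ[k] R b.comp →ₗ[k] R c.comp →ₗ[k] PiTensorProduct k N, ∀ w w' w'',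
      T.val ({mkW a P Q w} + {mkW b P' Q' w'} + {mkW c P'' Q'' w''} + L) =
        g (w a.comp) (w' b.comp) (w'' c.comp) := by
  obtain ⟨i, d⟩ := a
  obtain ⟨i', d'⟩ := b
  obtain ⟨i'', d''⟩ := c
  simp only [Multiset.singleton_add, Multiset.cons_add]
  cases d <;> cases d' <;> cases d'' <;> exact T.exists_val_cons₃ _ _ _ _ _ _ i i' i'' L

variable {T}

/-- On an upward strand the lower arc comes first, which is why the weights are combined by `comb`
according to the direction. -/
theorem Red.contract (a : Strand n) (P Q R' : X) (w₁ w₂ : ∀ i, R i) :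
    T.Red ({mkW a P Q w₁} + {mkW a Q R' w₂}) {mkW a P R' (comb a.dir w₁ w₂)} := by
  obtain ⟨i, d⟩ := a
  intro L hL
  cases d
  · simp only [Multiset.singleton_add, Multiset.cons_add] at hL ⊢
    exact T.val_contract hL rfl rfl
  · rw [add_comm {mkW _ P Q w₁}] at hL ⊢
    simp only [Multiset.singleton_add, Multiset.cons_add] at hL ⊢
    exact T.val_contract hL rfl rfl

theorem Red.strandArcs (a : Strand n) (P : X) (l : List (X × ∀ i, R i)) (hl : l ≠ []) :
    T.Red (strandArcs a P l) {mkW a P (lastPoint P l) (combAll a.dir l)} := by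
  induction l generalizing P with
  | nil => exact absurd rfl hl
  | cons x l ih =>
    obtain ⟨Q, w⟩ := x
    cases l with
    | nil =>
      refine Red.of_eq ?_
      simp [ColoredDiagrams.strandArcs, lastPoint, combAll, comb_one_right]
    | cons y l => exact ((ih Q (by simp)).add_left _).trans (Red.contract _ _ _ _ _ _)

theorem Red.lines (h t h' u h'' s : ℕ) (v : List (Strand n)) :
    T.Red (lines h t h' u v + lines h' u h'' s v) (lines h t h'' s v) := by
  induction v generalizing t u s with
  | nil => exact Red.of_eq rfl
  | cons a v ih =>
    have h1 := (Red.contract (T := T) a (h, t) (h', u) (h'', s) 1 1).add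
      (ih (t + 1) (u + 1) (s + 1))
    rw [comb_one_left] at h1
    refine (Red.of_eq ?_).trans h1
    simp only [ColoredDiagrams.lines]
    abel

end Reading

end Strands

/-! ### Replacement of a local diagram -/

section Local

variable {n : ℕ} {ι : Type*} [Fintype ι]

/-- With trivial weights a state sum just evaluates at the underlying arcs. Every identity of state
sums thus specializes to one of systems of arcs, which is how tameness is transported. -/
theorem stateSum_unit {M : Type*} [AddCommMonoid M] (ps : List (PlacedPiece n))
    (F : Multiset (WArc (ℕ × ℕ) n Unit) → M) :
    stateSum (fun _ _ _ (_ : Unit) => ()) ps F = F (skelOf ps) := by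
  induction ps generalizing F with
  | nil => rfl
  | cons p ps ih =>
    have hp : ∀ G : Multiset (WArc (ℕ × ℕ) n Unit) → M,
        pieceSum (fun _ _ _ (_ : Unit) => ()) p G = G (Multiset.ofList (p.arcs.map Arc.skel)) := by
      intro G
      unfold pieceSum
      split
      · rw [Fintype.sum_unique]; rfl
      · rfl
    rw [stateSum, hp, ih, skelOf_cons]

theorem skelOf_relocate {f : ℕ × ℕ → ℕ × ℕ} (rows : List (Row n)) {h h' : ℕ}
    (hf : ∀ i ≤ rows.length, ∀ j, f (h + i, j) = (h' + i, j)) :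
    skelOf (stackPlaced h' rows) = (skelOf (stackPlaced h rows)).map (WArc.mapPts f) := by
  have := stateSum_relocate_stack (lab := fun _ _ _ (_ : Unit) => ()) rows hf id
  rwa [stateSum_unit, stateSum_unit] at this

/-- Move the points below the line `h` up by `d` lines. -/
def lower (h d : ℕ) (x : ℕ × ℕ) : ℕ × ℕ := if x.1 ≤ h then x else (x.1 - d, x.2)

theorem lower_zero (h : ℕ) : lower h 0 = id := by
  funext x
  simp [lower]

theorem mapPts_id {P B : Type*} : (WArc.mapPts id : WArc P n B → WArc P n B) = id := rfl

theorem lower_of_le {h d i : ℕ} (j : ℕ) (hi : i ≤ h) : lower h d (i, j) = (i, j) := by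
  simp [lower, hi]

theorem lower_of_ge {h d i : ℕ} (j : ℕ) (hi : h + d ≤ i) : lower h d (i, j) = (i - d, j) := by
  unfold lower
  split
  · obtain rfl : d = 0 := by simp only at *; omega
    rfl
  · rfl

/-! ### Vertical strands beside a local diagram -/

section Beside

variable {B M : Type*} [One B] [AddCommMonoid M] {lab : Bool → CrossingKind → Direction → ι → B}

theorem stateSum_idRow (h t u : ℕ) (v : List (Strand n))
    (F : Multiset (WArc (ℕ × ℕ) n B) → M) :
    stateSum lab (rowPlaced h t u (idRow v)) F = F (lines h t (h + 1) u v) := by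
  induction v generalizing t u F with
  | nil => rfl
  | cons a v ih =>
    have : idRow (a :: v) = Piece.strand a :: idRow v := rfl
    rw [this, rowPlaced, stateSum, lines]
    simp only [Piece.top, Piece.bot, List.length_singleton, ih]
    simp [pieceSum, PlacedPiece.name, PlacedPiece.arcs, Piece.arcs, weigh_mkArc]

theorem skel_lines (h t h' u : ℕ) (v : List (Strand n)) :
    (lines (B := B) h t h' u v).map WArc.skel = lines h t h' u v := by
  induction v generalizing t u with
  | nil => rfl
  | cons a v ih =>
    rw [lines, Multiset.map_add, ih, Multiset.map_singleton, skel_mkW]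
    rfl

/-- The pieces of a stack of rows that starts at the position `l`. -/
def centre (l : ℕ) : ℕ → List (Row n) → List (PlacedPiece n)
  | _, [] => []
  | h, r :: rs => rowPlaced h l l r ++ centre l (h + 1) rs

/-- The strands to the left and to the right of a stack of rows. -/
def pads {B : Type*} [One B] (left right : List (Strand n)) :
    ℕ → List (Row n) → Multiset (WArc (ℕ × ℕ) n B)
  | _, [] => 0
  | h, r :: rs => lines h 0 (h + 1) 0 left + lines h (left.length + (Row.top r).length) (h + 1)
      (left.length + (Row.bot r).length) right + pads left right (h + 1) rs

/-- Vertical strands have no states, so they leave the sum as a constant part of the system. -/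
theorem stateSum_pad (left right : List (Strand n)) (h : ℕ)
    (rows : List (Row n)) (F : Multiset (WArc (ℕ × ℕ) n B) → M) :
    stateSum lab (stackPlaced h (rows.map fun r => idRow left ++ r ++ idRow right)) F =
      stateSum lab (centre left.length h rows) fun x => F (pads left right h rows + x) := by
  induction rows generalizing h F with
  | nil => simp [stackPlaced, centre, stateSum, pads]
  | cons r rs ih =>
    simp only [List.map_cons, stackPlaced, rowPlaced_append, stateSum_append, centre, pads,
      stateSum_idRow, ih, rowTop_idRow, rowBot_idRow, rowTop_append, rowBot_append,
      List.length_append, zero_add]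
    simp only [add_assoc, add_left_comm]

theorem skelOf_pad (left right : List (Strand n)) (h : ℕ) (rows : List (Row n)) :
    skelOf (stackPlaced h (rows.map fun r => idRow left ++ r ++ idRow right)) =
      pads left right h rows + skelOf (centre left.length h rows) := by
  have := stateSum_pad (lab := fun _ _ _ (_ : Unit) => ()) left right h rows id
  rwa [stateSum_unit, stateSum_unit] at this

theorem skel_pads (left right : List (Strand n)) (h : ℕ) (rows : List (Row n)) :
    (pads (B := B) left right h rows).map WArc.skel = pads left right h rows := by
  induction rows generalizing h with
  | nil => rfl
  | cons r rs ih => simp only [pads, Multiset.map_add, skel_lines, ih]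

end Beside

variable {k : Type*} [Field k] {R N : Fin n → Type*} [∀ i, Ring (R i)]
  [∀ i, Algebra k (R i)] [∀ i, AddCommGroup (N i)] [∀ i, Module k (N i)]
  {T : Reading k R N} {lab : Bool → CrossingKind → Direction → ι → ∀ i, R i}

/-- The rows above and below are the same in both diagrams up to the renaming `f` of points, so
their states can be fixed and their arcs collected in `L`. The premises of `H` on `L` are what
remains of the tameness of the two diagrams. -/
theorem stateSum_local {above S S' below : List (Row n)} (f : ℕ × ℕ → ℕ × ℕ)
    (hA : ∀ i ≤ above.length, ∀ j, f (i, j) = (i, j))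
    (hB : ∀ i j, f (above.length + S.length + i, j) = (above.length + S'.length + i, j))
    (hZ : Tame T.cl (skelOf (stackPlaced 0 (above ++ S ++ below))))
    (hZ' : Tame T.cl (skelOf (stackPlaced 0 (above ++ S' ++ below))))
    (H : ∀ L : Multiset (WArc (ℕ × ℕ) n (∀ i, R i)),
      (∀ t : Multiset (WArc (ℕ × ℕ) n (∀ i, R i)),
        t.map WArc.skel = skelOf (stackPlaced above.length S) → Tame T.cl (t + L)) →
      (∀ t : Multiset (WArc (ℕ × ℕ) n (∀ i, R i)),
        t.map WArc.skel = skelOf (stackPlaced above.length S') →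
          Tame T.cl (t + L.map (WArc.mapPts f))) →
      stateSum lab (stackPlaced above.length S) (fun t => T.val (t + L)) =
        stateSum lab (stackPlaced above.length S')
          (fun t => T.val (t + L.map (WArc.mapPts f)))) :
    stateSum lab (stackPlaced 0 (above ++ S ++ below)) T.val =
      stateSum lab (stackPlaced 0 (above ++ S' ++ below)) T.val := by
  have hA' : ∀ i ≤ above.length, ∀ j, f (0 + i, j) = (0 + i, j) := by simpa using hA
  have hB' : ∀ i ≤ below.length, ∀ j,
      f (0 + (above ++ S).length + i, j) = (0 + (above ++ S').length + i, j) := by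
    intro i _ j
    simpa using hB i j
  simp only [stackPlaced_append, stateSum_append, skelOf_append] at hZ hZ' ⊢
  conv_rhs =>
    rw [stateSum_relocate_stack (h' := 0) above hA']
    simp only [stateSum_relocate_stack (h' := 0 + (above ++ S').length) below hB']
  rw [skelOf_relocate (h' := 0) above hA',
    skelOf_relocate (h' := 0 + (above ++ S').length) below hB'] at hZ'
  refine stateSum_congr fun a ha => ?_
  rw [stateSum_comm (stackPlaced (0 + above.length) S),
    stateSum_comm (stackPlaced (0 + above.length) S')]
  refine stateSum_congr fun b hb => ?_
  simp only [zero_add] at hZ hZ' hb ⊢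
  have hskel : ∀ x : Multiset (WArc (ℕ × ℕ) n (∀ i, R i)),
      (x.map (WArc.mapPts f)).map WArc.skel = (x.map WArc.skel).map (WArc.mapPts f) := by
    intro x
    rw [Multiset.map_map, Multiset.map_map]
    rfl
  have := H (a + b) (fun t ht => ?_) (fun t ht => ?_)
  · simpa only [Multiset.map_add, add_comm, add_left_comm, add_assoc] using this
  · rw [← tame_skel_iff, Multiset.map_add, Multiset.map_add, ha, hb, ht]
    convert hZ using 1
    abel
  · rw [← tame_skel_iff, Multiset.map_add, hskel, Multiset.map_add, Multiset.map_add, ha, hb, ht]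
    convert hZ' using 1
    abel

/-- The rows of a stack fit together, with `t` points on the top line and `b` points on the
bottom line. -/
def Fits : ℕ → List (Row n) → ℕ → Prop
  | t, [], b => t = b
  | t, r :: rs, b => (Row.top r).length = t ∧ Fits (Row.bot r).length rs b

/-- Each vertical strand merges into one arc from the top to the bottom of the stack. An empty stack
would provide no arc to start with. -/
theorem red_pads (left right : List (Strand n)) (h : ℕ) (S : List (Row n)) (hS : S ≠ [])
    {t b : ℕ} (hfit : Fits t S b) :
    T.Red (pads left right h S) (lines h 0 (h + S.length) 0 left +
      lines h (left.length + t) (h + S.length) (left.length + b) right) := by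
  induction S generalizing h t with
  | nil => exact absurd rfl hS
  | cons r rs ih =>
    obtain ⟨rfl, hfit⟩ := hfit
    cases rs with
    | nil =>
      obtain rfl : _ = b := hfit
      exact Reading.Red.of_eq (by simp [pads])
    | cons s rs =>
      have h2 := ((ih (h + 1) (by simp) hfit).add_left (lines h 0 (h + 1) 0 left +
        lines h (left.length + (Row.top r).length) (h + 1)
          (left.length + (Row.bot r).length) right))
      rw [pads]
      refine h2.trans ?_
      rw [List.length_cons (a := r), show h + 1 + (s :: rs).length = h + ((s :: rs).length + 1) by
        omega]
      refine Reading.Red.trans (Reading.Red.of_eq ?_)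
        ((Reading.Red.lines h 0 (h + 1) 0 _ 0 left).add
          (Reading.Red.lines h _ (h + 1) (left.length + (Row.bot r).length) _ _ right))
      abel

/-- The two local diagrams `S` and `S'`, with `d` rows more in `S`, have the same value
in every surrounding. -/
def SameValue (T : Reading k R N) (lab : Bool → CrossingKind → Direction → ι → ∀ i, R i)
    (S S' : List (Row n)) (d : ℕ) : Prop :=
  ∀ (l h : ℕ) (L : Multiset (WArc (ℕ × ℕ) n (∀ i, R i))),
    (∀ t : Multiset (WArc (ℕ × ℕ) n (∀ i, R i)),
      t.map WArc.skel = skelOf (centre l h S) → Tame T.cl (t + L)) →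
    (∀ t : Multiset (WArc (ℕ × ℕ) n (∀ i, R i)),
      t.map WArc.skel = skelOf (centre l h S') →
        Tame T.cl (t + L.map (WArc.mapPts (lower h d)))) →
    stateSum lab (centre l h S) (fun t => T.val (t + L)) =
      stateSum lab (centre l h S') (fun t => T.val (t + L.map (WArc.mapPts (lower h d))))

theorem stateSum_contract_pads {left right : List (Strand n)} {h : ℕ} {S : List (Row n)}
    (hS : S ≠ []) {t b : ℕ} (hfit : Fits t S b) {L : Multiset (WArc (ℕ × ℕ) n (∀ i, R i))}
    (hL : ∀ x : Multiset (WArc (ℕ × ℕ) n (∀ i, R i)), x.map WArc.skel = skelOf (stackPlaced h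
      (S.map fun r => idRow left ++ r ++ idRow right)) → Tame T.cl (x + L)) :
    (∀ x : Multiset (WArc (ℕ × ℕ) n (∀ i, R i)), x.map WArc.skel = skelOf (centre left.length h S) →
      Tame T.cl (x + (lines h 0 (h + S.length) 0 left +
        lines h (left.length + t) (h + S.length) (left.length + b) right + L))) ∧
    stateSum lab (stackPlaced h (S.map fun r => idRow left ++ r ++ idRow right))
        (fun x => T.val (x + L)) =
      stateSum lab (centre left.length h S) fun x => T.val (x +
        (lines h 0 (h + S.length) 0 left +
          lines h (left.length + t) (h + S.length) (left.length + b) right + L)) := by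
  have key : ∀ x : Multiset (WArc (ℕ × ℕ) n (∀ i, R i)),
      x.map WArc.skel = skelOf (centre left.length h S) → _ := fun x hx =>
    red_pads (T := T) left right h S hS hfit (x + L) (by
      rw [← add_assoc]
      refine hL _ ?_
      rw [skelOf_pad, Multiset.map_add, hx, skel_pads])
  refine ⟨fun x hx => ?_, ?_⟩
  · rw [add_left_comm]
    exact (key x hx).1
  · rw [stateSum_pad]
    refine stateSum_congr fun x hx => ?_
    rw [add_assoc, (key x hx).2, add_left_comm x]

/-- The merged strands on the left and right connect the outer lines of the local diagram, and
`lower` carries those of `S` to those of `S'`. They can therefore be counted as part of the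
surrounding. -/
theorem SameValue.stateSum_eq {above below : List (Row n)} {left right : List (Strand n)}
    {S S' : List (Row n)} {d : ℕ} (hS : S ≠ []) (hS' : S' ≠ []) {t b : ℕ}
    (hfit : Fits t S b) (hfit' : Fits t S' b) (hd : S.length = S'.length + d)
    (hZ : Tame T.cl (skelOf (stackPlaced 0
      (above ++ S.map (fun r => idRow left ++ r ++ idRow right) ++ below))))
    (hZ' : Tame T.cl (skelOf (stackPlaced 0
      (above ++ S'.map (fun r => idRow left ++ r ++ idRow right) ++ below))))
    (H : SameValue T lab S S' d) :
    stateSum lab (stackPlaced 0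
        (above ++ S.map (fun r => idRow left ++ r ++ idRow right) ++ below)) T.val =
      stateSum lab (stackPlaced 0
        (above ++ S'.map (fun r => idRow left ++ r ++ idRow right) ++ below)) T.val := by
  have hlow : ∀ i j, lower above.length d (above.length + S.length + i, j) =
      (above.length + S'.length + i, j) := fun i j => by
    rw [lower_of_ge j (by omega)]
    simp only [Prod.mk.injEq, and_true]
    omega
  have hlow' : ∀ j, lower above.length d (above.length + S.length, j) =
      (above.length + S'.length, j) := hlow 0
  have htop : ∀ j, lower above.length d (above.length, j) = (above.length, j) :=
    fun j => lower_of_le j le_rfl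
  refine stateSum_local (lower above.length d) (fun i hi j => lower_of_le j hi)
    (by simpa using hlow) hZ hZ' fun L hL hL' => ?_
  have h1 := stateSum_contract_pads (lab := lab) hS hfit hL
  have h2 := stateSum_contract_pads (lab := lab) hS' hfit' hL'
  have hP : (lines above.length 0 (above.length + S.length) 0 left +
      lines above.length (left.length + t) (above.length + S.length) (left.length + b) right +
        L).map (WArc.mapPts (lower above.length d)) =
      lines above.length 0 (above.length + S'.length) 0 left +
        lines above.length (left.length + t) (above.length + S'.length) (left.length + b) right +
          L.map (WArc.mapPts (lower above.length d)) := by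
    rw [Multiset.map_add, Multiset.map_add, map_lines _ left (fun j => htop _) (fun j => hlow' _),
      map_lines _ right (fun j => htop _) (fun j => hlow' _)]
  rw [← hP] at h2
  rw [h1.2, h2.2]
  exact H _ _ _ h1.1 h2.1

end Local

/-! ### Virtual and planar moves -/

section Pieces

variable {n : ℕ} {B M ι : Type*} [One B] [AddCommMonoid M] [Fintype ι]
  (lab : Bool → CrossingKind → Direction → ι → B)

/-- The sum over the states of a crossing of the strands with directions `d` (from top left) and
`d'` (from top right). The summand depends on the weights of the two strands. -/
def crossSum (d d' : Direction) (κ : CrossingKind) (F : B → B → M) : M :=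
  match κ with
  | .slashOver => ∑ j, F (lab false .slashOver d j) (lab true .slashOver d' j)
  | .backslashOver => ∑ j, F (lab true .backslashOver d j) (lab false .backslashOver d' j)
  | .virtual => F 1 1

variable {lab}

@[simp] theorem stateSum_strand (h t u : ℕ) (a : Strand n) (ps : List (PlacedPiece n))
    (F : Multiset (WArc (ℕ × ℕ) n B) → M) : stateSum lab (⟨h, t, u, .strand a⟩ :: ps) F =
      stateSum lab ps fun x => F ({mkW a (h, t) (h + 1, u) 1} + x) := by
  simp [stateSum, pieceSum, PlacedPiece.name, PlacedPiece.arcs, Piece.arcs, weigh_mkArc]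

@[simp] theorem stateSum_max (h t u : ℕ) (a : Strand n) (ps : List (PlacedPiece n))
    (F : Multiset (WArc (ℕ × ℕ) n B) → M) : stateSum lab (⟨h, t, u, .max a⟩ :: ps) F =
      stateSum lab ps fun x => F ({mkW a (h + 1, u + 1) (h + 1, u) 1} + x) := by
  simp [stateSum, pieceSum, PlacedPiece.name, PlacedPiece.arcs, Piece.arcs, weigh_mkArc]

@[simp] theorem stateSum_min (h t u : ℕ) (a : Strand n) (ps : List (PlacedPiece n))
    (F : Multiset (WArc (ℕ × ℕ) n B) → M) : stateSum lab (⟨h, t, u, .min a⟩ :: ps) F =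
      stateSum lab ps fun x => F ({mkW a (h, t) (h, t + 1) 1} + x) := by
  simp [stateSum, pieceSum, PlacedPiece.name, PlacedPiece.arcs, Piece.arcs, weigh_mkArc]

@[simp] theorem stateSum_crossing (h t u : ℕ) (κ : CrossingKind) (a b : Strand n)
    (ps : List (PlacedPiece n)) (F : Multiset (WArc (ℕ × ℕ) n B) → M) :
    stateSum lab (⟨h, t, u, .crossing κ a b⟩ :: ps) F =
      crossSum lab a.dir b.dir κ fun w w' => stateSum lab ps fun x =>
        F ({mkW a (h, t) (h + 1, u + 1) w} + ({mkW b (h, t + 1) (h + 1, u) w'} + x)) := by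
  cases κ <;> simp [stateSum, pieceSum, PlacedPiece.name, PlacedPiece.arcs, Piece.arcs, weigh_mkArc,
    crossSum, ← Multiset.cons_coe, Multiset.cons_swap (mkW b _ _ _)]

@[simp] theorem skelOf_strand (h t u : ℕ) (a : Strand n) (ps : List (PlacedPiece n)) :
    skelOf (⟨h, t, u, .strand a⟩ :: ps) = {mkW a (h, t) (h + 1, u) ()} + skelOf ps := by
  simp [skelOf_cons, PlacedPiece.arcs, Piece.arcs, skel_mkArc]

@[simp] theorem skelOf_max (h t u : ℕ) (a : Strand n) (ps : List (PlacedPiece n)) :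
    skelOf (⟨h, t, u, .max a⟩ :: ps) = {mkW a (h + 1, u + 1) (h + 1, u) ()} + skelOf ps := by
  simp [skelOf_cons, PlacedPiece.arcs, Piece.arcs, skel_mkArc]

@[simp] theorem skelOf_min (h t u : ℕ) (a : Strand n) (ps : List (PlacedPiece n)) :
    skelOf (⟨h, t, u, .min a⟩ :: ps) = {mkW a (h, t) (h, t + 1) ()} + skelOf ps := by
  simp [skelOf_cons, PlacedPiece.arcs, Piece.arcs, skel_mkArc]

@[simp] theorem skelOf_crossing (h t u : ℕ) (κ : CrossingKind) (a b : Strand n)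
    (ps : List (PlacedPiece n)) : skelOf (⟨h, t, u, .crossing κ a b⟩ :: ps) =
      {mkW a (h, t) (h + 1, u + 1) ()} + ({mkW b (h, t + 1) (h + 1, u) ()} + skelOf ps) := by
  cases κ <;> simp [skelOf_cons, PlacedPiece.arcs, Piece.arcs, skel_mkArc, ← Multiset.cons_coe,
    Multiset.cons_swap (mkW b _ _ _)]

@[simp] theorem stateSum_nil (F : Multiset (WArc (ℕ × ℕ) n B) → M) : stateSum lab [] F = F 0 := rfl

@[simp] theorem skelOf_nil : skelOf ([] : List (PlacedPiece n)) = 0 := rfl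

theorem crossSum_congr {d d' : Direction} {κ : CrossingKind} {F G : B → B → M}
    (h : ∀ w w', F w w' = G w w') : crossSum lab d d' κ F = crossSum lab d d' κ G := by
  congr 1
  funext w w'
  exact h w w'

end Pieces

section Moves

variable {n : ℕ} {ι : Type*} [Fintype ι] {k : Type*} [Field k] {R N : Fin n → Type*}
  [∀ i, Ring (R i)] [∀ i, Algebra k (R i)] [∀ i, AddCommGroup (N i)] [∀ i, Module k (N i)]
  {T : Reading k R N} {lab : Bool → CrossingKind → Direction → ι → ∀ i, R i}

theorem Reading.Red.val_eq_of_skel {m m' L : Multiset (WArc (ℕ × ℕ) n (∀ i, R i))}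
    {s : Multiset (WArc (ℕ × ℕ) n Unit)} (hr : T.Red m m')
    (hL : ∀ t : Multiset (WArc (ℕ × ℕ) n (∀ i, R i)), t.map WArc.skel = s → Tame T.cl (t + L))
    (hs : m.map WArc.skel = s) : T.val (m + L) = T.val (m' + L) :=
  (hr L (hL m hs)).2

/-- A collapse in which no arc is dropped: points are only renamed. Tameness of both systems takes
the place of injectivity of `f`. -/
theorem Reading.val_lower {m m' L : Multiset (WArc (ℕ × ℕ) n (∀ i, R i))} (f : ℕ × ℕ → ℕ × ℕ)
    (h : Tame T.cl (m + L)) (h' : Tame T.cl (m' + L.map (WArc.mapPts f)))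
    (hm : m.map (WArc.mapPts f) = m') : T.val (m + L) = T.val (m' + L.map (WArc.mapPts f)) := by
  subst hm
  rw [← Multiset.map_add] at h' ⊢
  rw [← add_zero (m + L)] at h
  simpa only [add_zero] using T.val_collapse f h h' (by simp)

theorem combAll_one {X B : Type*} [Monoid B] (d : Direction) (q : List X) :
    combAll d (q.map fun x => (x, (1 : B))) = 1 := by
  induction q with
  | nil => rfl
  | cons x q ih => rw [List.map_cons, combAll, ih, comb_one_left]

theorem skel_strandArcs {X B : Type*} (a : Strand n) (P : X) (q : List (X × B)) :
    (strandArcs a P q).map WArc.skel = strandArcs a P (q.map fun x => (x.1, ())) := by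
  induction q generalizing P with
  | nil => rfl
  | cons x q ih => simp [strandArcs, ih, skel_mkW]

/-- For local diagrams without labels that consist of a single strand. The list `q l h` is the route
of the strand after its top point `(h, l)`; all arcs on it have weight 1 and merge into one. -/
theorem sameValue_strand (a : Strand n) (S : List (Row n)) (d : ℕ) (q : ℕ → ℕ → List (ℕ × ℕ))
    (hq : ∀ l h, lastPoint (h, l) ((q l h).map fun x => (x, ())) = (h + d + 1, l))
    (hS : ∀ l h (F : Multiset (WArc (ℕ × ℕ) n (∀ i, R i)) → PiTensorProduct k N),
      stateSum lab (centre l h S) F = F (strandArcs a (h, l) ((q l h).map fun x => (x, 1))))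
    (hs : ∀ l h, skelOf (centre l h S) = strandArcs a (h, l) ((q l h).map fun x => (x, ()))) :
    SameValue T lab S [[.strand a]] d := by
  have hlast : ∀ (P : ℕ × ℕ) (q : List (ℕ × ℕ)),
      lastPoint P (q.map fun x => (x, (1 : ∀ i, R i))) = lastPoint P (q.map fun x => (x, ())) := by
    intro P q
    induction q generalizing P with
    | nil => rfl
    | cons x q ih => exact ih x
  intro l h L hL hL'
  have hr := Reading.Red.strandArcs (T := T) a (h, l) ((q l h).map fun x => (x, 1)) (by
    intro h0
    have := hq l h
    rw [List.map_eq_nil_iff.1 h0] at this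
    simp [lastPoint] at this
    omega) L (hL _ (by
      rw [skel_strandArcs, hs, List.map_map]
      rfl))
  rw [hlast, hq, combAll_one] at hr
  have h1 : stateSum lab (centre l h [[Piece.strand a]]) (fun t => T.val (t + L.map
      (WArc.mapPts (lower h d)))) = T.val ({mkW a (h, l) (h + 1, l) 1} + L.map
      (WArc.mapPts (lower h d))) := by
    simp [centre, rowPlaced]
  have h2 := hL' {mkW a (h, l) (h + 1, l) 1} (by simp [centre, rowPlaced, skel_mkW])
  rw [hS, hr.2, h1]
  refine Reading.val_lower _ hr.1 h2 ?_
  rw [Multiset.map_singleton, mapPts_mkW, lower_of_le _ le_rfl, lower_of_ge _ (by omega)]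
  congr 4
  omega

theorem sameValue_zigzagRight (a : Strand n) :
    SameValue T lab [[.strand a, .max a.rev], [.min a, .strand a]] [[.strand a]] 1 := by
  refine sameValue_strand a _ _ (fun l h => [(h + 1, l), (h + 1, l + 1), (h + 1, l + 2),
    (h + 1 + 1, l)]) (fun l h => rfl) (fun l h F => ?_) (fun l h => ?_)
  all_goals
    simp [Nat.add_assoc, -Multiset.singleton_add, centre, rowPlaced, strandArcs, Piece.top,
      Piece.bot, mkW_rev]
    try refine congrArg F ?_
    ac_rfl

theorem sameValue_zigzagLeft (a : Strand n) :
    SameValue T lab [[.max a, .strand a], [.strand a, .min a.rev]] [[.strand a]] 1 := by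
  refine sameValue_strand a _ _ (fun l h => [(h + 1, l + 2), (h + 1, l + 1), (h + 1, l),
    (h + 1 + 1, l)]) (fun l h => rfl) (fun l h F => ?_) (fun l h => ?_)
  all_goals
    simp [Nat.add_assoc, -Multiset.singleton_add, centre, rowPlaced, strandArcs, Piece.top,
      Piece.bot, mkW_rev]
    try refine congrArg F ?_
    ac_rfl

theorem sameValue_kinkRight (a : Strand n) :
    SameValue T lab [[.strand a, .max a], [.crossing .virtual a a, .strand a.rev],
      [.strand a, .min a]] [[.strand a]] 2 := by
  -- The route passes the crossing, the minimum, the vertical strand at the right, the maximum, and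
  -- the crossing again.
  refine sameValue_strand a _ _ (fun l h => [(h + 1, l), (h + 2, l + 1), (h + 2, l + 2),
    (h + 1, l + 2), (h + 1, l + 1), (h + 2, l), (h + 2 + 1, l)])
    (fun l h => rfl) (fun l h F => ?_) (fun l h => ?_)
  all_goals
    simp [Nat.add_assoc, -Multiset.singleton_add, centre, rowPlaced, strandArcs, Piece.top,
      Piece.bot, mkW_rev, crossSum]
    try refine congrArg F ?_
    ac_rfl

theorem sameValue_kinkLeft (a : Strand n) :
    SameValue T lab [[.max a.rev, .strand a], [.strand a.rev, .crossing .virtual a a],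
      [.min a.rev, .strand a]] [[.strand a]] 2 := by
  refine sameValue_strand a _ _ (fun l h => [(h + 1, l + 2), (h + 2, l + 1), (h + 2, l),
    (h + 1, l), (h + 1, l + 1), (h + 2, l + 2), (h + 2 + 1, l)])
    (fun l h => rfl) (fun l h F => ?_) (fun l h => ?_)
  all_goals
    simp [Nat.add_assoc, -Multiset.singleton_add, centre, rowPlaced, strandArcs, Piece.top,
      Piece.bot, mkW_rev, crossSum]
    try refine congrArg F ?_
    ac_rfl

end Moves

/-! ### Moves of several strands -/

section Moves

variable {n : ℕ} {ι : Type*} [Fintype ι] {k : Type*} [Field k] {R N : Fin n → Type*}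
  [∀ i, Ring (R i)] [∀ i, Algebra k (R i)] [∀ i, AddCommGroup (N i)] [∀ i, Module k (N i)]
  {T : Reading k R N} {lab : Bool → CrossingKind → Direction → ι → ∀ i, R i}

/-- Both strands return to their positions, so merging leaves two vertical arcs whatever the kinds
of the crossings are. The first claim is tameness after merging, needed for the shift to a single
row. -/
theorem stateSum_double (κ κ' : CrossingKind) (a b : Strand n) (l h : ℕ)
    {L : Multiset (WArc (ℕ × ℕ) n (∀ i, R i))}
    (hL : ∀ t : Multiset (WArc (ℕ × ℕ) n (∀ i, R i)), t.map WArc.skel =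
      skelOf (centre l h [[.crossing κ a b], [.crossing κ' b a]]) → Tame T.cl (t + L)) :
    Tame T.cl ({mkW a (h, l) (h + 2, l) 1} + {mkW b (h, l + 1) (h + 2, l + 1) 1} + L) ∧
    stateSum lab (centre l h [[.crossing κ a b], [.crossing κ' b a]]) (fun t => T.val (t + L)) =
      crossSum lab a.dir b.dir κ fun u v => crossSum lab b.dir a.dir κ' fun v' u' =>
        T.val ({mkW a (h, l) (h + 2, l) (comb a.dir u u')} +
          {mkW b (h, l + 1) (h + 2, l + 1) (comb b.dir v v')} + L) := by
  have hr := fun u v u' v' : ∀ i, R i =>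
    ((Reading.Red.strandArcs (T := T) a (h, l) [((h + 1, l + 1), u), ((h + 2, l), u')]
      (by simp)).add (Reading.Red.strandArcs (T := T) b (h, l + 1)
        [((h + 1, l), v), ((h + 2, l + 1), v')] (by simp))) L (hL _ (by
          simp [-Multiset.singleton_add, centre, rowPlaced, strandArcs, skel_mkW]
          ac_rfl))
  simp only [lastPoint, combAll, comb_one_right] at hr
  refine ⟨by simpa only [comb_one_right] using (hr 1 1 1 1).1, ?_⟩
  simp only [centre, rowPlaced, List.cons_append, List.nil_append, stateSum_crossing, stateSum_nil]
  refine crossSum_congr fun u v => crossSum_congr fun v' u' => ?_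
  rw [← (hr u v u' v').2]
  congr 2
  simp only [strandArcs]
  ac_rfl

/-- Arbitrary kinds of crossings are admitted, so that the Pachner moves and the naturality of
virtual crossings can share this computation. The merged arcs have the same ends as in
`stateSum_inner`; only the order in which labels are met differs. -/
theorem stateSum_outer (κ₁ κ₂ κ₃ : CrossingKind) (x m y : Strand n) (l h : ℕ)
    {L : Multiset (WArc (ℕ × ℕ) n (∀ i, R i))}
    (hL : ∀ t : Multiset (WArc (ℕ × ℕ) n (∀ i, R i)), t.map WArc.skel =
      skelOf (centre l h [[.strand x, .crossing κ₁ m y], [.crossing κ₂ x y, .strand m],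
        [.strand y, .crossing κ₃ x m]]) → Tame T.cl (t + L)) :
    stateSum lab (centre l h [[.strand x, .crossing κ₁ m y], [.crossing κ₂ x y, .strand m],
        [.strand y, .crossing κ₃ x m]]) (fun t => T.val (t + L)) =
      crossSum lab m.dir y.dir κ₁ fun m₁ y₁ => crossSum lab x.dir y.dir κ₂ fun x₁ y₂ =>
        crossSum lab x.dir m.dir κ₃ fun x₂ m₂ =>
          T.val ({mkW x (h, l) (h + 3, l + 2) (comb x.dir x₁ x₂)} +
            {mkW m (h, l + 1) (h + 3, l + 1) (comb m.dir m₁ m₂)} +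
            {mkW y (h, l + 2) (h + 3, l) (comb y.dir y₁ y₂)} + L) := by
  simp only [centre, rowPlaced, List.cons_append, List.nil_append, List.append_nil,
    stateSum_crossing, stateSum_strand, stateSum_nil, Piece.top, Piece.bot, List.length_cons,
    List.length_nil, zero_add, Nat.add_assoc, Nat.reduceAdd]
  refine crossSum_congr fun m₁ y₁ => crossSum_congr fun x₁ y₂ => crossSum_congr fun x₂ m₂ => ?_
  have hr := ((Reading.Red.strandArcs (T := T) x (h, l)
    [((h + 1, l), 1), ((h + 2, l + 1), x₁), ((h + 3, l + 2), x₂)] (by simp)).add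
      (Reading.Red.strandArcs (T := T) m (h, l + 1)
        [((h + 1, l + 2), m₁), ((h + 2, l + 2), 1), ((h + 3, l + 1), m₂)] (by simp))).add
      (Reading.Red.strandArcs (T := T) y (h, l + 2)
        [((h + 1, l + 1), y₁), ((h + 2, l), y₂), ((h + 3, l), 1)] (by simp))
  refine Eq.trans ?_ ((hr.val_eq_of_skel hL ?_).trans ?_)
  · congr 2
    simp only [strandArcs]
    ac_rfl
  · simp [-Multiset.singleton_add, centre, rowPlaced, strandArcs, Piece.top, Piece.bot, skel_mkW,
      Nat.add_assoc]
    ac_rfl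
  · simp only [lastPoint, combAll, comb_one_right, comb_one_left]

theorem stateSum_inner (κ₁ κ₂ κ₃ : CrossingKind) (x m y : Strand n) (l h : ℕ)
    {L : Multiset (WArc (ℕ × ℕ) n (∀ i, R i))}
    (hL : ∀ t : Multiset (WArc (ℕ × ℕ) n (∀ i, R i)), t.map WArc.skel =
      skelOf (centre l h [[.crossing κ₁ x m, .strand y], [.strand m, .crossing κ₂ x y],
        [.crossing κ₃ m y, .strand x]]) → Tame T.cl (t + L)) :
    stateSum lab (centre l h [[.crossing κ₁ x m, .strand y], [.strand m, .crossing κ₂ x y],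
        [.crossing κ₃ m y, .strand x]]) (fun t => T.val (t + L)) =
      crossSum lab x.dir m.dir κ₁ fun x₁ m₁ => crossSum lab x.dir y.dir κ₂ fun x₂ y₁ =>
        crossSum lab m.dir y.dir κ₃ fun m₂ y₂ =>
          T.val ({mkW x (h, l) (h + 3, l + 2) (comb x.dir x₁ x₂)} +
            {mkW m (h, l + 1) (h + 3, l + 1) (comb m.dir m₁ m₂)} +
            {mkW y (h, l + 2) (h + 3, l) (comb y.dir y₁ y₂)} + L) := by
  simp only [centre, rowPlaced, List.cons_append, List.nil_append, List.append_nil,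
    stateSum_crossing, stateSum_strand, stateSum_nil, Piece.top, Piece.bot, List.length_cons,
    List.length_nil, zero_add, Nat.add_assoc, Nat.reduceAdd]
  refine crossSum_congr fun x₁ m₁ => crossSum_congr fun x₂ y₁ => crossSum_congr fun m₂ y₂ => ?_
  have hr := ((Reading.Red.strandArcs (T := T) x (h, l)
    [((h + 1, l + 1), x₁), ((h + 2, l + 2), x₂), ((h + 3, l + 2), 1)] (by simp)).add
      (Reading.Red.strandArcs (T := T) m (h, l + 1)
        [((h + 1, l), m₁), ((h + 2, l), 1), ((h + 3, l + 1), m₂)] (by simp))).add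
      (Reading.Red.strandArcs (T := T) y (h, l + 2)
        [((h + 1, l + 2), 1), ((h + 2, l + 1), y₁), ((h + 3, l), y₂)] (by simp))
  refine Eq.trans ?_ ((hr.val_eq_of_skel hL ?_).trans ?_)
  · congr 2
    simp only [strandArcs]
    ac_rfl
  · simp [-Multiset.singleton_add, centre, rowPlaced, strandArcs, Piece.top, Piece.bot, skel_mkW,
      Nat.add_assoc]
    ac_rfl
  · simp only [lastPoint, combAll, comb_one_right, comb_one_left]

/-- The maximum with both legs merges into one arc between its feet, which as an arc of `a` runs
from the right foot to the left one. `stateSum_maxLeft` yields the same arc, so that a slide only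
changes the labels. -/
theorem stateSum_maxRight (κ : CrossingKind) (s a : Strand n) (l h : ℕ)
    {L : Multiset (WArc (ℕ × ℕ) n (∀ i, R i))}
    (hL : ∀ t : Multiset (WArc (ℕ × ℕ) n (∀ i, R i)), t.map WArc.skel =
      skelOf (centre l h [[.strand s, .max a], [.crossing κ s a, .strand a.rev]]) →
        Tame T.cl (t + L)) :
    stateSum lab (centre l h [[.strand s, .max a], [.crossing κ s a, .strand a.rev]])
        (fun t => T.val (t + L)) =
      crossSum lab s.dir a.dir κ fun u v =>
        T.val ({mkW s (h, l) (h + 2, l + 1) u} + {mkW a (h + 2, l + 2) (h + 2, l) v} + L) := by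
  simp only [centre, rowPlaced, List.cons_append, List.nil_append, List.append_nil,
    stateSum_crossing, stateSum_strand, stateSum_max, stateSum_nil, Piece.top, Piece.bot,
    List.length_cons, List.length_nil, zero_add, Nat.add_assoc, Nat.reduceAdd, mkW_rev]
  refine crossSum_congr fun u v => ?_
  have hr := (Reading.Red.strandArcs (T := T) s (h, l) [((h + 1, l), 1), ((h + 2, l + 1), u)]
    (by simp)).add (Reading.Red.strandArcs (T := T) a (h + 2, l + 2)
      [((h + 1, l + 2), 1), ((h + 1, l + 1), 1), ((h + 2, l), v)] (by simp))
  refine Eq.trans ?_ ((hr.val_eq_of_skel hL ?_).trans ?_)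
  · congr 2
    simp only [strandArcs]
    ac_rfl
  · simp [-Multiset.singleton_add, centre, rowPlaced, strandArcs, Piece.top, Piece.bot, skel_mkW,
      Nat.add_assoc, mkW_rev]
    ac_rfl
  · simp only [lastPoint, combAll, comb_one_right, comb_one_left]

theorem stateSum_maxLeft (κ : CrossingKind) (s a : Strand n) (l h : ℕ)
    {L : Multiset (WArc (ℕ × ℕ) n (∀ i, R i))}
    (hL : ∀ t : Multiset (WArc (ℕ × ℕ) n (∀ i, R i)), t.map WArc.skel =
      skelOf (centre l h [[.max a, .strand s], [.strand a, .crossing κ a.rev s]]) →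
        Tame T.cl (t + L)) :
    stateSum lab (centre l h [[.max a, .strand s], [.strand a, .crossing κ a.rev s]])
        (fun t => T.val (t + L)) =
      crossSum lab a.rev.dir s.dir κ fun v u =>
        T.val ({mkW s (h, l) (h + 2, l + 1) u} + {mkW a (h + 2, l + 2) (h + 2, l) v} + L) := by
  simp only [centre, rowPlaced, List.cons_append, List.nil_append, List.append_nil,
    stateSum_crossing, stateSum_strand, stateSum_max, stateSum_nil, Piece.top, Piece.bot,
    List.length_cons, List.length_nil, zero_add, Nat.add_assoc, Nat.reduceAdd, mkW_rev]
  refine crossSum_congr fun v u => ?_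
  have hr := (Reading.Red.strandArcs (T := T) s (h, l) [((h + 1, l + 2), 1), ((h + 2, l + 1), u)]
    (by simp)).add (Reading.Red.strandArcs (T := T) a (h + 2, l + 2)
      [((h + 1, l + 1), v), ((h + 1, l), 1), ((h + 2, l), 1)] (by simp))
  refine Eq.trans ?_ ((hr.val_eq_of_skel hL ?_).trans ?_)
  · congr 2
    simp only [strandArcs]
    ac_rfl
  · simp [-Multiset.singleton_add, centre, rowPlaced, strandArcs, Piece.top, Piece.bot, skel_mkW,
      Nat.add_assoc, mkW_rev]
    ac_rfl
  · simp only [lastPoint, combAll, comb_one_right, comb_one_left]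

theorem stateSum_minLeft (κ : CrossingKind) (s a : Strand n) (l h : ℕ)
    {L : Multiset (WArc (ℕ × ℕ) n (∀ i, R i))}
    (hL : ∀ t : Multiset (WArc (ℕ × ℕ) n (∀ i, R i)), t.map WArc.skel =
      skelOf (centre l h [[.crossing κ a s, .strand a.rev], [.strand s, .min a]]) →
        Tame T.cl (t + L)) :
    stateSum lab (centre l h [[.crossing κ a s, .strand a.rev], [.strand s, .min a]])
        (fun t => T.val (t + L)) =
      crossSum lab a.dir s.dir κ fun v u =>
        T.val ({mkW s (h, l + 1) (h + 2, l) u} + {mkW a (h, l) (h, l + 2) v} + L) := by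
  simp only [centre, rowPlaced, List.cons_append, List.nil_append, List.append_nil,
    stateSum_crossing, stateSum_strand, stateSum_min, stateSum_nil, Piece.top, Piece.bot,
    List.length_cons, List.length_nil, zero_add, Nat.add_assoc, Nat.reduceAdd, mkW_rev]
  refine crossSum_congr fun v u => ?_
  have hr := (Reading.Red.strandArcs (T := T) s (h, l + 1) [((h + 1, l), u), ((h + 2, l), 1)]
    (by simp)).add (Reading.Red.strandArcs (T := T) a (h, l)
      [((h + 1, l + 1), v), ((h + 1, l + 2), 1), ((h, l + 2), 1)] (by simp))
  refine Eq.trans ?_ ((hr.val_eq_of_skel hL ?_).trans ?_)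
  · congr 2
    simp only [strandArcs]
    ac_rfl
  · simp [-Multiset.singleton_add, centre, rowPlaced, strandArcs, Piece.top, Piece.bot, skel_mkW,
      Nat.add_assoc, mkW_rev]
    ac_rfl
  · simp only [lastPoint, combAll, comb_one_right]

theorem stateSum_minRight (κ : CrossingKind) (s a : Strand n) (l h : ℕ)
    {L : Multiset (WArc (ℕ × ℕ) n (∀ i, R i))}
    (hL : ∀ t : Multiset (WArc (ℕ × ℕ) n (∀ i, R i)), t.map WArc.skel =
      skelOf (centre l h [[.strand a, .crossing κ s a.rev], [.min a, .strand s]]) →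
        Tame T.cl (t + L)) :
    stateSum lab (centre l h [[.strand a, .crossing κ s a.rev], [.min a, .strand s]])
        (fun t => T.val (t + L)) =
      crossSum lab s.dir a.rev.dir κ fun u v =>
        T.val ({mkW s (h, l + 1) (h + 2, l) u} + {mkW a (h, l) (h, l + 2) v} + L) := by
  simp only [centre, rowPlaced, List.cons_append, List.nil_append, List.append_nil,
    stateSum_crossing, stateSum_strand, stateSum_min, stateSum_nil, Piece.top, Piece.bot,
    List.length_cons, List.length_nil, zero_add, Nat.add_assoc, Nat.reduceAdd, mkW_rev]
  refine crossSum_congr fun u v => ?_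
  have hr := (Reading.Red.strandArcs (T := T) s (h, l + 1) [((h + 1, l + 2), u), ((h + 2, l), 1)]
    (by simp)).add (Reading.Red.strandArcs (T := T) a (h, l)
      [((h + 1, l), 1), ((h + 1, l + 1), 1), ((h, l + 2), v)] (by simp))
  refine Eq.trans ?_ ((hr.val_eq_of_skel hL ?_).trans ?_)
  · congr 2
    simp only [strandArcs]
    ac_rfl
  · simp [-Multiset.singleton_add, centre, rowPlaced, strandArcs, Piece.top, Piece.bot, skel_mkW,
      Nat.add_assoc, mkW_rev]
    ac_rfl
  · simp only [lastPoint, combAll, comb_one_right, comb_one_left]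

theorem sameValue_of_eq {S S' : List (Row n)}
    (H : ∀ (l h : ℕ) (L : Multiset (WArc (ℕ × ℕ) n (∀ i, R i))),
      (∀ t : Multiset (WArc (ℕ × ℕ) n (∀ i, R i)),
        t.map WArc.skel = skelOf (centre l h S) → Tame T.cl (t + L)) →
      (∀ t : Multiset (WArc (ℕ × ℕ) n (∀ i, R i)),
        t.map WArc.skel = skelOf (centre l h S') → Tame T.cl (t + L)) →
      stateSum lab (centre l h S) (fun t => T.val (t + L)) =
        stateSum lab (centre l h S') (fun t => T.val (t + L))) :
    SameValue T lab S S' 0 := by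
  intro l h L
  rw [lower_zero, mapPts_id, Multiset.map_id]
  exact H l h L

/-- Virtual crossings contribute 1, so on both sides the labels are those of the single crossing `κ`
and lie on the same merged arcs. -/
theorem sameValue_naturality (κ : CrossingKind) (a b c : Strand n) :
    SameValue T lab
      [[.crossing κ a b, .strand c], [.strand b, .crossing .virtual a c],
        [.crossing .virtual b c, .strand a]]
      [[.strand a, .crossing .virtual b c], [.crossing .virtual a c, .strand b],
        [.strand c, .crossing κ a b]] 0 := by
  refine sameValue_of_eq fun l h L hL hL' => ?_
  rw [stateSum_inner _ _ _ _ _ _ _ _ hL, stateSum_outer _ _ _ _ _ _ _ _ hL']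
  simp only [crossSum, comb_one_left, comb_one_right]

end Moves

/-! ### Sums of labels -/

section LabelSums

open Coalgebra HopfAlgebra HeisenbergDouble

variable {k A : Type*} [Field k] [Ring A] [HopfAlgebra k A] {ι M : Type*} [Fintype ι]
  [AddCommGroup M] [Module k M] (e : Module.Basis ι k A)

/-- Expansion of the counit in the dual basis. -/
theorem sum_apply_counit (G : A →ₗ[k] Module.Dual k A →ₗ[k] M) :
    ∑ j, G (algebraMap k A (counit (e j))) (e.coord j) = G 1 counit := by
  simp only [Algebra.algebraMap_eq_smul_one, map_smul, LinearMap.smul_apply]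
  simp only [← map_smul, ← map_sum, sum_coord_smul]

/-- Trading the product of the dual vectors for a coproduct leaves $\sum\gamma(a')a''$, which the
antipode axiom reduces to the counit. -/
theorem sum_antipode_mul (G : A →ₗ[k] Module.Dual k A →ₗ[k] M) :
    ∑ i, ∑ j, G (antipode k (e i) * e j) (dualMul k A (e.coord i) (e.coord j)) = G 1 counit := by
  have h := sum_comul e (G ∘ₗ LinearMap.mul' k A ∘ₗ (antipode k).rTensor A)
  simp only [LinearMap.comp_apply, LinearMap.rTensor_tmul, LinearMap.mul'_apply,
    mul_antipode_rTensor_comul_apply] at h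
  rw [h, sum_apply_counit]

theorem sum_mul_antipode (G : A →ₗ[k] Module.Dual k A →ₗ[k] M) :
    ∑ i, ∑ j, G (e i * antipode k (e j)) (dualMul k A (e.coord i) (e.coord j)) = G 1 counit := by
  have h := sum_comul e (G ∘ₗ LinearMap.mul' k A ∘ₗ (antipode k).lTensor A)
  simp only [LinearMap.comp_apply, LinearMap.lTensor_tmul, LinearMap.mul'_apply,
    mul_antipode_lTensor_comul_apply] at h
  rw [h, sum_apply_counit]

/-- The arguments of `V` are the labels of `x`, of `m` (under and over) and of `y`. The product
$e^be^a$ on `y` is traded for the coproduct of `e a`; right multiplication by $a'$ on `x` then moves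
to $e^c$ as a right translation. The result is the right-hand side of the commutation relation on
`m`, which `hW` records. -/
theorem sum_pentagon_outer (V : A →ₗ[k] A →ₗ[k] Module.Dual k A →ₗ[k] Module.Dual k A →ₗ[k] M)
    (W : A → A → Module.Dual k A → Module.Dual k A → M)
    (hW : ∀ x y f g, W x y f g =
      ∑ i ∈ (ℛ k y).index, V x ((ℛ k y).right i) (translate k A ((ℛ k y).left i) f) g) :
    ∑ a, ∑ b, ∑ c, V (e c * e b) (e a) (e.coord c) (dualMul k A (e.coord b) (e.coord a)) =
      ∑ c, ∑ a, W (e c) (e a) (e.coord c) (e.coord a) := by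
  have h1 : ∀ c, ∑ b, ∑ a, V (e c * e b) (e a) (e.coord c) (dualMul k A (e.coord b) (e.coord a)) =
      ∑ a, ∑ i ∈ (ℛ k (e a)).index, V (e c * (ℛ k (e a)).left i) ((ℛ k (e a)).right i)
        (e.coord c) (e.coord a) := by
    intro c
    have h := sum_comul e (TensorProduct.lift
      ((V ∘ₗ LinearMap.mulLeft k (e c)).compr₂ (LinearMap.applyₗ (e.coord c))))
    simp only [TensorProduct.lift.tmul, LinearMap.compr₂_apply, LinearMap.comp_apply,
      LinearMap.mulLeft_apply, LinearMap.applyₗ_apply_apply] at h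
    rw [h]
    refine Finset.sum_congr rfl fun a _ => ?_
    conv_lhs => rw [← (ℛ k (e a)).eq]
    simp only [map_sum, LinearMap.sum_apply, TensorProduct.lift.tmul, LinearMap.compr₂_apply,
      LinearMap.comp_apply, LinearMap.mulLeft_apply, LinearMap.applyₗ_apply_apply]
  calc _ = ∑ c, ∑ b, ∑ a, V (e c * e b) (e a) (e.coord c)
          (dualMul k A (e.coord b) (e.coord a)) := by
        rw [Finset.sum_comm]
        exact (Finset.sum_congr rfl fun b _ => Finset.sum_comm).trans Finset.sum_comm
    _ = ∑ a, ∑ i ∈ (ℛ k (e a)).index, ∑ c, V (e c * (ℛ k (e a)).left i) ((ℛ k (e a)).right i)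
          (e.coord c) (e.coord a) := by
        simp only [h1]
        exact Finset.sum_comm.trans (Finset.sum_congr rfl fun a _ => Finset.sum_comm)
    _ = ∑ a, ∑ i ∈ (ℛ k (e a)).index, ∑ c, V (e c) ((ℛ k (e a)).right i)
          (translate k A ((ℛ k (e a)).left i) (e.coord c)) (e.coord a) := by
        refine Finset.sum_congr rfl fun a _ => Finset.sum_congr rfl fun i _ => ?_
        exact sum_transfer e ((V.flip ((ℛ k (e a)).right i)).compr₂
          (LinearMap.applyₗ (e.coord a))) (LinearMap.mulRight k ((ℛ k (e a)).left i))
    _ = _ := by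
        simp only [hW]
        exact ((Finset.sum_congr rfl fun a _ => Finset.sum_comm).trans Finset.sum_comm)

/-- Mirror image of `sum_pentagon_outer`: the second tensor factor $a''$ multiplies on the left, so
a left translation of $e^c$ arises, as required by `comb_underMap_overMap`. -/
theorem sum_pentagon_inner (V : A →ₗ[k] A →ₗ[k] Module.Dual k A →ₗ[k] Module.Dual k A →ₗ[k] M)
    (W : A → A → Module.Dual k A → Module.Dual k A → M)
    (hW : ∀ x y f g, W x y f g =
      ∑ i ∈ (ℛ k y).index, V x ((ℛ k y).left i) (leftTranslate ((ℛ k y).right i) f) g) :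
    ∑ c, ∑ b, ∑ a, V (e b * e c) (e a) (e.coord c) (dualMul k A (e.coord a) (e.coord b)) =
      ∑ a, ∑ c, W (e c) (e a) (e.coord c) (e.coord a) := by
  have h1 : ∀ c, ∑ a, ∑ b, V (e b * e c) (e a) (e.coord c) (dualMul k A (e.coord a) (e.coord b)) =
      ∑ a, ∑ i ∈ (ℛ k (e a)).index, V ((ℛ k (e a)).right i * e c) ((ℛ k (e a)).left i)
        (e.coord c) (e.coord a) := by
    intro c
    have h := sum_comul e (TensorProduct.lift
      ((V ∘ₗ LinearMap.mulRight k (e c)).compr₂ (LinearMap.applyₗ (e.coord c))).flip)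
    simp only [TensorProduct.lift.tmul, LinearMap.compr₂_apply, LinearMap.comp_apply,
      LinearMap.flip_apply, LinearMap.mulRight_apply, LinearMap.applyₗ_apply_apply] at h
    rw [h]
    refine Finset.sum_congr rfl fun a _ => ?_
    conv_lhs => rw [← (ℛ k (e a)).eq]
    simp only [map_sum, LinearMap.sum_apply, TensorProduct.lift.tmul, LinearMap.compr₂_apply,
      LinearMap.flip_apply, LinearMap.comp_apply, LinearMap.mulRight_apply,
      LinearMap.applyₗ_apply_apply]
  calc _ = ∑ c, ∑ a, ∑ b, V (e b * e c) (e a) (e.coord c)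
          (dualMul k A (e.coord a) (e.coord b)) :=
        Finset.sum_congr rfl fun c _ => Finset.sum_comm
    _ = ∑ a, ∑ i ∈ (ℛ k (e a)).index, ∑ c, V ((ℛ k (e a)).right i * e c) ((ℛ k (e a)).left i)
          (e.coord c) (e.coord a) := by
        simp only [h1]
        exact Finset.sum_comm.trans (Finset.sum_congr rfl fun a _ => Finset.sum_comm)
    _ = ∑ a, ∑ i ∈ (ℛ k (e a)).index, ∑ c, V (e c) ((ℛ k (e a)).left i)
          (leftTranslate ((ℛ k (e a)).right i) (e.coord c)) (e.coord a) := by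
        refine Finset.sum_congr rfl fun a _ => Finset.sum_congr rfl fun i _ => ?_
        exact sum_transfer e ((V.flip ((ℛ k (e a)).left i)).compr₂
          (LinearMap.applyₗ (e.coord a))) (LinearMap.mulLeft k ((ℛ k (e a)).right i))
    _ = _ := by
        simp only [hW]
        exact Finset.sum_congr rfl fun a _ => Finset.sum_comm

/-- The product `comb`, as a bilinear map. -/
def combL {R : Type*} [Ring R] [Algebra k R] : Direction → R →ₗ[k] R →ₗ[k] R
  | .down => (LinearMap.mul k R).flip
  | .up => LinearMap.mul k R

theorem combL_apply {R : Type*} [Ring R] [Algebra k R] (d : Direction) (x y : R) :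
    combL (k := k) d x y = comb d x y := by
  cases d <;> rfl

end LabelSums

/-! ### Moves with real crossings -/

section RealMoves

open Coalgebra HopfAlgebra HeisenbergDouble

variable {k A : Type*} [Field k] [Ring A] [HopfAlgebra k A]
  {hγ : Function.Bijective (HopfAlgebra.antipode k : A →ₗ[k] A)}
  {ι : Type*} [Fintype ι] {e : Module.Basis ι k A} {n : ℕ} {μ : Fin n → Thickness}
  {N : Fin n → Type*} [∀ i, AddCommGroup (N i)] [∀ i, Module k (N i)]
  {T : Reading k (fun i => ColorAlgebra k A (μ i)) N}

/-- The crossing of the other kind carries the inverse tensor, by the antipode axioms. The virtual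
case is included and serves as a symmetry move. -/
theorem sameValue_cancel (κ : CrossingKind) (a b : Strand n) :
    SameValue T (label μ hγ e) [[.crossing κ a b], [.crossing κ.swap b a]]
      [[.strand a, .strand b]] 1 := by
  intro l h L hL hL'
  obtain ⟨htame, hsum⟩ := stateSum_double (lab := label μ hγ e) κ κ.swap a b l h hL
  obtain ⟨g, hg⟩ := T.exists_val_mkW₂ a b (h, l) (h + 2, l) (h, l + 1) (h + 2, l + 1) L
  have h1 : stateSum (label μ hγ e) (centre l h [[Piece.crossing κ a b],
      [Piece.crossing κ.swap b a]]) (fun t => T.val (t + L)) =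
      T.val ({mkW a (h, l) (h + 2, l) 1} + {mkW b (h, l + 1) (h + 2, l + 1) 1} + L) := by
    rw [hsum]
    simp only [hg]
    cases κ with
    | slashOver =>
      simp only [crossSum, CrossingKind.swap, label_over, label_under_slashOver,
        label_under_backslashOver, comb_underW, comb_overW]
      rw [Finset.sum_comm]
      refine (sum_antipode_mul e (g.compl₁₂ (underMap k A (μ a.comp) a.dir)
        (overMap hγ (μ b.comp) b.dir))).trans ?_
      rw [LinearMap.compl₁₂_apply, underMap_one, overMap_counit]
      rfl
    | backslashOver =>
      simp only [crossSum, CrossingKind.swap, label_over, label_under_slashOver,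
        label_under_backslashOver, comb_underW, comb_overW]
      rw [Finset.sum_comm]
      refine (sum_mul_antipode e (g.flip.compl₁₂ (underMap k A (μ b.comp) b.dir)
        (overMap hγ (μ a.comp) a.dir))).trans ?_
      rw [LinearMap.compl₁₂_apply, underMap_one, overMap_counit]
      rfl
    | virtual => simp only [crossSum, CrossingKind.swap, comb_one_left]
  have h2 : ∀ F : Multiset (WArc (ℕ × ℕ) n (∀ i, ColorAlgebra k A (μ i))) → PiTensorProduct k N,
      stateSum (label μ hγ e) (centre l h [[.strand a, .strand b]]) F =
        F ({mkW a (h, l) (h + 1, l) 1} + {mkW b (h, l + 1) (h + 1, l + 1) 1}) := by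
    intro F
    simp [-Multiset.singleton_add, centre, rowPlaced, Piece.top, Piece.bot]
  have htame' := hL' ({mkW a (h, l) (h + 1, l) 1} + {mkW b (h, l + 1) (h + 1, l + 1) 1})
    (by simp [-Multiset.singleton_add, centre, rowPlaced, Piece.top, Piece.bot, skel_mkW])
  rw [h1, h2]
  refine Reading.val_lower (lower h 1) htame htame' ?_
  simp only [Multiset.map_add, Multiset.map_singleton, mapPts_mkW, lower_of_le _ le_rfl,
    lower_of_ge _ (show h + 1 ≤ h + 2 by omega)]
  rfl

/-- The sliding strand `s` meets `a` on one side and `a.rev` on the other, at crossings of opposite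
kinds. If `a` is under, $\gamma$ from the kind is compared with $\gamma$ from the direction; if `a`
is over, $\gamma$ on the label of `s` is compared with $\bar\gamma^*$ on that of `a`. They match
when the left leg goes down, and differ by $\gamma^2$ when it goes up. -/
theorem crossSum_slide {M : Type*} [AddCommGroup M] [Module k M] (κ : CrossingKind)
    (s a : Strand n)
    (ha : κ = .virtual ∨ a.dir = .down ∨ (antipode k ∘ₗ antipode k : A →ₗ[k] A) = LinearMap.id)
    (g : ColorAlgebra k A (μ s.comp) →ₗ[k] ColorAlgebra k A (μ a.comp) →ₗ[k] M) :
    (crossSum (label μ hγ e) s.dir a.dir κ fun u v => g (u s.comp) (v a.comp)) =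
      crossSum (label μ hγ e) a.rev.dir s.dir κ.swap fun v u => g (u s.comp) (v a.comp) := by
  obtain ⟨i, d⟩ := a
  cases κ with
  | virtual => rfl
  | slashOver =>
    simp only [crossSum, CrossingKind.swap, label_over, label_under_slashOver,
      label_under_backslashOver]
    change ∑ j, g (underMap k A (μ s.comp) s.dir (e j)) (overMap hγ (μ i) d (e.coord j)) =
      ∑ j, g (underMap k A (μ s.comp) s.dir (antipode k (e j)))
        (overMap hγ (μ i) d.rev (e.coord j))
    -- Moves the antipode from the label of `s` to the dual label of `a`, where it meets the change
    -- of direction.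
    refine Eq.trans ?_ (sum_transfer e (g.compl₁₂ (underMap k A (μ s.comp) s.dir)
      (overMap hγ (μ i) d.rev)) (antipode k)).symm
    refine Finset.sum_congr rfl fun j _ => ?_
    rw [LinearMap.compl₁₂_apply]
    congr 1
    cases d with
    | down =>
      change _ = overMap hγ (μ i) .up _
      rw [overMap_up]
      congr 1
      ext x
      simp [dualAntipodeInv_apply, antipode_antipodeInv]
    | up =>
      have h2 := ha.resolve_left (by simp) |>.resolve_left (by simp)
      change _ = overMap hγ (μ i) .down _
      rw [overMap_up]
      congr 1
      ext x
      obtain ⟨y, rfl⟩ := hγ.2 x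
      have := LinearMap.congr_fun h2 y
      simp only [LinearMap.comp_apply, LinearMap.id_apply] at this
      rw [dualAntipodeInv_apply, antipodeInv_antipode, LinearMap.comp_apply, this]
  | backslashOver =>
    simp only [crossSum, CrossingKind.swap, label_over, label_under_slashOver,
      label_under_backslashOver]
    refine Finset.sum_congr rfl fun j _ => ?_
    congr 1
    change underMap k A (μ i) d (antipode k (e j)) = underMap k A (μ i) d.rev (e j)
    cases d with
    | down => exact (underMap_up _ _).symm
    | up =>
      have h2 := ha.resolve_left (by simp) |>.resolve_left (by simp)
      have := LinearMap.congr_fun h2 (e j)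
      simp only [LinearMap.comp_apply, LinearMap.id_apply] at this
      rw [underMap_up, this]
      rfl

theorem sameValue_slideMax (κ : CrossingKind) (s a : Strand n)
    (ha : κ = .virtual ∨ a.dir = .down ∨ (antipode k ∘ₗ antipode k : A →ₗ[k] A) = LinearMap.id) :
    SameValue T (label μ hγ e) [[.strand s, .max a], [.crossing κ s a, .strand a.rev]]
      [[.max a, .strand s], [.strand a, .crossing κ.swap a.rev s]] 0 := by
  refine sameValue_of_eq fun l h L hL hL' => ?_
  rw [stateSum_maxRight _ _ _ _ _ hL, stateSum_maxLeft _ _ _ _ _ hL']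
  obtain ⟨g, hg⟩ := T.exists_val_mkW₂ s a (h, l) (h + 2, l + 1) (h + 2, l + 2) (h + 2, l) L
  simp only [hg]
  exact crossSum_slide κ s a ha g

theorem sameValue_slideMin (κ : CrossingKind) (s a : Strand n)
    (ha : κ = .virtual ∨ a.dir = .up ∨ (antipode k ∘ₗ antipode k : A →ₗ[k] A) = LinearMap.id) :
    SameValue T (label μ hγ e) [[.crossing κ a s, .strand a.rev], [.strand s, .min a]]
      [[.strand a, .crossing κ.swap s a.rev], [.min a, .strand s]] 0 := by
  refine sameValue_of_eq fun l h L hL hL' => ?_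
  rw [stateSum_minLeft _ _ _ _ _ hL, stateSum_minRight _ _ _ _ _ hL']
  obtain ⟨g, hg⟩ := T.exists_val_mkW₂ s a (h, l + 1) (h + 2, l) (h, l) (h, l + 2) L
  simp only [hg]
  -- At a minimum the exchange of legs is the one at a maximum read backwards, with `a.rev` in place
  -- of `a` and the other kind of crossing.
  have := crossSum_slide (hγ := hγ) (e := e) κ.swap s a.rev (ha.imp (fun h => by rw [h]; rfl)
    (Or.imp_left fun h => by rw [Strand.rev, h]; rfl)) g
  rw [show a.rev.rev.dir = a.dir from rev_rev a.dir] at this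
  cases κ <;> exact this.symm

/-- On the left `m` is met first as under and then as over strand, on the right in the opposite
order. Commuting these two labels produces exactly the additional crossing of `x` and `y`. -/
theorem sameValue_pachnerOuter (x m y : Strand n)
    (h : (μ m.comp = .thin ∧ m.dir = .down) ∨ (μ m.comp = .thick ∧ m.dir = .up)) :
    SameValue T (label μ hγ e)
      [[.strand x, .crossing .slashOver m y], [.crossing .slashOver x y, .strand m],
        [.strand y, .crossing .slashOver x m]]
      [[.crossing .slashOver x m, .strand y], [.strand m, .crossing .virtual x y],
        [.crossing .slashOver m y, .strand x]] 0 := by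
  refine sameValue_of_eq fun l q L hL hL' => ?_
  rw [stateSum_outer _ _ _ _ _ _ _ _ hL, stateSum_inner _ _ _ _ _ _ _ _ hL']
  obtain ⟨g, hg⟩ := T.exists_val_mkW₃ x m y (q, l) (q + 3, l + 2) (q, l + 1) (q + 3, l + 1)
    (q, l + 2) (q + 3, l) L
  simp only [hg, crossSum, label_over, label_under_slashOver, comb_underW, comb_overW,
    comb_one_left, comb_one_right]
  let V : A →ₗ[k] A →ₗ[k] Module.Dual k A →ₗ[k] Module.Dual k A →ₗ[k] PiTensorProduct k N :=
    LinearMap.mk₂ k (fun a b => ((g (underMap k A (μ x.comp) x.dir a)).compl₁₂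
        (combL m.dir (underMap k A (μ m.comp) m.dir b) ∘ₗ overMap hγ (μ m.comp) m.dir)
        (overMap hγ (μ y.comp) y.dir)))
      (fun a a' b => by ext; simp) (fun c a b => by ext; simp)
      (fun a b b' => by ext; simp) (fun c a b => by ext; simp)
  refine (Eq.trans ?_ (sum_pentagon_outer e V (fun a b f f' =>
    g (underMap k A (μ x.comp) x.dir a) (comb m.dir (overMap hγ (μ m.comp) m.dir f)
      (underMap k A (μ m.comp) m.dir b)) (overMap hγ (μ y.comp) y.dir f')) ?_)).trans ?_
  · refine Finset.sum_congr rfl fun a _ => Finset.sum_congr rfl fun b _ =>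
      Finset.sum_congr rfl fun c _ => ?_
    simp only [V, LinearMap.mk₂_apply, LinearMap.compl₁₂_apply, LinearMap.comp_apply, combL_apply,
      comb_apply]
    rfl
  · intro a b f f'
    rw [comb_overMap_underMap hγ h f (ℛ k b)]
    simp only [V, LinearMap.mk₂_apply, LinearMap.compl₁₂_apply, LinearMap.comp_apply, combL_apply,
      map_sum, LinearMap.sum_apply]
  · simp only [comb_apply]
    rfl

theorem sameValue_pachnerInner (x m y : Strand n)
    (h : (μ m.comp = .thick ∧ m.dir = .down) ∨ (μ m.comp = .thin ∧ m.dir = .up)) :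
    SameValue T (label μ hγ e)
      [[.crossing .slashOver x m, .strand y], [.strand m, .crossing .slashOver x y],
        [.crossing .slashOver m y, .strand x]]
      [[.strand x, .crossing .slashOver m y], [.crossing .virtual x y, .strand m],
        [.strand y, .crossing .slashOver x m]] 0 := by
  refine sameValue_of_eq fun l q L hL hL' => ?_
  rw [stateSum_inner _ _ _ _ _ _ _ _ hL, stateSum_outer _ _ _ _ _ _ _ _ hL']
  obtain ⟨g, hg⟩ := T.exists_val_mkW₃ x m y (q, l) (q + 3, l + 2) (q, l + 1) (q + 3, l + 1)
    (q, l + 2) (q + 3, l) L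
  simp only [hg, crossSum, label_over, label_under_slashOver, comb_underW, comb_overW,
    comb_one_left, comb_one_right]
  let V : A →ₗ[k] A →ₗ[k] Module.Dual k A →ₗ[k] Module.Dual k A →ₗ[k] PiTensorProduct k N :=
    LinearMap.mk₂ k (fun a b => ((g (underMap k A (μ x.comp) x.dir a)).compl₁₂
        ((combL m.dir).flip (underMap k A (μ m.comp) m.dir b) ∘ₗ overMap hγ (μ m.comp) m.dir)
        (overMap hγ (μ y.comp) y.dir)))
      (fun a a' b => by ext; simp) (fun c a b => by ext; simp)
      (fun a b b' => by ext; simp) (fun c a b => by ext; simp)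
  refine (Eq.trans ?_ (sum_pentagon_inner e V (fun a b f f' =>
    g (underMap k A (μ x.comp) x.dir a) (comb m.dir (underMap k A (μ m.comp) m.dir b)
      (overMap hγ (μ m.comp) m.dir f)) (overMap hγ (μ y.comp) y.dir f')) ?_)).trans ?_
  · refine Finset.sum_congr rfl fun a _ => Finset.sum_congr rfl fun b _ =>
      Finset.sum_congr rfl fun c _ => ?_
    simp only [V, LinearMap.mk₂_apply, LinearMap.compl₁₂_apply, LinearMap.comp_apply,
      LinearMap.flip_apply, combL_apply, comb_apply]
    rfl
  · intro a b f f'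
    rw [comb_underMap_overMap hγ h f (ℛ k b)]
    simp only [V, LinearMap.mk₂_apply, LinearMap.compl₁₂_apply, LinearMap.comp_apply,
      LinearMap.flip_apply, combL_apply, map_sum, LinearMap.sum_apply]
  · simp only [comb_apply]
    rfl

end RealMoves

/-! ### Moves of rows -/

section Rows

variable {n : ℕ} {ι : Type*} [Fintype ι]

/-! ### Rows spread over two levels -/

section Expand

variable {B M : Type*} [One B] [AddCommMonoid M] {lab : Bool → CrossingKind → Direction → ι → B}

theorem eq_of_mem_lines {f : ℕ × ℕ → ℕ × ℕ} {h t h' u : ℕ} {v : List (Strand n)}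
    (hf : ∀ j < v.length, f (h, t + j) = f (h', u + j)) {x : WArc (ℕ × ℕ) n B}
    (hx : x ∈ lines h t h' u v) : f x.src = f x.tgt ∧ x.w = 1 := by
  induction v generalizing t u with
  | nil => simp [lines] at hx
  | cons a v ih =>
    rw [lines, Multiset.mem_add, Multiset.mem_singleton] at hx
    rcases hx with rfl | hx
    · have h0 := hf 0 (by simp)
      simp only [add_zero] at h0
      unfold mkW
      split
      · exact ⟨h0, rfl⟩
      · exact ⟨h0.symm, rfl⟩
    · refine ih (fun j hj => ?_) hx
      rw [add_assoc, add_assoc]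
      exact hf _ (by simp only [List.length_cons]; omega)

theorem stateSum_leftFirst (h : ℕ) (p q : Row n) (F : Multiset (WArc (ℕ × ℕ) n B) → M) :
    stateSum lab (stackPlaced h [p ++ idRow (Row.top q), idRow (Row.bot p) ++ q]) F =
      stateSum lab (rowPlaced h 0 0 p ++
        rowPlaced (h + 1) (Row.bot p).length (Row.bot p).length q) fun x =>
          F (x + (lines h (Row.top p).length (h + 1) (Row.bot p).length (Row.top q) +
            lines (h + 1) 0 (h + 1 + 1) 0 (Row.bot p))) := by
  simp only [stackPlaced, List.append_nil, rowPlaced_append, stateSum_append, stateSum_idRow,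
    rowTop_idRow, rowBot_idRow, zero_add]
  refine congrArg (stateSum lab _) (funext fun x => congrArg (stateSum lab _)
    (funext fun y => congrArg F ?_))
  ac_rfl

theorem stateSum_rightFirst (h : ℕ) (p q : Row n) (F : Multiset (WArc (ℕ × ℕ) n B) → M) :
    stateSum lab (stackPlaced h [idRow (Row.top p) ++ q, p ++ idRow (Row.bot q)]) F =
      stateSum lab (rowPlaced (h + 1) 0 0 p ++
        rowPlaced h (Row.top p).length (Row.top p).length q) fun x =>
          F (x + (lines h 0 (h + 1) 0 (Row.top p) +
            lines (h + 1) (Row.top p).length (h + 1 + 1) (Row.bot p).length (Row.bot q))) := by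
  simp only [stackPlaced, List.append_nil, rowPlaced_append, stateSum_append, stateSum_idRow,
    rowTop_idRow, rowBot_idRow, zero_add]
  -- Now `q` lies in the upper row, but the sums are to be listed with `p` first, as in the joined
  -- row.
  rw [stateSum_comm]
  refine congrArg (stateSum lab _) (funext fun x => congrArg (stateSum lab _)
    (funext fun y => congrArg F ?_))
  ac_rfl

/-- The joined row consists of the same pieces `p` and `q`, placed anywhere, once `f` has carried
their points to the common row. -/
theorem stateSum_join {f : ℕ × ℕ → ℕ × ℕ} {h h₁ t₁ u₁ h₂ t₂ u₂ : ℕ} {p q : Row n}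
    (ht₁ : ∀ j < (Row.top p).length, f (h₁, t₁ + j) = (h, j))
    (hu₁ : ∀ j < (Row.bot p).length, f (h₁ + 1, u₁ + j) = (h + 1, j))
    (ht₂ : ∀ j < (Row.top q).length, f (h₂, t₂ + j) = (h, (Row.top p).length + j))
    (hu₂ : ∀ j < (Row.bot q).length, f (h₂ + 1, u₂ + j) = (h + 1, (Row.bot p).length + j))
    (F : Multiset (WArc (ℕ × ℕ) n B) → M) :
    stateSum lab (stackPlaced h [p ++ q]) F =
      stateSum lab (rowPlaced h₁ t₁ u₁ p ++ rowPlaced h₂ t₂ u₂ q) fun x =>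
        F (x.map (WArc.mapPts f)) := by
  simp only [stackPlaced, List.append_nil, rowPlaced_append, stateSum_append, zero_add,
    Multiset.map_add]
  rw [stateSum_relocate_row (f := f) p (t' := 0) (u' := 0) (by simpa using ht₁)
    (by simpa using hu₁)]
  simp only [stateSum_relocate_row (f := f) q ht₂ hu₂]

end Expand

variable {k : Type*} [Field k] {R N : Fin n → Type*} [∀ i, Ring (R i)]
  [∀ i, Algebra k (R i)] [∀ i, AddCommGroup (N i)] [∀ i, Module k (N i)]
  {T : Reading k R N} {lab : Bool → CrossingKind → Direction → ι → ∀ i, R i}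
  {above below : List (Row n)}

/-- For moves in which arbitrary pieces are kept and only vertical strands disappear. The pieces
`ps` are common to both sides, and `V` consists of the strands that `f` shrinks to points; no strand
has to be followed through the pieces. -/
theorem stateSum_collapse {S S' : List (Row n)} (f : ℕ × ℕ → ℕ × ℕ)
    (hA : ∀ i ≤ above.length, ∀ j, f (i, j) = (i, j))
    (hB : ∀ i j, f (above.length + S.length + i, j) = (above.length + S'.length + i, j))
    (hZ : Tame T.cl (skelOf (stackPlaced 0 (above ++ S ++ below))))
    (hZ' : Tame T.cl (skelOf (stackPlaced 0 (above ++ S' ++ below))))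
    (ps : List (PlacedPiece n)) (V : Multiset (WArc (ℕ × ℕ) n (∀ i, R i)))
    (hS : ∀ F : Multiset (WArc (ℕ × ℕ) n (∀ i, R i)) → PiTensorProduct k N,
      stateSum lab (stackPlaced above.length S) F = stateSum lab ps fun x => F (x + V))
    (hS₀ : skelOf (stackPlaced above.length S) = skelOf ps + V.map WArc.skel)
    (hS' : ∀ F : Multiset (WArc (ℕ × ℕ) n (∀ i, R i)) → PiTensorProduct k N,
      stateSum lab (stackPlaced above.length S') F =
        stateSum lab ps fun x => F (x.map (WArc.mapPts f)))
    (hS₀' : skelOf (stackPlaced above.length S') = (skelOf ps).map (WArc.mapPts f))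
    (hV : ∀ x ∈ V, f x.src = f x.tgt ∧ x.w = 1) :
    stateSum lab (stackPlaced 0 (above ++ S ++ below)) T.val =
      stateSum lab (stackPlaced 0 (above ++ S' ++ below)) T.val := by
  refine stateSum_local f hA hB hZ hZ' fun L hL hL' => ?_
  rw [hS, hS']
  refine stateSum_congr fun x hx => ?_
  have h1 := hL (x + V) (by rw [Multiset.map_add, hx, hS₀])
  have h2 := hL' (x.map (WArc.mapPts f)) (by
    rw [hS₀', ← hx, Multiset.map_map, Multiset.map_map]
    rfl)
  rw [add_right_comm] at h1 ⊢
  rw [← Multiset.map_add] at h2 ⊢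
  exact T.val_collapse f h1 h2 hV

/-- After the deletion no local arc is left into which strands could be merged, so the whole row is
shrunk instead. -/
theorem stateSum_insert_idRow (w : List (Strand n))
    (hZ : Tame T.cl (skelOf (stackPlaced 0 (above ++ [idRow w] ++ below))))
    (hZ' : Tame T.cl (skelOf (stackPlaced 0 (above ++ [] ++ below)))) :
    stateSum lab (stackPlaced 0 (above ++ [idRow w] ++ below)) T.val =
      stateSum lab (stackPlaced 0 (above ++ [] ++ below)) T.val := by
  refine stateSum_collapse (lower above.length 1) (fun i hi j => lower_of_le j hi)
    (fun i j => ?_) hZ hZ' [] (lines above.length 0 (above.length + 1) 0 w) (fun F => ?_) ?_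
    (fun F => rfl) rfl fun x hx => ?_
  · rw [lower_of_ge j (by simp only [List.length_singleton]; omega)]
    simp only [List.length_singleton, List.length_nil, Prod.mk.injEq, and_true]
    omega
  · simp only [stackPlaced, List.append_nil, stateSum_idRow, stateSum_nil, zero_add]
  · rw [skel_lines]
    have := stateSum_idRow (lab := fun _ _ _ (_ : Unit) => ()) above.length 0 0 w id
    rw [stateSum_unit] at this
    simpa [stackPlaced] using this
  · refine eq_of_mem_lines (fun j _ => ?_) hx
    rw [lower_of_le _ le_rfl, lower_of_ge _ le_rfl]
    rfl

/-- Move the points below the line `h + 1` up by one line, and the points on this line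
as prescribed by `φ`. -/
def squash (h : ℕ) (φ : ℕ → ℕ × ℕ) (x : ℕ × ℕ) : ℕ × ℕ :=
  if x.1 ≤ h then x else if x.1 = h + 1 then φ x.2 else (x.1 - 1, x.2)

theorem squash_of_le {h i : ℕ} (φ : ℕ → ℕ × ℕ) (hi : i ≤ h) (j : ℕ) :
    squash h φ (i, j) = (i, j) := by
  simp [squash, hi]

theorem squash_succ (h : ℕ) (φ : ℕ → ℕ × ℕ) (j : ℕ) : squash h φ (h + 1, j) = φ j := by
  simp [squash]

theorem squash_of_ge (h i : ℕ) (φ : ℕ → ℕ × ℕ) (j : ℕ) :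
    squash h φ (h + 2 + i, j) = (h + 1 + i, j) := by
  unfold squash
  rw [if_neg (by simp only; omega), if_neg (by simp only; omega)]
  simp only [Prod.mk.injEq, and_true]
  omega

theorem stateSum_join_leftFirst (p q : Row n)
    (hZ : Tame T.cl (skelOf (stackPlaced 0
      (above ++ [p ++ idRow (Row.top q), idRow (Row.bot p) ++ q] ++ below))))
    (hZ' : Tame T.cl (skelOf (stackPlaced 0 (above ++ [p ++ q] ++ below)))) :
    stateSum lab (stackPlaced 0
        (above ++ [p ++ idRow (Row.top q), idRow (Row.bot p) ++ q] ++ below)) T.val =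
      stateSum lab (stackPlaced 0 (above ++ [p ++ q] ++ below)) T.val := by
  set h := above.length with hh
  -- On the middle line the left points are the bottom of `p` and stay on the lower line. The right
  -- points are the top of `q`; they move to the upper line, behind the top points of `p`.
  set f := squash h fun j => if j < (Row.bot p).length then (h + 1, j)
    else (h, (Row.top p).length + (j - (Row.bot p).length)) with hf
  have f₀ : ∀ j, f (h, j) = (h, j) := fun j => squash_of_le _ le_rfl j
  have f₁ : ∀ j < (Row.bot p).length, f (h + 1, j) = (h + 1, j) := fun j hj => by
    rw [hf, squash_succ, if_pos hj]
  have f₂ : ∀ j, f (h + 1, (Row.bot p).length + j) = (h, (Row.top p).length + j) := fun j => by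
    rw [hf, squash_succ, if_neg (by omega), Nat.add_sub_cancel_left]
  have f₃ : ∀ i j, f (h + 2 + i, j) = (h + 1 + i, j) := fun i j => squash_of_ge h i _ j
  have g₁ : ∀ j < (Row.top p).length, f (h, 0 + j) = (h, j) := fun j _ => by rw [zero_add, f₀]
  have g₂ : ∀ j < (Row.bot p).length, f (h + 1, 0 + j) = (h + 1, j) := fun j hj => by
    rw [zero_add, f₁ j hj]
  refine stateSum_collapse f (fun i hi j => squash_of_le _ hi j) (fun i j => f₃ i j) hZ hZ' _ _
    (fun F => stateSum_leftFirst h p q F) ?_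
    (fun F => stateSum_join g₁ g₂ (fun j _ => f₂ j) (fun j _ => f₃ 0 _) F) ?_ fun x hx => ?_
  · have := stateSum_leftFirst (lab := fun _ _ _ (_ : Unit) => ()) h p q id
    rw [stateSum_unit, stateSum_unit] at this
    rw [Multiset.map_add, skel_lines, skel_lines]
    exact this
  · have := stateSum_join (lab := fun _ _ _ (_ : Unit) => ()) (q := q) g₁ g₂ (fun j _ => f₂ j)
      (fun j _ => f₃ 0 _) id
    rwa [stateSum_unit, stateSum_unit] at this
  · rcases Multiset.mem_add.1 hx with hx | hx
    · exact eq_of_mem_lines (fun j _ => by rw [f₀, f₂]) hx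
    · refine eq_of_mem_lines (fun j hj => ?_) hx
      rw [zero_add, f₁ j hj]
      exact (f₃ 0 j).symm

theorem stateSum_join_rightFirst (p q : Row n)
    (hZ : Tame T.cl (skelOf (stackPlaced 0
      (above ++ [idRow (Row.top p) ++ q, p ++ idRow (Row.bot q)] ++ below))))
    (hZ' : Tame T.cl (skelOf (stackPlaced 0 (above ++ [p ++ q] ++ below)))) :
    stateSum lab (stackPlaced 0
        (above ++ [idRow (Row.top p) ++ q, p ++ idRow (Row.bot q)] ++ below)) T.val =
      stateSum lab (stackPlaced 0 (above ++ [p ++ q] ++ below)) T.val := by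
  set h := above.length with hh
  -- Here the left points of the middle line are the top of `p` and move up, while the right points
  -- are the bottom of `q` and are placed behind the bottom points of `p`.
  set f := squash h fun j => if j < (Row.top p).length then (h, j)
    else (h + 1, (Row.bot p).length + (j - (Row.top p).length)) with hf
  have f₀ : ∀ j, f (h, j) = (h, j) := fun j => squash_of_le _ le_rfl j
  have f₁ : ∀ j < (Row.top p).length, f (h + 1, j) = (h, j) := fun j hj => by
    rw [hf, squash_succ, if_pos hj]
  have f₂ : ∀ j, f (h + 1, (Row.top p).length + j) = (h + 1, (Row.bot p).length + j) :=
    fun j => by rw [hf, squash_succ, if_neg (by omega), Nat.add_sub_cancel_left]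
  have f₃ : ∀ i j, f (h + 2 + i, j) = (h + 1 + i, j) := fun i j => squash_of_ge h i _ j
  have g₁ : ∀ j < (Row.top p).length, f (h + 1, 0 + j) = (h, j) := fun j hj => by
    rw [zero_add, f₁ j hj]
  have g₂ : ∀ j < (Row.bot p).length, f (h + 1 + 1, 0 + j) = (h + 1, j) := fun j _ => by
    rw [zero_add]
    exact f₃ 0 j
  refine stateSum_collapse f (fun i hi j => squash_of_le _ hi j) (fun i j => f₃ i j) hZ hZ' _ _
    (fun F => stateSum_rightFirst h p q F) ?_
    (fun F => stateSum_join g₁ g₂ (fun j _ => f₀ _) (fun j _ => f₂ j) F) ?_ fun x hx => ?_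
  · have := stateSum_rightFirst (lab := fun _ _ _ (_ : Unit) => ()) h p q id
    rw [stateSum_unit, stateSum_unit] at this
    rw [Multiset.map_add, skel_lines, skel_lines]
    exact this
  · have := stateSum_join (lab := fun _ _ _ (_ : Unit) => ()) (q := q) g₁ g₂ (fun j _ => f₀ _)
      (fun j _ => f₂ j) id
    rwa [stateSum_unit, stateSum_unit] at this
  · rcases Multiset.mem_add.1 hx with hx | hx
    · exact eq_of_mem_lines (fun j hj => by rw [zero_add, f₀, f₁ j hj]) hx
    · refine eq_of_mem_lines (fun j hj => ?_) hx
      rw [f₂]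
      exact (f₃ 0 _).symm

end Rows

/-! ### Invariance -/

section Invariance

variable {k A : Type*} [Field k] [Ring A] [HopfAlgebra k A]
  (hγ : Function.Bijective (HopfAlgebra.antipode k : A →ₗ[k] A))
  {ι : Type*} [Fintype ι] (e : Module.Basis ι k A) {n : ℕ} {μ : Fin n → Thickness}
  {ν : Fin n → ComponentType}

theorem SameValue.JPrime_eq {above below : List (Row n)} {left right : List (Strand n)}
    {S S' : List (Row n)} {d : ℕ} {Z Z' : ColoredDiagram μ ν}
    (H : SameValue (reading k A μ ν) (label μ hγ e) S S' d)
    (hZ : Z.rows = above ++ S.map (fun r => idRow left ++ r ++ idRow right) ++ below)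
    (hZ' : Z'.rows = above ++ S'.map (fun r => idRow left ++ r ++ idRow right) ++ below)
    (hS : S ≠ []) (hS' : S' ≠ []) {t b : ℕ} (hfit : Fits t S b) (hfit' : Fits t S' b)
    (hd : S.length = S'.length + d) : JPrime hγ e Z = JPrime hγ e Z' := by
  have h := Z.tame
  have h' := Z'.tame
  rw [ColoredDiagrams.JPrime_eq, ColoredDiagrams.JPrime_eq, hZ, hZ']
  rw [hZ] at h
  rw [hZ'] at h'
  exact H.stateSum_eq hS hS' hfit hfit' hd h h'

theorem idRow_append (v w : List (Strand n)) : idRow (v ++ w) = idRow v ++ idRow w := by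
  simp [idRow]

/-- The disjunction in the hypothesis covers both claims of the theorem at once. It is consulted
only for real slides, where it supplies either the favourable orientation or $\gamma^2=1$. -/
theorem JPrime_eq_of_localMove {Z Z' : ColoredDiagram μ ν}
    (h : LocalMove (fun S S' => ColoredMove μ S S' ∧ (¬ ExceptionalMove μ S S' ∨
      (HopfAlgebra.antipode k ∘ₗ HopfAlgebra.antipode k : A →ₗ[k] A) = LinearMap.id)) Z Z') :
    JPrime hγ e Z = JPrime hγ e Z' := by
  obtain ⟨above, below, left, right, S, S', ⟨hM, hx⟩, hZ, hZ'⟩ := h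
  have hT := Z.tame
  have hT' := Z'.tame
  cases hM with
  | pachner m h =>
    cases h with
    | outerFirst x y h =>
      exact (sameValue_pachnerOuter x m y h).JPrime_eq hγ e hZ hZ' (by simp) (by simp)
        ⟨rfl, rfl, rfl, rfl⟩ ⟨rfl, rfl, rfl, rfl⟩ rfl
    | innerFirst x y h =>
      exact (sameValue_pachnerInner x m y h).JPrime_eq hγ e hZ hZ' (by simp) (by simp)
        ⟨rfl, rfl, rfl, rfl⟩ ⟨rfl, rfl, rfl, rfl⟩ rfl
  | zeroTwo h =>
    cases h with
    | cancel κ hκ a b =>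
      exact (sameValue_cancel κ a b).JPrime_eq hγ e hZ hZ' (by simp) (by simp)
        ⟨rfl, rfl, rfl⟩ ⟨rfl, rfl⟩ rfl
  | symmetry h =>
    cases h with
    | kinkRight a =>
      exact (sameValue_kinkRight a).JPrime_eq hγ e hZ hZ' (by simp) (by simp)
        ⟨rfl, rfl, rfl, rfl⟩ ⟨rfl, rfl⟩ rfl
    | kinkLeft a =>
      exact (sameValue_kinkLeft a).JPrime_eq hγ e hZ hZ' (by simp) (by simp)
        ⟨rfl, rfl, rfl, rfl⟩ ⟨rfl, rfl⟩ rfl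
    | involution a b =>
      exact (sameValue_cancel .virtual a b).JPrime_eq hγ e hZ hZ' (by simp) (by simp)
        ⟨rfl, rfl, rfl⟩ ⟨rfl, rfl⟩ rfl
    | naturality κ a b c =>
      exact (sameValue_naturality κ a b c).JPrime_eq hγ e hZ hZ' (by simp) (by simp)
        ⟨rfl, rfl, rfl, rfl⟩ ⟨rfl, rfl, rfl, rfl⟩ rfl
  | planar h =>
    cases h with
    | identity w =>
      simp only [List.map_cons, List.map_nil, ← idRow_append] at hZ hZ'
      rw [hZ] at hT
      rw [hZ'] at hT'
      rw [JPrime_eq, JPrime_eq, hZ, hZ']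
      exact stateSum_insert_idRow (T := reading k A μ ν) _ hT hT'
    | leftFirst p q =>
      -- The vertical strands on the left are absorbed into `p` and those on the right into `q`, so
      -- the move has the same form without a surrounding on the sides.
      have e₀ : idRow left ++ (p ++ q) ++ idRow right =
          (idRow left ++ p) ++ (q ++ idRow right) := by
        simp
      have e₁ : idRow left ++ (p ++ idRow (Row.top q)) ++ idRow right =
          (idRow left ++ p) ++ idRow (Row.top (q ++ idRow right)) := by
        simp [idRow_append]
      have e₂ : idRow left ++ (idRow (Row.bot p) ++ q) ++ idRow right =
          idRow (Row.bot (idRow left ++ p)) ++ (q ++ idRow right) := by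
        simp [idRow_append]
      simp only [List.map_cons, List.map_nil, e₀, e₁, e₂] at hZ hZ'
      rw [hZ] at hT
      rw [hZ'] at hT'
      rw [JPrime_eq, JPrime_eq, hZ, hZ']
      exact (stateSum_join_leftFirst (T := reading k A μ ν) _ _ hT' hT).symm
    | rightFirst p q =>
      have e₀ : idRow left ++ (p ++ q) ++ idRow right =
          (idRow left ++ p) ++ (q ++ idRow right) := by
        simp
      have e₁ : idRow left ++ (idRow (Row.top p) ++ q) ++ idRow right =
          idRow (Row.top (idRow left ++ p)) ++ (q ++ idRow right) := by
        simp [idRow_append]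
      have e₂ : idRow left ++ (p ++ idRow (Row.bot q)) ++ idRow right =
          (idRow left ++ p) ++ idRow (Row.bot (q ++ idRow right)) := by
        simp [idRow_append]
      simp only [List.map_cons, List.map_nil, e₀, e₁, e₂] at hZ hZ'
      rw [hZ] at hT
      rw [hZ'] at hT'
      rw [JPrime_eq, JPrime_eq, hZ, hZ']
      exact (stateSum_join_rightFirst (T := reading k A μ ν) _ _ hT' hT).symm
    | zigzagRight a =>
      exact (sameValue_zigzagRight a).JPrime_eq hγ e hZ hZ' (by simp) (by simp)
        ⟨rfl, rfl, rfl⟩ ⟨rfl, rfl⟩ rfl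
    | zigzagLeft a =>
      exact (sameValue_zigzagLeft a).JPrime_eq hγ e hZ hZ' (by simp) (by simp)
        ⟨rfl, rfl, rfl⟩ ⟨rfl, rfl⟩ rfl
    | slideMax κ s a =>
      refine (sameValue_slideMax κ s a ?_).JPrime_eq hγ e hZ hZ' (by simp) (by simp)
        ⟨rfl, rfl, rfl⟩ ⟨rfl, rfl, rfl⟩ rfl
      by_cases hκ : κ = .virtual
      · exact Or.inl hκ
      · refine Or.inr (hx.imp_left fun hx => ?_)
        cases ha : a.dir with
        | down => rfl
        | up => exact absurd (.slideMax κ hκ s a ha) hx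
    | slideMin κ s a =>
      refine (sameValue_slideMin κ s a ?_).JPrime_eq hγ e hZ hZ' (by simp) (by simp)
        ⟨rfl, rfl, rfl⟩ ⟨rfl, rfl, rfl⟩ rfl
      by_cases hκ : κ = .virtual
      · exact Or.inl hκ
      · refine Or.inr (hx.imp_left fun hx => ?_)
        cases ha : a.dir with
        | up => rfl
        | down => exact absurd (.slideMin κ hκ s a ha) hx

theorem JPrime_eq_of_eqvGen {M : List (Row n) → List (Row n) → Prop}
    (hM : ∀ S S', M S S' → ColoredMove μ S S' ∧ (¬ ExceptionalMove μ S S' ∨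
      (HopfAlgebra.antipode k ∘ₗ HopfAlgebra.antipode k : A →ₗ[k] A) = LinearMap.id))
    {Z Z' : ColoredDiagram μ ν} (h : Relation.EqvGen (LocalMove M) Z Z') :
    JPrime hγ e Z = JPrime hγ e Z' := by
  induction h with
  | rel Z Z' h =>
    obtain ⟨above, below, left, right, S, S', h, hZ, hZ'⟩ := h
    exact JPrime_eq_of_localMove hγ e ⟨above, below, left, right, S, S', hM S S' h, hZ, hZ'⟩
  | refl Z => rfl
  | symm Z Z' _ ih => exact ih.symm
  | trans Z Z' Z'' _ _ ih ih' => exact ih.trans ih'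

end Invariance

end ColoredDiagrams

end

open ColoredDiagrams in
theorem theorem5p1 {k A : Type*} [Field k] [Ring A] [HopfAlgebra k A]
    (hγ : Function.Bijective (HopfAlgebra.antipode k : A →ₗ[k] A))
    {ι : Type*} [Fintype ι] (e : Module.Basis ι k A)
    {n : ℕ} (μ : Fin n → Thickness) (ν : Fin n → ComponentType) :
    (∀ Z Z' : ColoredDiagram μ ν,
      RestrictedColoredEquiv Z Z' → JPrime hγ e Z = JPrime hγ e Z') ∧
    ((HopfAlgebra.antipode k ∘ₗ HopfAlgebra.antipode k : A →ₗ[k] A) = LinearMap.id →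
      ∀ Z Z' : ColoredDiagram μ ν,
        ColoredEquiv Z Z' → JPrime hγ e Z = JPrime hγ e Z') :=
  ⟨fun _ _ h => JPrime_eq_of_eqvGen hγ e (fun _ _ h => ⟨h.1, Or.inl h.2⟩) h,
    fun h2 _ _ h => JPrime_eq_of_eqvGen hγ e (fun _ _ h => ⟨h, Or.inr h2⟩) h⟩
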